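/- **Setting.** Let $\varepsilon_0>0$, $L_0\in\mathbb N$, $L_0\ge1$, and for $N\in\mathbb N_0$ put $\varepsilon_N=2^{-N}\varepsilon_0$, $L_N=2^NL_0$, $L=\varepsilon_0L_0=\varepsilon_NL_N$, $\Lambda_N=\varepsilon_N\{-L_N,\dots,L_N-1\}$, $\mathfrak h_N=\ell^2(\Lambda_N)$ with $\langle\xi,\eta\rangle_N=\sum_{x\in\Lambda_N}\overline{\xi_x}\,\eta_x$, and $\mathfrak h_\infty=L^2([-L,L))$ ($L^2$ of the circle of length $2L$), both complex. Fix a boundary condition $\theta\in\{1,-1\}$ (periodic or anti-periodic), put $\delta=0$ if $\theta=1$ and $\delta=\tfrac12$ if $\theta=-1$, and let $$\Gamma_\infty=\tfrac{\pi}{L}(\mathbb Z+\delta),\qquad \Gamma_N=\tfrac{\pi}{L}\big(\{-L_N,\dots,L_N-1\}+\delta\big),\qquad e_l(x)=e^{ilx},$$ $e_l$ being regarded as an element of $\mathfrak h_N$ or of $\mathfrak h_\infty$ (not normalized). Fix a chirality $\pm$ and $k\in\frac{\pi}{L}\mathbb Z$. For a Hilbert space $\mathfrak h$ let $\mathfrak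 F_{\rm a}(\mathfrak h)$ be the anti-symmetric Fock space with vacuum $\Omega_0$ and creation and annihilation operators $a^\dagger(\xi)$, $a(\xi)=a^\dagger(\xi)^*$, $\{a(\xi),a^\dagger(\eta)\}=\langle\xi,\eta\rangle$. The $a^\sharp(\xi)$ also denote the generators of the CAR algebra of $\mathfrak h$, which acts on $\mathfrak F_{\rm a}(\mathfrak h)$ by the Fock representation. For a subspace $\mathcal D\subset\mathfrak h$ let $\mathfrak F^{\rm alg}_{\rm a}(\mathcal D)$ be the linear span of the vectors $a^\dagger(\xi_1)\cdots a^\dagger(\xi_n)\Omega_0$ with $n\in\mathbb N_0$ and $\xi_1,\dots,\xi_n\in\mathcal D$. For an operator $o$ with domain $\mathcal D_o\subset\mathfrak h$, $dF_0(o)$ is the operator with domain $\mathfrak F^{\rm alg}_{\rm a}(\mathcal D_o)$ given by $$dF_0(o)\,a^\dagger(\xi_1)\cdots a^\dagger(\xi_n)\Omega_0=\sum_{m=1}^n a^\dagger(\xi_1)\cdots a^\dagger(o\,\xi_m)\cdots a^\dagger(\xi_n)\Omega_0.$$ *Continuum Virasoro generators.* On $\mathrm{span}\{e_l:l\in\Gamma_\infty\}$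 let $\ell_{\pm,k}\,\xi=\frac{\pm1}{2\pi}\sum_{l\in\Gamma_\infty}(l\mp\frac k2)\,\langle e_l,\xi\rangle\,e_{l\mp k}$; denote the closure again by $\ell_{\pm,k}$, and let $L_{\pm,k}$ be the closure of $dF_0(\ell_{\pm,k})$ on $\mathfrak F_{\rm a}(\mathfrak h_\infty)$ (the Fock representation, $c=0$). *Koo--Saleur approximants.* In the CAR algebra of $\mathfrak h_N$ let $$L^{(N)}_{\pm,k}=\frac{\pm1}{2\pi}\sum_{l\in\Gamma_N}\cos\!\big(\tfrac14\varepsilon_Nk\big)^2\sin\!\big(\varepsilon_N(l\mp\tfrac k2)\big)\,a^\dagger(e_{l\mp k})\,a(e_l).$$ *Wavelet renormalization group.* Let $s:\mathbb R\to\mathbb R$ be a compactly supported orthonormal scaling function: $s$ is continuous with compact support, $\int s=1$, $\int_{\mathbb R} s(x)\,s(x-n)\,dx=\delta_{n,0}$ for all $n\in\mathbb Z$, and $s(x)=\sum_n h_n\sqrt2\,s(2x-n)$ for all $x$, with a finitely supported real filter $(h_n)_{n\in\mathbb Z}$. (The continuous compactly supported Daubechies scaling functions are examples.) Assume that $s$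 is regular in the sense that it is absolutely continuous with derivative in $L^2(\mathbb R)$ (e.g. $s\in C^1$). Put $s^{(\varepsilon)}(y)=\sum_{m\in\mathbb Z}\theta^m\varepsilon^{-1/2}s(\varepsilon^{-1}(y+2Lm))$ and $$R^N_\infty:\mathfrak h_N\to\mathfrak h_\infty,\quad R^N_\infty\xi=\sum_{x\in\Lambda_N}\xi_x\,s^{(\varepsilon_N)}(\,\cdot\,-x),\qquad \alpha^N_\infty(a^\sharp(\xi))=a^\sharp(R^N_\infty\xi),\qquad \mathcal D_W=\bigcup_{N}R^N_\infty\mathfrak h_N .$$ Here $R^N_\infty$ is an isometry, $\alpha^N_\infty$ is the induced morphism of CAR algebras, and the union is increasing. **Theorem (Convergence of the KS approximants, Fock representation $c=0$).** For each boundary condition, each chirality $\pm$ and each $k\in\frac\pi L\mathbb Z$: $\mathfrak F^{\rm alg}_{\rm a}(\mathcal D_W)$ is dense in $\mathfrak F_{\rm a}(\mathfrak h_\infty)$ and is a core for $L_{\pm,k}$, and $\alpha^N_\infty(L^{(N)}_{\pm,k})$ converges strongly to $L_{\pm,k}$ on it, i.e. for all $n\in\mathbb N_0$ and $\xi_1,\dots,\xi_n\in\mathcal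 D_W$ the vector $a^\dagger(\xi_1)\cdots a^\dagger(\xi_n)\Omega_0$ lies in the domain of $L_{\pm,k}$ and $$\lim_{N\to\infty}\big\|\big(\alpha^N_\infty(L^{(N)}_{\pm,k})-L_{\pm,k}\big)\,a^\dagger(\xi_1)\cdots a^\dagger(\xi_n)\Omega_0\big\|=0 .$$ -/

import Mathlib

open MeasureTheory Filter Topology
open scoped InnerProductSpace ComplexConjugate

noncomputable section

namespace KS

universe u

section Fock

variable (h : Type u) [NormedAddCommGroup h] [InnerProductSpace ℂ h]

/-- Finite-particle vectors `⊕ₙ ⋀ⁿ h` (algebraic direct sum), as the exterior algebra of `h`. -/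
abbrev FockAlg : Type u := ExteriorAlgebra ℂ h

variable {h}

/-- A one-particle vector, seen in `⋀¹ h`. -/
def FockAlg.ι : h →ₗ[ℂ] FockAlg h := ExteriorAlgebra.ι ℂ

/-- Contraction with `ξ`: the algebraic annihilation operator. -/
def FockAlg.contract (ξ : h) : FockAlg h →ₗ[ℂ] FockAlg h :=
  CliffordAlgebra.contractLeft (Q := (0 : QuadraticForm ℂ h)) (innerₛₗ ℂ ξ)

namespace FockAlg

lemma contract_ι_mul (ξ η : h) (u : FockAlg h) :
    contract ξ (ι η * u) = ⟪ξ, η⟫_ℂ • u - ι η * contract ξ u :=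
  CliffordAlgebra.contractLeft_ι_mul (Q := (0 : QuadraticForm ℂ h)) (innerₛₗ ℂ ξ) η u

lemma contract_algebraMap (ξ : h) (r : ℂ) : contract ξ (algebraMap ℂ (FockAlg h) r) = 0 :=
  CliffordAlgebra.contractLeft_algebraMap (Q := (0 : QuadraticForm ℂ h)) (innerₛₗ ℂ ξ) r

lemma contract_contract (ξ : h) (u : FockAlg h) : contract ξ (contract ξ u) = 0 :=
  CliffordAlgebra.contractLeft_contractLeft (Q := (0 : QuadraticForm ℂ h)) (innerₛₗ ℂ ξ) u

lemma contract_add (ξ η : h) : contract (ξ + η) = contract ξ + contract η := by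
  simp [contract]

lemma contract_smul (c : ℂ) (ξ : h) : contract (c • ξ) = conj c • contract ξ := by
  simp [contract]

lemma ι_mul_ι (ξ η : h) : ι ξ * ι η = -(ι η * ι ξ) :=
  eq_neg_of_add_eq_zero_left (ExteriorAlgebra.ι_add_mul_swap (R := ℂ) ξ η)

lemma ι_mul_self (ξ : h) : ι ξ * ι ξ = 0 := ExteriorAlgebra.ι_sq_zero (R := ℂ) ξ

lemma induction_left {P : FockAlg h → Prop} (h1 : ∀ r : ℂ, P (algebraMap ℂ _ r))
    (h2 : ∀ u v, P u → P v → P (u + v)) (h3 : ∀ u ξ, P u → P (ι ξ * u)) (u : FockAlg h) : P u :=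
  CliffordAlgebra.left_induction (Q := (0 : QuadraticForm ℂ h)) h1 h2 (fun x m hx => h3 x m hx) u

/-- Conjugate of the vacuum component, as a conjugate-linear functional. -/
def vacConj : FockAlg h →ₛₗ[starRingEnd ℂ] ℂ where
  toFun u := conj (ExteriorAlgebra.algebraMapInv (R := ℂ) (M := h) u)
  map_add' u v := by
    simp
  map_smul' c u := by
    simp

lemma vacConj_algebraMap (r : ℂ) : vacConj (algebraMap ℂ (FockAlg h) r) = conj r := by
  simp only [vacConj, LinearMap.coe_mk, AddHom.coe_mk]
  congr 1
  exact ExteriorAlgebra.algebraMap_leftInverse (R := ℂ) h r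

lemma vacConj_ι_mul (ξ : h) (u : FockAlg h) : vacConj (ι ξ * u) = 0 := by
  simp only [vacConj, LinearMap.coe_mk, AddHom.coe_mk]
  rw [map_mul, show ExteriorAlgebra.algebraMapInv (R := ℂ) (M := h) (ι ξ) = 0 by
    simp [ExteriorAlgebra.algebraMapInv, ι]]
  simp

/-- The recursion step `n ↦ n ∘ contract ξ` for the inner product. -/
def pairStep : h →ₗ[ℂ] (FockAlg h →ₛₗ[starRingEnd ℂ] ℂ) →ₗ[ℂ] (FockAlg h →ₛₗ[starRingEnd ℂ] ℂ) :=
  LinearMap.mk₂ ℂ (fun ξ n => n.comp (contract ξ))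
    (fun ξ η n => by ext u; simp [contract_add])
    (fun c ξ n => by ext u; simp [contract_smul])
    (fun ξ n m => by ext u; simp)
    (fun c ξ n => by ext u; simp)

/-- The sesquilinear form on finite-particle vectors determined by `⟪1, 1⟫ = 1` and
`⟪v, ξ ∧ u⟫ = ⟪ξ ⌋ v, u⟫`, i.e. `⟪ξ₁ ∧ … ∧ ξₙ, η₁ ∧ … ∧ ηₘ⟫ = δₙₘ det ⟪ξᵢ, ηⱼ⟫`;
linear in the displayed argument, conjugate-linear in the other one. -/
def pair : FockAlg h →ₗ[ℂ] (FockAlg h →ₛₗ[starRingEnd ℂ] ℂ) :=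
  CliffordAlgebra.foldr (0 : QuadraticForm ℂ h) pairStep
    (fun ξ n => by ext u; simp [pairStep, contract_contract]) vacConj

lemma pair_algebraMap (r : ℂ) (v : FockAlg h) :
    pair (algebraMap ℂ (FockAlg h) r) v = r * vacConj v := by
  have := CliffordAlgebra.foldr_algebraMap (0 : QuadraticForm ℂ h) pairStep
    (fun ξ n => by ext u; simp [pairStep, contract_contract]) vacConj r
  exact congrArg (fun f => f v) this

lemma pair_ι_mul (ξ : h) (u v : FockAlg h) : pair (ι ξ * u) v = pair u (contract ξ v) := by
  have := CliffordAlgebra.foldr_mul (0 : QuadraticForm ℂ h) pairStep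
    (fun ξ n => by ext u; simp [pairStep, contract_contract]) vacConj (ι ξ) u
  refine (congrArg (fun f => f v) this).trans ?_
  refine (congrArg (fun f => f v) (CliffordAlgebra.foldr_ι (0 : QuadraticForm ℂ h) pairStep
    (fun ξ n => by ext u; simp [pairStep, contract_contract]) _ ξ)).trans ?_
  rfl

lemma pair_right_ι_mul (ξ : h) (u v : FockAlg h) : pair u (ι ξ * v) = pair (contract ξ u) v := by
  induction u using induction_left generalizing v with
  | h1 r => simp [pair_algebraMap, contract_algebraMap, vacConj_ι_mul]
  | h2 u w hu hw => simp [hu, hw]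
  | h3 u η hu =>
    rw [pair_ι_mul, contract_ι_mul, contract_ι_mul]
    simp [pair_ι_mul, hu]

lemma pair_symm (u v : FockAlg h) : conj (pair u v) = pair v u := by
  induction u using induction_left generalizing v with
  | h1 r =>
    induction v using induction_left with
    | h1 s => simp [pair_algebraMap, vacConj_algebraMap, mul_comm]
    | h2 u w hu hw => simp [hu, hw]
    | h3 u η hu => simp [pair_ι_mul, pair_algebraMap, vacConj_ι_mul, contract_algebraMap]
  | h2 u w hu hw => simp [hu, hw]
  | h3 u η hu => rw [pair_ι_mul, hu, pair_right_ι_mul]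

/-- The subalgebra generated by a set of one-particle vectors. -/
def gen (s : Set h) : Subalgebra ℂ (FockAlg h) := Algebra.adjoin ℂ (ι '' s)

lemma contract_gen {s : Set h} {ξ : h} (hξ : ∀ η ∈ s, ⟪ξ, η⟫_ℂ = 0) {a : FockAlg h}
    (ha : a ∈ gen s) : contract ξ a = 0 := by
  suffices H : ∀ t, contract ξ t = 0 → contract ξ (a * t) = 0 by
    have := H 1 (by simpa using contract_algebraMap ξ 1)
    simpa using this
  refine Algebra.adjoin_induction (p := fun a _ => ∀ t, contract ξ t = 0 → contract ξ (a * t) = 0)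
    ?_ ?_ ?_ ?_ ha
  · rintro _ ⟨η, hη, rfl⟩ t ht
    rw [contract_ι_mul, hξ η hη, ht]; simp
  · intro r t ht
    rw [← Algebra.smul_def, map_smul, ht, smul_zero]
  · intro x y _ _ hx hy t ht
    rw [add_mul, map_add, hx t ht, hy t ht, add_zero]
  · intro x y _ _ hx hy t ht
    rw [mul_assoc]; exact hx _ (hy t ht)

lemma gen_insert {s : Set h} {e : h} {a : FockAlg h} (ha : a ∈ gen (insert e s)) :
    ∃ v ∈ gen s, ∃ w ∈ gen s, a = v + ι e * w := by
  suffices H : ∀ t, (∃ v ∈ gen s, ∃ w ∈ gen s, t = v + ι e * w) →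
      ∃ v ∈ gen s, ∃ w ∈ gen s, a * t = v + ι e * w by
    simpa using H 1 ⟨1, one_mem _, 0, zero_mem _, by simp⟩
  refine Algebra.adjoin_induction (p := fun a _ => ∀ t, (∃ v ∈ gen s, ∃ w ∈ gen s, t = v + ι e * w)
    → ∃ v ∈ gen s, ∃ w ∈ gen s, a * t = v + ι e * w) ?_ ?_ ?_ ?_ ha
  · rintro _ ⟨η, hη, rfl⟩ t ⟨v, hv, w, hw, rfl⟩
    rcases hη with rfl | hη
    · exact ⟨0, zero_mem _, v, hv, by rw [mul_add, ← mul_assoc, ι_mul_self]; simp⟩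
    · have hη' : ι η ∈ gen s := Algebra.subset_adjoin ⟨η, hη, rfl⟩
      refine ⟨ι η * v, mul_mem hη' hv, -(ι η * w), neg_mem (mul_mem hη' hw), ?_⟩
      rw [mul_add, ← mul_assoc, ι_mul_ι η e]; simp [mul_assoc]
  · rintro r t ⟨v, hv, w, hw, rfl⟩
    refine ⟨r • v, Subalgebra.smul_mem _ hv r, r • w, Subalgebra.smul_mem _ hw r, ?_⟩
    rw [← Algebra.smul_def, smul_add, mul_smul_comm]
  · intro x y _ _ hx hy t ht
    obtain ⟨v, hv, w, hw, h1⟩ := hx t ht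
    obtain ⟨v', hv', w', hw', h2⟩ := hy t ht
    exact ⟨v + v', add_mem hv hv', w + w', add_mem hw hw', by
        rw [add_mul, h1, h2, mul_add]; abel⟩
  · intro x y _ _ hx hy t ht
    rw [mul_assoc]; exact hx _ (hy t ht)

lemma pair_pos_gen (s : Finset h) (hs : Orthonormal ℂ (fun x : s => (x : h))) {u : FockAlg h}
    (hu : u ∈ gen (s : Set h)) : 0 ≤ (pair u u).re ∧ ((pair u u).re = 0 → u = 0) := by
  classical
  induction s using Finset.induction_on generalizing u with
  | empty =>
    have : u ∈ (⊥ : Subalgebra ℂ (FockAlg h)) := by simpa [gen] using hu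
    obtain ⟨r, rfl⟩ := Algebra.mem_bot.1 this
    rw [pair_algebraMap, vacConj_algebraMap, Complex.mul_conj, Complex.ofReal_re]
    refine ⟨Complex.normSq_nonneg _, fun h0 => ?_⟩
    rw [Complex.normSq_eq_zero] at h0; simp [h0]
  | insert e s he ih =>
    rw [Finset.coe_insert] at hu
    obtain ⟨v, hv, w, hw, rfl⟩ := gen_insert hu
    have hs' : Orthonormal ℂ (fun x : s => (x : h)) := by
      have := hs.comp (fun x : s => (⟨x, Finset.mem_insert_of_mem x.2⟩ : ↥(insert e s)))
        (fun x y hxy => Subtype.ext (by simpa using hxy))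
      exact this
    have hee : ⟪e, e⟫_ℂ = 1 := by
      have := hs.1 ⟨e, Finset.mem_insert_self e s⟩
      rw [inner_self_eq_norm_sq_to_K]; simp at this; simp [this]
    have hes : ∀ η ∈ (s : Set h), ⟪e, η⟫_ℂ = 0 := by
      intro η hη
      have hη' : η ∈ s := hη
      have := hs.2 (i := ⟨e, Finset.mem_insert_self e s⟩)
        (j := ⟨η, Finset.mem_insert_of_mem hη'⟩) (by
          intro h; apply he; have := congrArg Subtype.val h; simp at this; rwa [this])
      exact this
    have cv := contract_gen hes hv
    have cw := contract_gen hes hw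
    have key : pair (v + ι e * w) (v + ι e * w) = pair v v + pair w w := by
      simp only [map_add, LinearMap.add_apply, pair_ι_mul, pair_right_ι_mul, cv,
        contract_ι_mul, cw, hee]
      simp
    obtain ⟨p1, z1⟩ := ih hs' hv
    obtain ⟨p2, z2⟩ := ih hs' hw
    rw [key, Complex.add_re]
    refine ⟨by linarith, fun h0 => ?_⟩
    rw [z1 (by linarith), z2 (by linarith)]; simp

lemma exists_gen (u : FockAlg h) : ∃ s : Finset h, Orthonormal ℂ (fun x : s => (x : h)) ∧
    u ∈ gen (s : Set h) := by
  classical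
  have step1 : ∃ V : Submodule ℂ h, FiniteDimensional ℂ V ∧ u ∈ gen (V : Set h) := by
    induction u using induction_left with
    | h1 r => exact ⟨⊥, inferInstance, Subalgebra.algebraMap_mem _ r⟩
    | h2 u v hu hv =>
      obtain ⟨V, _, hV⟩ := hu
      obtain ⟨W, _, hW⟩ := hv
      refine ⟨V ⊔ W, inferInstance, add_mem ?_ ?_⟩
      · exact Algebra.adjoin_mono (Set.image_mono (SetLike.coe_subset_coe.2 (le_sup_left (a := V)))) hV
      · exact Algebra.adjoin_mono (Set.image_mono (SetLike.coe_subset_coe.2 (le_sup_right (a := V)))) hW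
    | h3 u ξ hu =>
      obtain ⟨V, _, hV⟩ := hu
      refine ⟨V ⊔ Submodule.span ℂ {ξ}, inferInstance, mul_mem ?_ ?_⟩
      · exact Algebra.subset_adjoin ⟨ξ, Submodule.mem_sup_right (Submodule.mem_span_singleton_self ξ), rfl⟩
      · exact Algebra.adjoin_mono (Set.image_mono (SetLike.coe_subset_coe.2 (le_sup_left (a := V)))) hV
  obtain ⟨V, _, hV⟩ := step1
  let b := stdOrthonormalBasis ℂ V
  have hb : Orthonormal ℂ (fun i => (b i : h)) :=
    b.orthonormal.comp_linearIsometry V.subtypeₗᵢ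
  refine ⟨Finset.univ.image (fun i => (b i : h)), ?_, ?_⟩
  · have := hb.toSubtypeRange
    have e : Set.range (fun i => (b i : h)) = ((Finset.univ.image (fun i => (b i : h)) : Finset h) : Set h) := by simp
    rw [e] at this
    exact this
  · refine (Algebra.adjoin_le ?_ : gen (V : Set h) ≤ _) hV
    rintro _ ⟨x, hx, rfl⟩
    have hx' : x = ∑ i, (b.repr ⟨x, hx⟩ i) • (b i : h) := by
      have := congrArg (Subtype.val) (b.sum_repr ⟨x, hx⟩)
      simpa using this.symm
    rw [hx', map_sum]
    refine sum_mem fun i _ => ?_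
    rw [map_smul]
    exact Subalgebra.smul_mem _ (Algebra.subset_adjoin (Set.mem_image_of_mem _ (by simp))) _

lemma pair_pos (u : FockAlg h) : 0 ≤ (pair u u).re ∧ ((pair u u).re = 0 → u = 0) := by
  obtain ⟨s, hs, hu⟩ := exists_gen u
  exact pair_pos_gen s hs hu

end FockAlg

/-- The inner product of finite-particle vectors. -/
@[reducible] def fockCore : InnerProductSpace.Core ℂ (FockAlg h) where
  inner v u := FockAlg.pair u v
  conj_inner_symm v u := FockAlg.pair_symm v u
  re_inner_nonneg u := (FockAlg.pair_pos u).1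
  add_left u v w := by simp
  smul_left u v c := by simp
  definite u hu := (FockAlg.pair_pos u).2 (by rw [hu]; simp)

instance fockNormedAddCommGroup : NormedAddCommGroup (FockAlg h) :=
  (fockCore (h := h)).toNormedAddCommGroup
instance fockInnerProductSpace : InnerProductSpace ℂ (FockAlg h) := 
  InnerProductSpace.ofCore (fockCore (h := h)).toCore

lemma fock_inner_def (u v : FockAlg h) : ⟪v, u⟫_ℂ = FockAlg.pair u v := rfl

variable (h) in
/-- Anti-symmetric Fock space: the Hilbert space completion of `⊕ₙ ⋀ⁿ h`. -/
abbrev Fock : Type u := UniformSpace.Completion (FockAlg h)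

/-- The Fock vacuum. -/
def vacuum : Fock h := ((1 : FockAlg h) : Fock h)

lemma norm_ι_mul_le (ξ : h) (u : FockAlg h) : ‖FockAlg.ι ξ * u‖ ≤ ‖ξ‖ * ‖u‖ := by
  have e : ⟪FockAlg.ι ξ * u, FockAlg.ι ξ * u⟫_ℂ =
      ⟪ξ, ξ⟫_ℂ * ⟪u, u⟫_ℂ - ⟪FockAlg.contract ξ u, FockAlg.contract ξ u⟫_ℂ := by
    simp only [fock_inner_def]
    rw [FockAlg.pair_ι_mul, FockAlg.contract_ι_mul, map_sub, FockAlg.pair_right_ι_mul]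
    simp
  have e' := congrArg Complex.re e
  rw [inner_self_eq_norm_sq_to_K, inner_self_eq_norm_sq_to_K,
    inner_self_eq_norm_sq_to_K, inner_self_eq_norm_sq_to_K] at e'
  simp only [Complex.coe_algebraMap, ← Complex.ofReal_pow, ← Complex.ofReal_mul,
    ← Complex.ofReal_sub, Complex.ofReal_re] at e'
  refine (abs_le_of_sq_le_sq' ?_ (by positivity)).2
  rw [mul_pow]; nlinarith [sq_nonneg ‖FockAlg.contract ξ u‖]

/-- `u ↦ ξ ∧ u` on finite-particle vectors. -/
def createAlg (ξ : h) : FockAlg h →L[ℂ] FockAlg h :=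
  LinearMap.mkContinuous (LinearMap.mulLeft ℂ (FockAlg.ι ξ)) ‖ξ‖ (norm_ι_mul_le ξ)

/-- The creation operator `a†(ξ)` on Fock space: the continuous extension of `u ↦ ξ ∧ u`. -/
def create (ξ : h) : Fock h →L[ℂ] Fock h := (createAlg ξ).completion

/-- The annihilation operator `a(ξ)`, the adjoint of `a†(ξ)`. -/
def annihilate (ξ : h) : Fock h →L[ℂ] Fock h := ContinuousLinearMap.adjoint (create ξ)

/-- The vector `a†(ξ₁) ⋯ a†(ξₙ) Ω₀`. -/
def fockVector {n : ℕ} (ξ : Fin n → h) : Fock h :=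
  (List.ofFn fun i => create (ξ i)).prod vacuum


lemma create_coe (ξ : h) (u : FockAlg h) : create ξ (u : Fock h) = ((FockAlg.ι ξ * u : FockAlg h) : Fock h) :=
  ContinuousLinearMap.completion_apply_coe (createAlg ξ) u

lemma annihilate_coe (ξ : h) (u : FockAlg h) :
    annihilate ξ (u : Fock h) = ((FockAlg.contract ξ u : FockAlg h) : Fock h) := by
  refine ext_inner_left ℂ fun w => ?_
  rw [annihilate, ContinuousLinearMap.adjoint_inner_right]
  induction w using UniformSpace.Completion.induction_on with
  | hp => exact isClosed_eq (by fun_prop) (by fun_prop)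
  | ih w =>
    rw [create_coe, UniformSpace.Completion.inner_coe, UniformSpace.Completion.inner_coe,
      fock_inner_def, fock_inner_def, FockAlg.pair_right_ι_mul]

lemma fock_ext {A B : Fock h →L[ℂ] Fock h} (H : ∀ u : FockAlg h, A u = B u) : A = B := by
  ext w
  induction w using UniformSpace.Completion.induction_on with
  | hp => exact isClosed_eq (by fun_prop) (by fun_prop)
  | ih w => exact H w

lemma create_add (ξ η : h) : create (ξ + η) = create ξ + create η :=
  fock_ext fun u => by
    rw [add_apply]
    simp only [create_coe, map_add, add_mul, UniformSpace.Completion.coe_add]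

lemma create_smul (c : ℂ) (ξ : h) : create (c • ξ) = c • create ξ :=
  fock_ext fun u => by
    rw [smul_apply]
    simp only [create_coe, map_smul, smul_mul_assoc, UniformSpace.Completion.coe_smul]

lemma annihilate_add (ξ η : h) : annihilate (ξ + η) = annihilate ξ + annihilate η := by
  simp [annihilate, create_add]

lemma annihilate_smul (c : ℂ) (ξ : h) : annihilate (c • ξ) = conj c • annihilate ξ := by
  rw [annihilate, create_smul]
  exact map_smulₛₗ ContinuousLinearMap.adjoint c (create ξ)

lemma create_anticomm (ξ η : h) : create ξ * create η + create η * create ξ = 0 :=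
  fock_ext fun u => by
    rw [add_apply]
    simp only [mul_apply_eq_comp, create_coe, ← mul_assoc]
    rw [FockAlg.ι_mul_ι ξ η, ← UniformSpace.Completion.coe_add]
    simp

lemma annihilate_anticomm (ξ η : h) :
    annihilate ξ * annihilate η + annihilate η * annihilate ξ = 0 := by
  have := congrArg star (create_anticomm η ξ)
  rw [star_add, star_mul, star_mul, star_zero] at this
  exact this

lemma car (ξ η : h) : annihilate ξ * create η + create η * annihilate ξ = ⟪ξ, η⟫_ℂ • 1 :=
  fock_ext fun u => by
    rw [add_apply]
    simp only [mul_apply_eq_comp, create_coe, annihilate_coe,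
      ← UniformSpace.Completion.coe_add, FockAlg.contract_ι_mul, sub_add_cancel]
    simp

section CAR

variable (h) in
/-- Generators of the CAR algebra: `inl ξ` stands for `a†(ξ)` and `inr ξ` for `a(ξ)`. -/
abbrev CARFree : Type u := FreeAlgebra ℂ (h ⊕ h)

/-- The defining relations of the CAR algebra of `h`. -/
inductive CARRel : CARFree h → CARFree h → Prop
  | create_add (ξ η : h) : CARRel (FreeAlgebra.ι ℂ (Sum.inl (ξ + η)))
      (FreeAlgebra.ι ℂ (Sum.inl ξ) + FreeAlgebra.ι ℂ (Sum.inl η))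
  | create_smul (c : ℂ) (ξ : h) : CARRel (FreeAlgebra.ι ℂ (Sum.inl (c • ξ)))
      (c • FreeAlgebra.ι ℂ (Sum.inl ξ))
  | annihilate_add (ξ η : h) : CARRel (FreeAlgebra.ι ℂ (Sum.inr (ξ + η)))
      (FreeAlgebra.ι ℂ (Sum.inr ξ) + FreeAlgebra.ι ℂ (Sum.inr η))
  | annihilate_smul (c : ℂ) (ξ : h) : CARRel (FreeAlgebra.ι ℂ (Sum.inr (c • ξ)))
      (conj c • FreeAlgebra.ι ℂ (Sum.inr ξ))
  | create_anticomm (ξ η : h) : CARRel (FreeAlgebra.ι ℂ (Sum.inl ξ) * FreeAlgebra.ι ℂ (Sum.inl η) +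
      FreeAlgebra.ι ℂ (Sum.inl η) * FreeAlgebra.ι ℂ (Sum.inl ξ)) 0
  | annihilate_anticomm (ξ η : h) : CARRel
      (FreeAlgebra.ι ℂ (Sum.inr ξ) * FreeAlgebra.ι ℂ (Sum.inr η) +
      FreeAlgebra.ι ℂ (Sum.inr η) * FreeAlgebra.ι ℂ (Sum.inr ξ)) 0
  | car (ξ η : h) : CARRel (FreeAlgebra.ι ℂ (Sum.inr ξ) * FreeAlgebra.ι ℂ (Sum.inl η) +
      FreeAlgebra.ι ℂ (Sum.inl η) * FreeAlgebra.ι ℂ (Sum.inr ξ)) (⟪ξ, η⟫_ℂ • 1)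

variable (h) in
/-- The algebra of canonical anti-commutation relations over `h`: the universal unital algebra
generated by `a†(ξ)` (linear in `ξ`) and `a(ξ)` (antilinear in `ξ`) subject to
`{a(ξ), a†(η)} = ⟪ξ, η⟫` and `{a(ξ), a(η)} = 0 = {a†(ξ), a†(η)}`. (For finite-dimensional `h` this is
already the CAR C⋆-algebra; in general it is its dense subalgebra of polynomials in the fields.) -/
abbrev CARAlgebra : Type u := RingQuot (CARRel (h := h))

/-- The abstract creation operator `a†(ξ)`. -/
def CARAlgebra.cr (ξ : h) : CARAlgebra h :=
  RingQuot.mkAlgHom ℂ CARRel (FreeAlgebra.ι ℂ (Sum.inl ξ))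

/-- The abstract annihilation operator `a(ξ)`. -/
def CARAlgebra.an (ξ : h) : CARAlgebra h :=
  RingQuot.mkAlgHom ℂ CARRel (FreeAlgebra.ι ℂ (Sum.inr ξ))

/-- The Fock representation `π₀` of the CAR algebra, `π₀(a^♯(ξ)) = a^♯(ξ)`. -/
def fockRep : CARAlgebra h →ₐ[ℂ] (Fock h →L[ℂ] Fock h) :=
  RingQuot.liftAlgHom ℂ ⟨FreeAlgebra.lift ℂ (Sum.elim create annihilate), by
    intro x y hxy
    induction hxy with
    | create_add ξ η => simp [create_add]
    | create_smul c ξ => simp [create_smul]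
    | annihilate_add ξ η => simp [annihilate_add]
    | annihilate_smul c ξ => simp [annihilate_smul]
    | create_anticomm ξ η => simp [create_anticomm]
    | annihilate_anticomm ξ η => simp [annihilate_anticomm]
    | car ξ η => simp [car]⟩

lemma fockRep_cr (ξ : h) : fockRep (CARAlgebra.cr ξ) = create ξ := by
  simp [fockRep, CARAlgebra.cr]

lemma fockRep_an (ξ : h) : fockRep (CARAlgebra.an ξ) = annihilate ξ := by
  simp [fockRep, CARAlgebra.an]

variable {h' : Type u} [NormedAddCommGroup h'] [InnerProductSpace ℂ h']

/-- The morphism of CAR algebras `a^♯(ξ) ↦ a^♯(V ξ)` induced by an isometry `V`. -/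
def carMap (V : h →ₗᵢ[ℂ] h') : CARAlgebra h →ₐ[ℂ] CARAlgebra h' :=
  RingQuot.liftAlgHom ℂ ⟨FreeAlgebra.lift ℂ
    (Sum.elim (fun ξ => CARAlgebra.cr (V ξ)) (fun ξ => CARAlgebra.an (V ξ))), by
    intro x y hxy
    have key : ∀ {a b : CARFree h'}, CARRel a b →
      RingQuot.mkAlgHom ℂ CARRel a = RingQuot.mkAlgHom ℂ CARRel b :=
      fun hab => RingQuot.mkAlgHom_rel ℂ hab
    induction hxy with
    | create_add ξ η => simpa [CARAlgebra.cr] using key (.create_add (V ξ) (V η))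
    | create_smul c ξ => simpa [CARAlgebra.cr] using key (.create_smul c (V ξ))
    | annihilate_add ξ η => simpa [CARAlgebra.an] using key (.annihilate_add (V ξ) (V η))
    | annihilate_smul c ξ => simpa [CARAlgebra.an] using key (.annihilate_smul c (V ξ))
    | create_anticomm ξ η => simpa [CARAlgebra.cr] using key (.create_anticomm (V ξ) (V η))
    | annihilate_anticomm ξ η => simpa [CARAlgebra.an] using key (.annihilate_anticomm (V ξ) (V η))
    | car ξ η => simpa [CARAlgebra.cr, CARAlgebra.an] using key (.car (V ξ) (V η))⟩

lemma carMap_cr (V : h →ₗᵢ[ℂ] h') (ξ : h) :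
    carMap V (CARAlgebra.cr ξ) = CARAlgebra.cr (V ξ) := by
  simp [carMap, CARAlgebra.cr]

lemma carMap_an (V : h →ₗᵢ[ℂ] h') (ξ : h) :
    carMap V (CARAlgebra.an ξ) = CARAlgebra.an (V ξ) := by
  simp [carMap, CARAlgebra.an]

end CAR

section SecondQuantization

/-- The inclusion of finite-particle vectors with all one-particle vectors in `D` into Fock space. -/
def algFockIncl (D : Submodule ℂ h) : ExteriorAlgebra ℂ D →ₗ[ℂ] Fock h :=
  (UniformSpace.Completion.toComplₗᵢ (𝕜 := ℂ) (E := FockAlg h)).toLinearMap ∘ₗ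
    (ExteriorAlgebra.map D.subtype).toLinearMap

lemma algFockIncl_injective (D : Submodule ℂ h) : Function.Injective (algFockIncl D) :=
  (UniformSpace.Completion.toComplₗᵢ (𝕜 := ℂ) (E := FockAlg h)).injective.comp
    (ExteriorAlgebra.map_injective_field (Submodule.ker_subtype D))

/-- The span of all `ξ₁ ∧ … ∧ ξₙ` with `n ≥ 0` and `ξ₁, …, ξₙ ∈ D`, a subspace of Fock space. -/
def algFock (D : Submodule ℂ h) : Submodule ℂ (Fock h) := LinearMap.range (algFockIncl D)

/-- The linear map `x ↦ x + ε Tx` into the dual numbers over the exterior algebra. -/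
def dualLift (T : h →ₗ.[ℂ] h) : T.domain →ₗ[ℂ] DualNumber (FockAlg h) where
  toFun x := TrivSqZeroExt.inl (FockAlg.ι (x : h)) + TrivSqZeroExt.inr (FockAlg.ι (T x))
  map_add' x y := by ext <;> simp [LinearPMap.map_add]
  map_smul' c x := by ext <;> simp [LinearPMap.map_smul]

lemma dualLift_sq (T : h →ₗ.[ℂ] h) (x : T.domain) : dualLift T x * dualLift T x = 0 := by
  ext
  · simp [dualLift, FockAlg.ι_mul_self]
  · simp [dualLift, FockAlg.ι_mul_ι (T x) (x : h)]

/-- The algebra morphism `x₁ ∧ … ∧ xₙ ↦ (x₁ + ε Tx₁) ∧ … ∧ (xₙ + ε Txₙ)`. -/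
def dualHom (T : h →ₗ.[ℂ] h) : ExteriorAlgebra ℂ T.domain →ₐ[ℂ] DualNumber (FockAlg h) :=
  ExteriorAlgebra.lift ℂ ⟨dualLift T, dualLift_sq T⟩

lemma dualHom_ι (T : h →ₗ.[ℂ] h) (x : T.domain) :
    dualHom T (ExteriorAlgebra.ι ℂ x) =
      TrivSqZeroExt.inl (FockAlg.ι (x : h)) + TrivSqZeroExt.inr (FockAlg.ι (T x)) :=
  ExteriorAlgebra.lift_ι_apply ℂ (dualLift T) (dualLift_sq T) x

/-- Second quantization on finite-particle vectors, as the `ε`-part of `dualHom T`: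
`x₁ ∧ … ∧ xₙ ↦ ∑ₘ x₁ ∧ … ∧ Txₘ ∧ … ∧ xₙ`. -/
def secondQuantAlg (T : h →ₗ.[ℂ] h) : ExteriorAlgebra ℂ T.domain →ₗ[ℂ] FockAlg h where
  toFun u := (dualHom T u).snd
  map_add' u v := by rw [map_add, TrivSqZeroExt.snd_add]
  map_smul' c u := by rw [map_smul, TrivSqZeroExt.snd_smul, RingHom.id_apply]

lemma secondQuantAlg_one (T : h →ₗ.[ℂ] h) : secondQuantAlg T 1 = 0 := by
  change (dualHom T 1).snd = 0
  rw [map_one, TrivSqZeroExt.snd_one]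

lemma dualHom_fst (T : h →ₗ.[ℂ] h) (u : ExteriorAlgebra ℂ T.domain) :
    (dualHom T u).fst = ExteriorAlgebra.map T.domain.subtype u := by
  have : (TrivSqZeroExt.fstHom ℂ (FockAlg h) (FockAlg h)).comp (dualHom T) =
      ExteriorAlgebra.map T.domain.subtype := by
    refine ExteriorAlgebra.hom_ext (LinearMap.ext fun x => ?_)
    change (dualHom T (ExteriorAlgebra.ι ℂ x)).fst =
      ExteriorAlgebra.map T.domain.subtype (ExteriorAlgebra.ι ℂ x)
    rw [dualHom_ι, ExteriorAlgebra.map_apply_ι, TrivSqZeroExt.fst_add, TrivSqZeroExt.fst_inl,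
      TrivSqZeroExt.fst_inr, add_zero]
    rfl
  exact congrArg (fun f => f u) this

lemma secondQuantAlg_ι_mul (T : h →ₗ.[ℂ] h) (x : T.domain) (u : ExteriorAlgebra ℂ T.domain) :
    secondQuantAlg T (ExteriorAlgebra.ι ℂ x * u) =
      FockAlg.ι (T x) * ExteriorAlgebra.map T.domain.subtype u +
        FockAlg.ι (x : h) * secondQuantAlg T u := by
  change (dualHom T (ExteriorAlgebra.ι ℂ x * u)).snd = _ + _ * (dualHom T u).snd
  rw [map_mul, TrivSqZeroExt.snd_mul, ← dualHom_fst, dualHom_ι]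
  simp [add_comm, FockAlg.ι]

/-- Additive second quantization `dF₀(T)` of a (possibly unbounded) one-particle operator `T`,
with domain the algebraic Fock space over the domain of `T`. -/
def secondQuant (T : h →ₗ.[ℂ] h) : Fock h →ₗ.[ℂ] Fock h where
  domain := algFock T.domain
  toFun := (UniformSpace.Completion.toComplₗᵢ (𝕜 := ℂ) (E := FockAlg h)).toLinearMap ∘ₗ
    secondQuantAlg T ∘ₗ
      (LinearEquiv.ofInjective _ (algFockIncl_injective T.domain)).symm.toLinearMap

end SecondQuantization
end Fock

/-- The `θ`-twisted periodization `∑ₘ θᵐ φ(· + T m)` of a function on the line. -/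
def twistPer (θ : ℤˣ) (T : ℝ) (φ : ℝ → ℝ) (z : ℝ) : ℝ :=
  ∑' m : ℤ, (((θ ^ m : ℤˣ) : ℤ) : ℝ) * φ (z + T * m)

lemma exists_bound {φ : ℝ → ℝ} (hφ : HasCompactSupport φ) :
    ∃ B : ℝ, 0 ≤ B ∧ ∀ z, B < |z| → φ z = 0 := by
  obtain ⟨B, hB⟩ := hφ.isCompact.isBounded.subset_closedBall 0
  refine ⟨max B 0, le_max_right _ _, fun z hz => ?_⟩
  by_contra h
  have := hB (subset_tsupport φ h)
  simp at this
  exact absurd hz (not_lt.2 (this.trans (le_max_left _ _)))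

lemma exists_cut {φ : ℝ → ℝ} (hφ : HasCompactSupport φ) {T : ℝ} (hT : 0 < T) (C : ℝ) :
    ∃ M : ℕ, ∀ z, |z| ≤ C → ∀ m : ℤ, m ∉ Finset.Icc (-(M : ℤ)) M → φ (z + T * m) = 0 := by
  obtain ⟨B, hB0, hB⟩ := exists_bound hφ
  obtain ⟨M, hM⟩ := exists_nat_gt ((B + C) / T)
  refine ⟨M, fun z hz m hm => hB _ ?_⟩
  rw [div_lt_iff₀ hT] at hM
  have hm' : (M : ℝ) < |(m : ℝ)| := by
    have : (M : ℤ) < |m| := by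
      rw [Finset.mem_Icc, not_and_or] at hm
      rcases hm with h | h
      · exact lt_abs.2 (Or.inr (by omega))
      · exact lt_abs.2 (Or.inl (by omega))
    exact_mod_cast this
  have h1 : |T * m| ≤ |z + T * m| + |z| := by
    have := abs_sub (z + T * m) z
    simpa using this
  rw [abs_mul, abs_of_pos hT] at h1
  nlinarith

lemma twistPer_eq_sum {φ : ℝ → ℝ} {θ : ℤˣ} {T C : ℝ} {M : ℕ}
    (hM : ∀ z, |z| ≤ C → ∀ m : ℤ, m ∉ Finset.Icc (-(M : ℤ)) M → φ (z + T * m) = 0)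
    {z : ℝ} (hz : |z| ≤ C) :
    twistPer θ T φ z =
      ∑ m ∈ Finset.Icc (-(M : ℤ)) M, (((θ ^ m : ℤˣ) : ℤ) : ℝ) * φ (z + T * m) :=
  tsum_eq_sum fun m hm => by rw [hM z hz m hm, mul_zero]

lemma twistPer_continuous {φ : ℝ → ℝ} (hc : Continuous φ) (hφ : HasCompactSupport φ) (θ : ℤˣ)
    {T : ℝ} (hT : 0 < T) : Continuous (twistPer θ T φ) := by
  rw [continuous_iff_continuousAt]
  intro z₀
  obtain ⟨M, hM⟩ := exists_cut hφ hT (|z₀| + 1)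
  have hcont : Continuous fun z => ∑ m ∈ Finset.Icc (-(M : ℤ)) M,
      (((θ ^ m : ℤˣ) : ℤ) : ℝ) * φ (z + T * m) := by fun_prop
  refine hcont.continuousAt.congr ?_
  have : ∀ᶠ z in 𝓝 z₀, |z| < |z₀| + 1 :=
    (continuous_abs.tendsto z₀).eventually (gt_mem_nhds (by linarith))
  filter_upwards [this] with z hz
  exact (twistPer_eq_sum hM hz.le).symm

lemma twistPer_add (θ : ℤˣ) (T : ℝ) (φ : ℝ → ℝ) (z : ℝ) (n : ℤ) :
    twistPer θ T φ (z + T * n) = (((θ ^ n : ℤˣ) : ℤ) : ℝ) * twistPer θ T φ z := by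
  unfold twistPer
  rw [← tsum_mul_left, ← (Equiv.addRight n).tsum_eq
    (fun m : ℤ => (((θ ^ n : ℤˣ) : ℤ) : ℝ) * ((((θ ^ m : ℤˣ) : ℤ) : ℝ) * φ (z + T * m)))]
  refine tsum_congr fun m => ?_
  have h2 : ((((θ ^ n : ℤˣ) : ℤ) : ℝ)) * (((θ ^ n : ℤˣ) : ℤ) : ℝ) = 1 := by
    rcases Int.units_eq_one_or (θ ^ n) with h | h <;> rw [h] <;> simp
  simp only [Equiv.coe_addRight, zpow_add, Units.val_mul, Int.cast_mul, Int.cast_add]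
  rw [show z + T * (m + n) = z + T * n + T * m by ring]
  linear_combination -(((θ ^ m : ℤˣ) : ℤ) : ℝ) * φ (z + T * n + T * m) * h2

lemma unfold_integral {G : ℝ → ℝ} (hG : Integrable G) {L : ℝ} (hL : 0 < L) :
    HasSum (fun m : ℤ => ∫ z in (-L)..L, G (z + 2 * L * m)) (∫ z, G z) := by
  have hL2 : (2 * L) ≠ 0 := by positivity
  have h1 := (hG.comp_mul_left' hL2).hasSum_intervalIntegral (-(1 / 2))
  rw [Measure.integral_comp_mul_left] at h1
  have h2 := h1.mul_left (2 * L)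
  rw [abs_of_pos (by positivity), smul_eq_mul, mul_inv_cancel_left₀ hL2] at h2
  suffices H : (fun m : ℤ => ∫ z in (-L)..L, G (z + 2 * L * m)) = fun i : ℤ =>
      2 * L * ∫ x in (-(1 / 2) + (i : ℝ))..(-(1 / 2) + (i : ℝ) + 1), G (2 * L * x) by
    rw [H]; exact h2
  funext m
  have e1 := intervalIntegral.integral_comp_mul_left (a := -(1 / 2) + (m : ℝ))
    (b := -(1 / 2) + (m : ℝ) + 1) G hL2
  have e2 := intervalIntegral.integral_comp_add_right (a := -L) (b := L) G (2 * L * m)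
  rw [e2, e1, smul_eq_mul, mul_inv_cancel_left₀ hL2]
  congr 1 <;> ring

lemma twistPer_inner {φ ψ : ℝ → ℝ} (hc : Continuous φ) (hφ : HasCompactSupport φ)
    (hc' : Continuous ψ) (hψ : HasCompactSupport ψ) (θ : ℤˣ) {L : ℝ} (hL : 0 < L) :
    ∃ M : ℕ, ∀ M' ≥ M, ∫ z in (-L)..L, twistPer θ (2 * L) φ z * twistPer θ (2 * L) ψ z =
      ∑ m ∈ Finset.Icc (-(M' : ℤ)) M',
        (((θ ^ m : ℤˣ) : ℤ) : ℝ) * ∫ z, φ z * ψ (z + 2 * L * m) := by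
  have hT : (0 : ℝ) < 2 * L := by positivity
  obtain ⟨B, hB0, hB⟩ := exists_bound hφ
  obtain ⟨M₁, hM₁⟩ := exists_cut hφ hT L
  obtain ⟨M₂, hM₂⟩ := exists_cut hψ hT B
  have hP := twistPer_continuous hc' hψ θ hT
  set P := twistPer θ (2 * L) ψ with hPdef
  have hint : Integrable fun z => φ z * P z :=
    (hc.mul hP).integrable_of_hasCompactSupport (hφ.mul_right)
  have step1 : ∫ z in (-L)..L, twistPer θ (2 * L) φ z * P z = ∫ z, φ z * P z := by
    rw [← (unfold_integral hint hL).tsum_eq, tsum_eq_sum (s := Finset.Icc (-(M₁ : ℤ)) M₁)]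
    · rw [← intervalIntegral.integral_finsetSum
        (fun m _ => Continuous.intervalIntegrable (by fun_prop) _ _)]
      refine intervalIntegral.integral_congr fun z hz => ?_
      rw [Set.uIcc_of_le (by linarith)] at hz
      rw [twistPer_eq_sum hM₁ (abs_le.2 hz), Finset.sum_mul]
      refine Finset.sum_congr rfl fun m _ => ?_
      rw [hPdef, twistPer_add]; ring
    · intro m hm
      rw [intervalIntegral.integral_congr (g := fun _ => (0 : ℝ))]
      · simp
      · intro z hz
        rw [Set.uIcc_of_le (by linarith)] at hz
        beta_reduce
        rw [hM₁ z (abs_le.2 hz) m hm, zero_mul]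
  refine ⟨M₂, fun M' hM' => ?_⟩
  rw [step1]
  have hM₂' : ∀ z, |z| ≤ B → ∀ m : ℤ, m ∉ Finset.Icc (-(M' : ℤ)) M' → ψ (z + 2 * L * m) = 0 := by
    intro z hz m hm
    refine hM₂ z hz m fun h => hm ?_
    rw [Finset.mem_Icc] at h ⊢
    omega
  have : ∀ z, φ z * P z = ∑ m ∈ Finset.Icc (-(M' : ℤ)) M',
      (((θ ^ m : ℤˣ) : ℤ) : ℝ) * (φ z * ψ (z + 2 * L * m)) := by
    intro z
    by_cases hz : |z| ≤ B
    · rw [hPdef, twistPer_eq_sum hM₂' hz, Finset.mul_sum]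
      exact Finset.sum_congr rfl fun m _ => by ring
    · rw [hB z (not_le.1 hz)]; simp
  simp_rw [this]
  rw [integral_finsetSum]
  · exact Finset.sum_congr rfl fun m _ => integral_const_mul _ _
  · intro m _
    refine Integrable.const_mul ?_ _
    exact (hc.mul (by fun_prop)).integrable_of_hasCompactSupport hφ.mul_right

section Lattice

/-- A compactly supported orthonormal scaling function `s` of a multiresolution analysis, with finite
low-pass filter `hₙ`; the compactly supported Daubechies scaling functions are examples. -/
structure ScalingFunction where
  toFun : ℝ → ℝ
  filter : ℤ →₀ ℝ
  continuous_toFun : Continuous toFun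
  hasCompactSupport_toFun : HasCompactSupport toFun
  integral_eq_one : ∫ x, toFun x = 1
  orthonormal_translates : ∀ n : ℤ, ∫ x, toFun x * toFun (x - n) = if n = 0 then 1 else 0
  scaling_eq : ∀ x, toFun x = filter.sum fun n c => c * (√2 * toFun (2 * x - n))

/-- The regularity of the scaling function: it is absolutely continuous with square-integrable
derivative. -/
def ScalingFunction.Regular (s : ScalingFunction) : Prop :=
  ∃ g : ℝ → ℝ, MemLp g 2 volume ∧ ∀ a b : ℝ, s.toFun b - s.toFun a = ∫ x in a..b, g x

/-- The parameters of the sequence of lattices: a lattice spacing `ε₀` and half of the number of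
lattice sites `L₀` at the coarsest scale. -/
structure LatticeData where
  eps₀ : ℝ
  len₀ : ℕ
  eps₀_pos : 0 < eps₀
  len₀_pos : 0 < len₀

namespace LatticeData

variable (D : LatticeData)

/-- Half of the length of the circle, `L = ε₀ L₀`. -/
def L : ℝ := D.eps₀ * D.len₀

/-- The lattice spacing `ε_N = 2⁻ᴺ ε₀`. -/
def eps (N : ℕ) : ℝ := D.eps₀ / 2 ^ N

/-- `L_N = 2ᴺ L₀`, so that `ε_N L_N = L`. -/
def len (N : ℕ) : ℕ := 2 ^ N * D.len₀

lemma L_pos : 0 < D.L := mul_pos D.eps₀_pos (Nat.cast_pos.2 D.len₀_pos)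

lemma eps_pos (N : ℕ) : 0 < D.eps N := div_pos D.eps₀_pos (by positivity)

lemma eps_mul_len (N : ℕ) : D.eps N * D.len N = D.L := by
  simp only [eps, len, L]; push_cast; field_simp

/-- The sites of the lattice `Λ_N = ε_N {-L_N, …, L_N - 1}`, labelled by integers. -/
abbrev Sites (N : ℕ) : Type := ↥(Finset.Ico (-(D.len N : ℤ)) (D.len N))

/-- The lattice one-particle space `ℓ²(Λ_N)`. -/
abbrev LatSpace (N : ℕ) : Type := EuclideanSpace ℂ (D.Sites N)

/-- Lebesgue measure on a fundamental interval `[-L, L)` of the circle. -/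
def circleMeasure : Measure ℝ := volume.restrict (Set.Ico (-D.L) D.L)

instance : IsFiniteMeasure D.circleMeasure := by
  unfold circleMeasure; infer_instance

/-- The continuum one-particle space `L²` of the circle of length `2L`. -/
abbrev ContSpace : Type := Lp ℂ 2 D.circleMeasure

/-- The momentum `(π/L) n` (periodic sector, `θ = 1`) or `(π/L) (n + 1/2)` (anti-periodic sector,
`θ = -1`). -/
def mom (θ : ℤˣ) (n : ℤ) : ℝ := Real.pi / D.L * (n + if θ = 1 then 0 else 1 / 2)

/-- The plane wave `e_p(x) = e^{ipx}` on the lattice. -/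
def latWave (N : ℕ) (p : ℝ) : D.LatSpace N :=
  WithLp.toLp 2 fun j => Complex.exp (Complex.I * (p * (D.eps N * (j : ℤ)) : ℝ))

lemma memLp_planeWave (p : ℝ) :
    MemLp (fun x : ℝ => Complex.exp (Complex.I * (p * x : ℝ))) 2 D.circleMeasure :=
  MemLp.of_bound (Continuous.aestronglyMeasurable (by fun_prop)) 1
    (Eventually.of_forall fun x => by rw [mul_comm, Complex.norm_exp_ofReal_mul_I])

/-- The plane wave `e_p(x) = e^{ipx}` on the circle. -/
def contWave (p : ℝ) : D.ContSpace := (D.memLp_planeWave p).toLp _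

lemma inner_contWave (p q : ℝ) : ⟪D.contWave p, D.contWave q⟫_ℂ =
    ∫ x in (-D.L)..D.L, Complex.exp (Complex.I * (q - p : ℝ) * x) := by
  rw [L2.inner_def, intervalIntegral.integral_of_le (by linarith [D.L_pos]), 
    ← integral_Ico_eq_integral_Ioc]
  refine integral_congr_ae ?_
  filter_upwards [(D.memLp_planeWave p).coeFn_toLp, (D.memLp_planeWave q).coeFn_toLp] with x hp hq
  rw [contWave, contWave, hp, hq, RCLike.inner_apply, ← Complex.exp_conj, ← Complex.exp_add]
  congr 1
  simp
  ring

lemma inner_contWave_mom (θ : ℤˣ) {m n : ℤ} (h : m ≠ n) :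
    ⟪D.contWave (D.mom θ m), D.contWave (D.mom θ n)⟫_ℂ = 0 := by
  have hL : (D.L : ℂ) ≠ 0 := Complex.ofReal_ne_zero.2 D.L_pos.ne'
  have hd : ((n : ℂ) - m) ≠ 0 := sub_ne_zero.2 (by exact_mod_cast h.symm)
  have hpi : (Real.pi : ℂ) ≠ 0 := Complex.ofReal_ne_zero.2 Real.pi_ne_zero
  have e : Complex.I * ((D.mom θ n - D.mom θ m : ℝ) : ℂ) =
      Complex.I * (Real.pi / D.L * (n - m)) := by
    simp only [mom]; push_cast; ring
  rw [inner_contWave, e, integral_exp_mul_complex]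
  · rw [div_eq_zero_iff]
    left
    rw [sub_eq_zero, Complex.exp_eq_exp_iff_exists_int]
    refine ⟨n - m, ?_⟩
    push_cast
    field_simp
    ring
  · exact mul_ne_zero Complex.I_ne_zero (mul_ne_zero (div_ne_zero hpi hL) hd)

/-- The trigonometric polynomials of the sector `θ`. -/
def trigPoly (θ : ℤˣ) : Submodule ℂ D.ContSpace :=
  Submodule.span ℂ (Set.range fun n : ℤ => D.contWave (D.mom θ n))

lemma finite_modes (θ : ℤˣ) {ξ : D.ContSpace} (hξ : ξ ∈ D.trigPoly θ) :
    {n : ℤ | ⟪D.contWave (D.mom θ n), ξ⟫_ℂ ≠ 0}.Finite := by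
  induction hξ using Submodule.span_induction with
  | mem x hx =>
    obtain ⟨m, rfl⟩ := hx
    refine (Set.finite_singleton m).subset fun n hn => ?_
    by_contra hne
    exact hn (D.inner_contWave_mom θ hne)
  | zero => simp
  | add x y _ _ hx hy =>
    refine (hx.union hy).subset fun n hn => ?_
    by_contra hne
    simp only [Set.mem_union, Set.mem_ofPred_eq, not_or, not_not] at hne
    exact hn (by rw [inner_add_right, hne.1, hne.2, add_zero])
  | smul c x _ hx =>
    refine hx.subset fun n hn => ?_
    intro h0
    exact hn (by rw [inner_smul_right, h0, mul_zero])

/-- The one-particle Virasoro generator with `σ = ±1` and `k = (π/L) κ`, on trigonometric polynomials: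
`ℓ_{±,k} = (±1/2π) ∑ₗ (l ∓ k/2) e_{l∓k} ⟪e_l, ·⟫`. -/
def ellTrig (σ θ : ℤˣ) (κ : ℤ) : D.ContSpace →ₗ.[ℂ] D.ContSpace where
  domain := D.trigPoly θ
  toFun :=
    { toFun := fun ξ => ∑ᶠ n : ℤ, (((σ : ℤ) / (2 * Real.pi) *
          (D.mom θ n - (σ : ℤ) * (Real.pi / D.L * κ) / 2) : ℝ) : ℂ) •
        ⟪D.contWave (D.mom θ n), (ξ : D.ContSpace)⟫_ℂ • D.contWave (D.mom θ (n - σ * κ))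
      map_add' := fun ξ η => by
        rw [← finsum_add_distrib]
        · refine finsum_congr fun n => ?_
          rw [Submodule.coe_add, inner_add_right, add_smul, smul_add]
        · exact (D.finite_modes θ ξ.2).subset fun n hn h0 => hn (by
            beta_reduce; rw [h0, zero_smul, smul_zero])
        · exact (D.finite_modes θ η.2).subset fun n hn h0 => hn (by
            beta_reduce; rw [h0, zero_smul, smul_zero])
      map_smul' := fun c ξ => by
        rw [RingHom.id_apply, smul_finsum]
        refine finsum_congr fun n => ?_
        rw [Submodule.coe_smul, inner_smul_right, mul_smul, smul_comm] }

/-- The one-particle Virasoro generator `ℓ_{±,k}` as a closed operator. -/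
def ell (σ θ : ℤˣ) (κ : ℤ) : D.ContSpace →ₗ.[ℂ] D.ContSpace := (D.ellTrig σ θ κ).closure

/-- The Virasoro generator `L_{±,k}`, the closure of the second quantization `dF₀(ℓ_{±,k})`. -/
def virasoro (σ θ : ℤˣ) (κ : ℤ) : Fock D.ContSpace →ₗ.[ℂ] Fock D.ContSpace :=
  (secondQuant (D.ell σ θ κ)).closure

/-- The Koo-Saleur approximant
`L⁽ᴺ⁾_{±,k} = (±1/2π) ∑_{l ∈ Γ_N} cos²(ε_N k/4) sin(ε_N (l ∓ k/2)) a†(e_{l∓k}) a(e_l)`,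
an element of the CAR algebra of the lattice one-particle space, with `k = (π/L) κ`. -/
def kooSaleur (σ θ : ℤˣ) (κ : ℤ) (N : ℕ) : CARAlgebra (D.LatSpace N) :=
  (((σ : ℤ) / (2 * Real.pi) : ℝ) : ℂ) • ∑ n ∈ Finset.Ico (-(D.len N : ℤ)) (D.len N),
    ((Real.cos (D.eps N * (Real.pi / D.L * κ) / 4) ^ 2 *
      Real.sin (D.eps N * (D.mom θ n - (σ : ℤ) * (Real.pi / D.L * κ) / 2)) : ℝ) : ℂ) •
    (CARAlgebra.cr (D.latWave N (D.mom θ (n - σ * κ))) *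
      CARAlgebra.an (D.latWave N (D.mom θ n)))

section Wavelet

variable (s : ScalingFunction)

/-- The `ε_N`-scaled and `θ`-periodized scaling function
`s^{(ε)}(z) = ∑ₘ θᵐ ε^{-1/2} s(ε⁻¹ (z + 2Lm))`. -/
def scaledScaling (θ : ℤˣ) (N : ℕ) (z : ℝ) : ℝ :=
  twistPer θ (2 * D.L) (fun y => (√(D.eps N))⁻¹ * s.toFun (y / D.eps N)) z

lemma scaledScaling_sub (θ : ℤˣ) (N : ℕ) (j : ℤ) (z : ℝ) :
    D.scaledScaling s θ N (z - D.eps N * j) = twistPer θ (2 * D.L)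
      (fun y => (√(D.eps N))⁻¹ * s.toFun ((y - D.eps N * j) / D.eps N)) z := by
  simp only [scaledScaling, twistPer]
  refine tsum_congr fun m => ?_
  congr 4
  ring

lemma hasCompactSupport_aux (N : ℕ) (j : ℤ) :
    HasCompactSupport fun y => (√(D.eps N))⁻¹ * s.toFun ((y - D.eps N * j) / D.eps N) := by
  refine HasCompactSupport.mul_left (f := fun _ => (√(D.eps N))⁻¹) ?_
  have h := s.hasCompactSupport_toFun.comp_homeomorph
    ((Homeomorph.subRight (D.eps N * j)).trans
      (Homeomorph.mulRight₀ (D.eps N)⁻¹ (inv_ne_zero (D.eps_pos N).ne')))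
  exact h

lemma continuous_aux (N : ℕ) (j : ℤ) :
    Continuous fun y => (√(D.eps N))⁻¹ * s.toFun ((y - D.eps N * j) / D.eps N) := by
  have := s.continuous_toFun
  fun_prop

lemma continuous_scaledScaling (θ : ℤˣ) (N : ℕ) : Continuous (D.scaledScaling s θ N) := by
  have h := twistPer_continuous (D.continuous_aux s N 0) (D.hasCompactSupport_aux s N 0) θ
    (T := 2 * D.L) (by linarith [D.L_pos])
  have e : D.scaledScaling s θ N = twistPer θ (2 * D.L)
      (fun y => (√(D.eps N))⁻¹ * s.toFun ((y - D.eps N * (0 : ℤ)) / D.eps N)) := by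
    funext z
    rw [← scaledScaling_sub]
    simp
  rw [e]
  exact h

lemma memLp_scaled (θ : ℤˣ) (N : ℕ) (j : ℤ) :
    MemLp (fun z : ℝ => ((D.scaledScaling s θ N (z - D.eps N * j) : ℝ) : ℂ)) 2
      D.circleMeasure := by
  have hc : Continuous fun z : ℝ => ((D.scaledScaling s θ N (z - D.eps N * j) : ℝ) : ℂ) := by
    have := D.continuous_scaledScaling s θ N
    fun_prop
  obtain ⟨C, hC⟩ := (isCompact_Icc (a := -D.L) (b := D.L)).exists_bound_of_continuousOn
    hc.continuousOn
  refine MemLp.of_bound hc.aestronglyMeasurable C ?_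
  rw [circleMeasure, ae_restrict_iff' measurableSet_Ico]
  exact Eventually.of_forall fun x hx => hC x (Set.Ico_subset_Icc_self hx)

/-- The shifted function `s^{(ε_N)}(· - x)` at the site `x = ε_N j`, in `L²` of the circle. -/
def scalingVec (θ : ℤˣ) (N : ℕ) (j : ℤ) : D.ContSpace := (D.memLp_scaled s θ N j).toLp _

lemma integral_aux (N : ℕ) (i j m : ℤ) :
    ∫ z, ((√(D.eps N))⁻¹ * s.toFun ((z - D.eps N * i) / D.eps N)) *
      ((√(D.eps N))⁻¹ * s.toFun ((z + 2 * D.L * m - D.eps N * j) / D.eps N)) =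
    if j - i - 2 * D.len N * m = 0 then 1 else 0 := by
  have he := D.eps_pos N
  have h1 := s.orthonormal_translates (j - i - 2 * D.len N * m)
  rw [← h1]
  have h2 : ∀ z, ((√(D.eps N))⁻¹ * s.toFun ((z - D.eps N * i) / D.eps N)) *
      ((√(D.eps N))⁻¹ * s.toFun ((z + 2 * D.L * m - D.eps N * j) / D.eps N)) =
      (D.eps N)⁻¹ * (fun y => s.toFun (y - i) *
        s.toFun (y - i - ((j - i - 2 * D.len N * m : ℤ) : ℝ))) (z / D.eps N) := by
    intro z
    have e1 : (z - D.eps N * i) / D.eps N = z / D.eps N - i := by field_simp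
    have e2 : (z + 2 * D.L * m - D.eps N * j) / D.eps N =
        z / D.eps N - i - ((j - i - 2 * D.len N * m : ℤ) : ℝ) := by
      rw [← D.eps_mul_len N]; push_cast; field_simp; ring
    have e3 : (√(D.eps N))⁻¹ * (√(D.eps N))⁻¹ = (D.eps N)⁻¹ := by
      rw [← mul_inv, Real.mul_self_sqrt he.le]
    rw [e1, e2]
    linear_combination s.toFun (z / D.eps N - i) *
      s.toFun (z / D.eps N - i - ((j - i - 2 * D.len N * m : ℤ) : ℝ)) * e3
  simp_rw [h2]
  rw [integral_const_mul, Measure.integral_comp_div (fun y => s.toFun (y - i) *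
    s.toFun (y - i - ((j - i - 2 * D.len N * m : ℤ) : ℝ))), abs_of_pos he, smul_eq_mul,
    inv_mul_cancel_left₀ he.ne']
  exact integral_sub_right_eq_self (fun y => s.toFun y *
    s.toFun (y - ((j - i - 2 * D.len N * m : ℤ) : ℝ))) (i : ℝ)

lemma inner_scalingVec (θ : ℤˣ) (N : ℕ) {i j : ℤ}
    (hi : i ∈ Finset.Ico (-(D.len N : ℤ)) (D.len N))
    (hj : j ∈ Finset.Ico (-(D.len N : ℤ)) (D.len N)) :
    ⟪D.scalingVec s θ N i, D.scalingVec s θ N j⟫_ℂ = if i = j then 1 else 0 := by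
  obtain ⟨M, hM⟩ := twistPer_inner (D.continuous_aux s N i) (D.hasCompactSupport_aux s N i)
    (D.continuous_aux s N j) (D.hasCompactSupport_aux s N j) θ D.L_pos
  have h := hM M le_rfl
  simp_rw [← scaledScaling_sub, integral_aux] at h
  have e : ⟪D.scalingVec s θ N i, D.scalingVec s θ N j⟫_ℂ =
      ((∫ z in (-D.L)..D.L, D.scaledScaling s θ N (z - D.eps N * i) *
        D.scaledScaling s θ N (z - D.eps N * j) : ℝ) : ℂ) := by
    rw [← intervalIntegral.integral_ofReal, L2.inner_def,
      intervalIntegral.integral_of_le (by linarith [D.L_pos]), ← integral_Ico_eq_integral_Ioc]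
    refine integral_congr_ae ?_
    filter_upwards [(D.memLp_scaled s θ N i).coeFn_toLp, (D.memLp_scaled s θ N j).coeFn_toLp]
      with x hp hq
    rw [scalingVec, scalingVec, hp, hq, RCLike.inner_apply]
    simp [mul_comm]
  rw [e, h]
  rw [Finset.mem_Ico] at hi hj
  have key : ∀ m : ℤ, (j - i - 2 * D.len N * m = 0) ↔ (m = 0 ∧ i = j) := by
    intro m
    constructor
    · intro h0
      have hm : m = 0 := by
        by_contra hm
        rcases lt_or_gt_of_ne hm with h' | h'
        · nlinarith
        · nlinarith
      subst hm
      exact ⟨rfl, by linarith⟩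
    · rintro ⟨rfl, rfl⟩; ring
  simp_rw [key]
  by_cases hij : i = j
  · simp [hij]
  · simp [hij]

/-- The isometry `R^N_∞ ξ = ∑_{x ∈ Λ_N} ξ_x s^{(ε_N)}(· - x)`. -/
def R (θ : ℤˣ) (N : ℕ) : D.LatSpace N →ₗᵢ[ℂ] D.ContSpace :=
  LinearMap.isometryOfInner
    { toFun := fun ξ => ∑ j : D.Sites N, ξ j • D.scalingVec s θ N j
      map_add' := fun ξ η => by simp [add_smul, Finset.sum_add_distrib]
      map_smul' := fun c ξ => by simp [mul_smul, Finset.smul_sum] }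
    fun ξ η => by
      have ho : Orthonormal ℂ fun j : D.Sites N => D.scalingVec s θ N j := by
        rw [orthonormal_iff_ite]
        intro i j
        rw [D.inner_scalingVec s θ N i.2 j.2]
        exact if_congr Subtype.ext_iff.symm rfl rfl
      simp only [LinearMap.coe_mk, AddHom.coe_mk]
      rw [ho.inner_sum]
      rw [PiLp.inner_apply]
      exact Finset.sum_congr rfl fun j _ => by rw [RCLike.inner_apply, mul_comm]

lemma R_apply (θ : ℤˣ) (N : ℕ) (ξ : D.LatSpace N) :
    D.R s θ N ξ = ∑ j : D.Sites N, ξ j • D.scalingVec s θ N j := rfl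

/-- The morphism `α^N_∞` of CAR algebras, `a^♯(ξ) ↦ a^♯(R^N_∞ ξ)`. -/
def alpha (θ : ℤˣ) (N : ℕ) : CARAlgebra (D.LatSpace N) →ₐ[ℂ] CARAlgebra D.ContSpace :=
  carMap (D.R s θ N)

/-- The wavelet span `D_W = ⋃_N R^N_∞ ℓ²(Λ_N)`, an increasing union of subspaces. -/
def waveletSpan (θ : ℤˣ) : Submodule ℂ D.ContSpace :=
  ⨆ N : ℕ, LinearMap.range (D.R s θ N).toLinearMap

end Wavelet

end LatticeData
end Lattice
end KS
end

noncomputable section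

namespace KS

universe u

/-! ### Creation operators and algebraic Fock subspaces -/

section FockTools

variable {h : Type u} [NormedAddCommGroup h] [InnerProductSpace ℂ h]

/-! Everything reduces to one-particle statements in Fourier space. There `ℓ_{±,k}` is a shift of
the momentum composed with multiplication by a real symbol linear in the momentum, and its closure
has the maximal domain: `ellGraph` consists of all pairs of vectors whose Fourier coefficients are
related in this way (`ell_graph`). The coefficients of `R^N_∞ η` are those of `η` on the lattice,
extended periodically in momentum, times `√ε_N ŝ(ε_N p)` (`inner_wave_R`).

Core. The rescaled image `interp` of a lattice plane wave has constant norm and converges to the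
continuum plane wave, because `ŝ` is continuous and `ŝ(0) = 1`. Orthonormality of the translates
forces `ŝ(2πq) = 0` for `q ≠ 0` (`ft_two_pi_mul`), so the periodization of `s'` vanishes. Since `s'
∈ L²` has compact support, this gives `∑_q |t + 2πq|² |ŝ(t + 2πq)|² ≤ C t²`
(`Regular.exists_bound`). With `t = ε_N l` the factors `ε_N²` cancel, so the vectors `interp` lie in
the domain of `ℓ_{±,k}` and their images are bounded uniformly in `N`. These images converge weakly,
and a closed subspace contains weak limits; hence the wavelet span is a core of `ℓ_{±,k}`
(`ell_graph_le_closure`).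

Convergence. On `R^N_∞ η` the one-particle Koo-Saleur operator is the Fourier multiplier `sin(ε_N (l
∓ k/2)) / ε_N`, followed by the compressed lattice shift and a scalar (`oneParticle_R`). The
multiplier tends to `l ∓ k/2` and is dominated by it in absolute value, so dominated convergence
applies on the domain of `ℓ_{±,k}`. The shifts are contractions and converge strongly
(`tendsto_oneParticle`).

Fock space. The vacuum and the creation operators generate the algebraic Fock spaces, and pairs `(ξ,
Tξ)` generate in the same way the graph of `dF₀(T)`. As creation is jointly continuous, density,
cores and convergence pass from one particle to finitely many. The formal adjoint `ℓ_{±,-k}` of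
`ℓ_{±,k}` makes `dF₀(ℓ_{±,k})` closable. -/

lemma norm_create_le (ξ : h) : ‖create ξ‖ ≤ ‖ξ‖ := by
  refine ContinuousLinearMap.opNorm_le_bound _ (norm_nonneg _) fun w => ?_
  induction w using UniformSpace.Completion.induction_on with
  | hp => exact isClosed_le (by fun_prop) (by fun_prop)
  | ih w =>
    rw [create_coe, UniformSpace.Completion.norm_coe, UniformSpace.Completion.norm_coe]
    exact norm_ι_mul_le ξ w

variable (h) in
/-- The creation operators as a continuous linear map in the one-particle vector. -/
def createCLM : h →L[ℂ] Fock h →L[ℂ] Fock h :=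
  LinearMap.mkContinuous ⟨⟨create, create_add⟩, create_smul⟩ 1 fun ξ => by
    simpa using norm_create_le ξ

lemma createCLM_apply (ξ : h) : createCLM h ξ = create ξ := rfl

/-- The action of a pair `(ξ, Tξ)` of one-particle vectors on a pair `(u, dF₀(T)u)`. -/
def pairCreate (p : h × h) (q : Fock h × Fock h) : Fock h × Fock h :=
  (create p.1 q.1, create p.2 q.1 + create p.1 q.2)

/-- Joint continuity is what allows both arguments to be replaced by limits at once in
`map_mem_closure₂`. -/
lemma continuous_pairCreate :
    Continuous fun x : (h × h) × (Fock h × Fock h) => pairCreate x.1 x.2 := by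
  simp only [pairCreate, ← createCLM_apply]
  fun_prop

lemma annihilate_vacuum (ξ : h) : annihilate ξ (vacuum : Fock h) = 0 := by
  rw [vacuum, annihilate_coe, ← map_one (algebraMap ℂ (FockAlg h)), FockAlg.contract_algebraMap,
    UniformSpace.Completion.coe_zero]

/-- The inclusion of finite-particle vectors over a subspace. -/
def inclAlg (V : Submodule ℂ h) : ExteriorAlgebra ℂ V →ₐ[ℂ] FockAlg h := ExteriorAlgebra.map V.subtype

lemma inclAlg_ι_mul (V : Submodule ℂ h) (y : V) (u : ExteriorAlgebra ℂ V) :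
    inclAlg V (ExteriorAlgebra.ι ℂ y * u) = FockAlg.ι (y : h) * inclAlg V u := by
  rw [inclAlg, map_mul, ExteriorAlgebra.map_apply_ι]; rfl

lemma algFockIncl_eq (V : Submodule ℂ h) (u : ExteriorAlgebra ℂ V) :
    algFockIncl V u = ((inclAlg V u : FockAlg h) : Fock h) := rfl

lemma algFockIncl_one (V : Submodule ℂ h) : algFockIncl V 1 = vacuum := by
  rw [algFockIncl_eq, map_one]; rfl

lemma vacuum_mem_algFock (V : Submodule ℂ h) : vacuum ∈ algFock V :=
  ⟨1, algFockIncl_one V⟩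

lemma algFockIncl_ι_mul (V : Submodule ℂ h) (x : V) (u : ExteriorAlgebra ℂ V) :
    algFockIncl V (ExteriorAlgebra.ι ℂ x * u) = create (x : h) (algFockIncl V u) := by
  rw [algFockIncl_eq, algFockIncl_eq, create_coe, inclAlg_ι_mul]

lemma create_mem_algFock {V : Submodule ℂ h} {ξ : h} (hξ : ξ ∈ V) {w : Fock h}
    (hw : w ∈ algFock V) : create ξ w ∈ algFock V := by
  obtain ⟨u, hu⟩ := LinearMap.mem_range.1 hw
  rw [← hu]
  exact LinearMap.mem_range.2 ⟨ExteriorAlgebra.ι ℂ (⟨ξ, hξ⟩ : V) * u, algFockIncl_ι_mul V ⟨ξ, hξ⟩ u⟩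

lemma exterior_left_induction {V : Type*} [AddCommGroup V] [Module ℂ V]
    {P : ExteriorAlgebra ℂ V → Prop}
    (one : P 1) (smul : ∀ (c : ℂ) u, P u → P (c • u)) (add : ∀ u v, P u → P v → P (u + v))
    (ι_mul : ∀ x u, P u → P (ExteriorAlgebra.ι ℂ x * u)) (u : ExteriorAlgebra ℂ V) : P u :=
  CliffordAlgebra.left_induction (Q := (0 : QuadraticForm ℂ V))
    (fun r => by rw [Algebra.algebraMap_eq_smul_one]; exact smul r 1 one) add
    (fun u x hu => ι_mul x u hu) u

/-- An induction principle: `algFock V` is the smallest subspace containing the vacuum and stable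
under creation of vectors of `V`. -/
lemma algFock_le_of_create {V : Submodule ℂ h} {S : Submodule ℂ (Fock h)} (h0 : vacuum ∈ S)
    (h1 : ∀ ξ ∈ V, ∀ w ∈ S, create ξ w ∈ S) : algFock V ≤ S := by
  rintro _ ⟨u, rfl⟩
  induction u using exterior_left_induction with
  | one =>
    rwa [algFockIncl_one]
  | smul c u hu => rw [map_smul]; exact S.smul_mem c hu
  | add u v hu hv => rw [map_add]; exact S.add_mem hu hv
  | ι_mul x u hu => rw [algFockIncl_ι_mul]; exact h1 _ x.2 _ hu

lemma algFock_mono {V W : Submodule ℂ h} (hVW : V ≤ W) : algFock V ≤ algFock W :=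
  algFock_le_of_create (vacuum_mem_algFock W) fun _ hξ _ hw => create_mem_algFock (hVW hξ) hw

/-- The closure of `algFock V` contains the vacuum and, by joint continuity and density of `V`, is
stable under every creation operator. Hence it contains all finite-particle vectors. -/
lemma dense_algFock {V : Submodule ℂ h} (hV : Dense (V : Set h)) :
    Dense (algFock V : Set (Fock h)) := by
  have key : algFock (⊤ : Submodule ℂ h) ≤ (algFock V).topologicalClosure := by
    refine algFock_le_of_create (Submodule.le_topologicalClosure _ (vacuum_mem_algFock V))
      fun ξ _ w hw => ?_
    have hc : Continuous fun x : h × Fock h => create x.1 x.2 := by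
      simp only [← createCLM_apply]; fun_prop
    refine map_mem_closure₂ (f := fun ξ w => create ξ w) (s := (V : Set h))
      (t := (algFock V : Set (Fock h))) hc (hV ξ) hw fun a ha b hb => ?_
    exact create_mem_algFock ha hb
  have hd : DenseRange ((↑) : FockAlg h → Fock h) := UniformSpace.Completion.denseRange_coe
  have hsub : Set.range ((↑) : FockAlg h → Fock h) ⊆ (algFock V).topologicalClosure := by
    rintro _ ⟨u, rfl⟩
    induction u using FockAlg.induction_left with
    | h1 r =>
      rw [Algebra.algebraMap_eq_smul_one, UniformSpace.Completion.coe_smul]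
      exact Submodule.smul_mem _ _ (key (vacuum_mem_algFock _))
    | h2 u v hu hv =>
      rw [UniformSpace.Completion.coe_add]; exact Submodule.add_mem _ hu hv
    | h3 u ξ hu =>
      rw [← create_coe]
      have hc : Continuous fun x : h × Fock h => create x.1 x.2 := by
        simp only [← createCLM_apply]; fun_prop
      refine map_mem_closure₂ (f := fun ξ w => create ξ w) (s := (V : Set h))
        (t := (algFock V : Set (Fock h))) hc (hV ξ) hu fun a ha b hb => ?_
      exact create_mem_algFock ha hb
  exact dense_closure.1 (hd.mono hsub)

/-! ### The graph of a second quantization -/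

section Graph

variable (T : h →ₗ.[ℂ] h)

lemma secondQuant_graph (u : ExteriorAlgebra ℂ T.domain) :
    (algFockIncl T.domain u, ((secondQuantAlg T u : FockAlg h) : Fock h)) ∈
      (secondQuant T).graph := by
  rw [LinearPMap.mem_graph_iff]
  refine ⟨⟨algFockIncl T.domain u, u, rfl⟩, rfl, ?_⟩
  change ((secondQuantAlg T ((LinearEquiv.ofInjective _ (algFockIncl_injective T.domain)).symm
    (LinearEquiv.ofInjective _ (algFockIncl_injective T.domain) u)) : FockAlg h) : Fock h) = _
  rw [LinearEquiv.symm_apply_apply]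

variable {T}

lemma mem_secondQuant_graph {p : Fock h × Fock h} (hp : p ∈ (secondQuant T).graph) :
    ∃ u, p = (algFockIncl T.domain u, ((secondQuantAlg T u : FockAlg h) : Fock h)) := by
  obtain ⟨⟨_, u, rfl⟩, h1, h2⟩ := (LinearPMap.mem_graph_iff _).1 hp
  refine ⟨u, Prod.ext h1.symm ?_⟩
  refine h2.symm.trans ?_
  change ((secondQuantAlg T ((LinearEquiv.ofInjective _ (algFockIncl_injective T.domain)).symm
    (LinearEquiv.ofInjective _ (algFockIncl_injective T.domain) u)) : FockAlg h) : Fock h) = _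
  rw [LinearEquiv.symm_apply_apply]

lemma vacuum_secondQuant_graph : (vacuum, 0) ∈ (secondQuant T).graph := by
  have := secondQuant_graph T 1
  rw [secondQuantAlg_one, UniformSpace.Completion.coe_zero] at this
  rwa [algFockIncl_one] at this

/-- The Leibniz rule for `dF₀(T)`, phrased as an action of the graph of `T` on the graph of
`dF₀(T)`. -/
lemma pairCreate_coe (x : T.domain) (u : ExteriorAlgebra ℂ T.domain) :
    pairCreate ((x : h), T x) (algFockIncl T.domain u, ((secondQuantAlg T u : FockAlg h) : Fock h)) =
      (algFockIncl T.domain (ExteriorAlgebra.ι ℂ x * u),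
        ((secondQuantAlg T (ExteriorAlgebra.ι ℂ x * u) : FockAlg h) : Fock h)) := by
  rw [algFockIncl_ι_mul, secondQuantAlg_ι_mul, UniformSpace.Completion.coe_add, ← create_coe,
    ← create_coe]
  rfl

lemma pairCreate_graph {p : h × h} (hp : p ∈ T.graph) {q : Fock h × Fock h}
    (hq : q ∈ (secondQuant T).graph) : pairCreate p q ∈ (secondQuant T).graph := by
  obtain ⟨u, rfl⟩ := mem_secondQuant_graph hq
  obtain ⟨x, h1, h2⟩ := (LinearPMap.mem_graph_iff _).1 hp
  obtain rfl : p = ((x : h), T x) := Prod.ext h1.symm h2.symm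
  rw [pairCreate_coe]
  exact secondQuant_graph T _

/-- The counterpart of `algFock_le_of_create` for graphs: `(vacuum, 0)` and `pairCreate` generate
the graph of `dF₀(T)`. -/
lemma secondQuant_graph_le {S : Submodule ℂ (Fock h × Fock h)} (h0 : (vacuum, 0) ∈ S)
    (h1 : ∀ p ∈ T.graph, ∀ q ∈ S, pairCreate p q ∈ S) : (secondQuant T).graph ≤ S := by
  intro q hq
  obtain ⟨u, rfl⟩ := mem_secondQuant_graph hq
  clear hq
  induction u using exterior_left_induction with
  | one =>
    rwa [algFockIncl_one, secondQuantAlg_one, UniformSpace.Completion.coe_zero]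
  | smul c u hu =>
    rw [map_smul, map_smul, UniformSpace.Completion.coe_smul]; exact S.smul_mem c hu
  | add u v hu hv =>
    rw [map_add, map_add, UniformSpace.Completion.coe_add]; exact S.add_mem hu hv
  | ι_mul x u hu => rw [← pairCreate_coe]; exact h1 _ (T.mem_graph x) _ hu

/-- The second quantization of a graph core is contained in the closure of the second quantization
restricted to that core. -/
lemma secondQuant_graph_le_closure {V : Submodule ℂ h}
    (hcore : T.graph ≤ (T.domRestrict V).graph.topologicalClosure) :
    (secondQuant T).graph ≤
      ((secondQuant T).graph ⊓ (algFock V).comap (LinearMap.fst ℂ _ _)).topologicalClosure := by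
  have hc := continuous_pairCreate (h := h)
  refine secondQuant_graph_le
    (Submodule.le_topologicalClosure _ ⟨vacuum_secondQuant_graph, vacuum_mem_algFock V⟩)
    fun p hp q hq => ?_
  -- `p` is a limit of pairs of `T` over `V`, and `q` a limit of pairs of `dF₀(T)` over `algFock V`.
  -- The action maps such approximants to pairs of the latter kind.
  refine map_mem_closure₂ (f := pairCreate) hc (hcore hp) hq fun a ha b hb => ?_
  obtain ⟨x, h1, h2⟩ := (LinearPMap.mem_graph_iff _).1 ha
  have hxV : a.1 ∈ V := by rw [← h1]; exact x.2.1
  refine ⟨pairCreate_graph (LinearPMap.le_graph_of_le LinearPMap.domRestrict_le ha) hb.1, ?_⟩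
  exact create_mem_algFock hxV hb.2

end Graph

/-! ### Formal adjoints and closability -/

section Adjoint

variable {T T' : h →ₗ.[ℂ] h}

/-- Contraction on the exterior algebra of a subspace. -/
def subContract (V : Submodule ℂ h) (x : h) : ExteriorAlgebra ℂ V →ₗ[ℂ] ExteriorAlgebra ℂ V :=
  CliffordAlgebra.contractLeft (Q := (0 : QuadraticForm ℂ V)) (innerₛₗ ℂ x ∘ₗ V.subtype)

lemma subContract_ι_mul (V : Submodule ℂ h) (x : h) (y : V) (u : ExteriorAlgebra ℂ V) :
    subContract V x (ExteriorAlgebra.ι ℂ y * u) =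
      ⟪x, (y : h)⟫_ℂ • u - ExteriorAlgebra.ι ℂ y * subContract V x u :=
  CliffordAlgebra.contractLeft_ι_mul (Q := (0 : QuadraticForm ℂ V)) (innerₛₗ ℂ x ∘ₗ V.subtype) y u

lemma subContract_one (V : Submodule ℂ h) (x : h) :
    subContract V x (1 : ExteriorAlgebra ℂ V) = 0 :=
  CliffordAlgebra.contractLeft_one (Q := (0 : QuadraticForm ℂ V)) (innerₛₗ ℂ x ∘ₗ V.subtype)

lemma contract_one (x : h) : FockAlg.contract x (1 : FockAlg h) = 0 := by
  simpa using FockAlg.contract_algebraMap x 1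

lemma inclAlg_subContract (V : Submodule ℂ h) (x : h) (u : ExteriorAlgebra ℂ V) :
    inclAlg V (subContract V x u) = FockAlg.contract x (inclAlg V u) := by
  induction u using exterior_left_induction with
  | one => rw [subContract_one, map_zero, map_one, contract_one]
  | smul c u hu => simp only [map_smul, hu]
  | add u v hu hv => simp only [map_add, hu, hv]
  | ι_mul y u hu =>
    rw [subContract_ι_mul, inclAlg_ι_mul, FockAlg.contract_ι_mul, map_sub, map_smul,
      inclAlg_ι_mul, hu]

/-- The commutation relation `[a(x), dF₀(T')] = a(Tx)` for formally adjoint `T` and `T'`, proved by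
peeling off one factor at a time. -/
lemma contract_secondQuantAlg (hT : ∀ (x : T.domain) (y : T'.domain), ⟪(x : h), T' y⟫_ℂ = ⟪T x, y⟫_ℂ)
    (x : T.domain) (u : ExteriorAlgebra ℂ T'.domain) :
    FockAlg.contract (x : h) (secondQuantAlg T' u) =
      secondQuantAlg T' (subContract T'.domain x u) +
        FockAlg.contract (T x) (inclAlg T'.domain u) := by
  induction u using exterior_left_induction with
  | one => rw [secondQuantAlg_one, subContract_one, map_one, contract_one]; simp
  | smul c u hu => simp only [map_smul, hu, smul_add]
  | add u v hu hv => simp only [map_add, hu, hv]; abel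
  | ι_mul y u hu =>
    have e : ExteriorAlgebra.map T'.domain.subtype = inclAlg T'.domain := rfl
    rw [secondQuantAlg_ι_mul, subContract_ι_mul, map_add, FockAlg.contract_ι_mul,
      FockAlg.contract_ι_mul, hu, map_sub, map_smul, secondQuantAlg_ι_mul, inclAlg_ι_mul,
      FockAlg.contract_ι_mul, hT, e, inclAlg_subContract, mul_add]
    abel

/-- Formal adjointness lifts to Fock space: moving a factor `x` of `w` across the pairing turns it
into a contraction, and `contract_secondQuantAlg` produces exactly the term with `T x`. -/
lemma pair_secondQuantAlg (hT : ∀ (x : T.domain) (y : T'.domain), ⟪(x : h), T' y⟫_ℂ = ⟪T x, y⟫_ℂ)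
    (w : ExteriorAlgebra ℂ T.domain) (u : ExteriorAlgebra ℂ T'.domain) :
    FockAlg.pair (secondQuantAlg T w) (inclAlg T'.domain u) =
      FockAlg.pair (inclAlg T.domain w) (secondQuantAlg T' u) := by
  induction w using exterior_left_induction generalizing u with
  | one =>
    rw [secondQuantAlg_one, map_one, map_zero, ← map_one (algebraMap ℂ (FockAlg h)),
      FockAlg.pair_algebraMap]
    induction u using exterior_left_induction with
    | one => simp [secondQuantAlg_one]
    | smul c u hu => 
      simp only [LinearMap.zero_apply, one_mul] at hu
      simp [← hu]
    | add u v hu hv =>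
      simp only [LinearMap.zero_apply, one_mul] at hu hv
      simp [← hu, ← hv]
    | ι_mul y u hu => simp [secondQuantAlg_ι_mul, FockAlg.vacConj_ι_mul]
  | smul c w hw => simp [hw]
  | add w v hw hv => simp [hw, hv]
  | ι_mul x w hw =>
    rw [secondQuantAlg_ι_mul, map_add, LinearMap.add_apply, FockAlg.pair_ι_mul, FockAlg.pair_ι_mul,
      inclAlg_ι_mul, FockAlg.pair_ι_mul, contract_secondQuantAlg hT, map_add,
      ← hw, inclAlg_subContract, add_comm]
    rfl

/-- If `T` has a densely defined formal adjoint, then `dF₀(T)` is closable. -/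
lemma secondQuant_isClosable
    (hT : ∀ (x : T.domain) (y : T'.domain), ⟪(x : h), T' y⟫_ℂ = ⟪T x, y⟫_ℂ)
    (hd : Dense (T'.domain : Set h)) : (secondQuant T).IsClosable := by
  have key : ∀ v, (0, v) ∈ (secondQuant T).graph.topologicalClosure → v = 0 := by
    intro v hv
    -- The adjoint relation is a closed condition on pairs, so it survives in the closure of the
    -- graph. For a pair `(0, v)` it says that `v` is orthogonal to the dense space `algFock
    -- T'.domain`.
    have hclosed : IsClosed {p : Fock h × Fock h | ∀ u : ExteriorAlgebra ℂ T'.domain,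
        ⟪algFockIncl T'.domain u, p.2⟫_ℂ =
          ⟪((secondQuantAlg T' u : FockAlg h) : Fock h), p.1⟫_ℂ} := by
      rw [Set.ofPred_forall]
      exact isClosed_iInter fun u => isClosed_eq (by fun_prop) (by fun_prop)
    have hsub : ((secondQuant T).graph : Set (Fock h × Fock h)) ⊆
        {p : Fock h × Fock h | ∀ u : ExteriorAlgebra ℂ T'.domain,
        ⟪algFockIncl T'.domain u, p.2⟫_ℂ =
          ⟪((secondQuantAlg T' u : FockAlg h) : Fock h), p.1⟫_ℂ} := by
      intro p hp u
      obtain ⟨w, rfl⟩ := mem_secondQuant_graph hp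
      have e1 : algFockIncl T'.domain u = ((inclAlg T'.domain u : FockAlg h) : Fock h) := rfl
      have e2 : algFockIncl T.domain w = ((inclAlg T.domain w : FockAlg h) : Fock h) := rfl
      simp only [e1, e2]
      rw [UniformSpace.Completion.inner_coe, UniformSpace.Completion.inner_coe, fock_inner_def,
        fock_inner_def, pair_secondQuantAlg hT]
    have hv' := closure_minimal hsub hclosed hv
    refine (dense_algFock hd).eq_zero_of_inner_left (𝕜 := ℂ) fun w hw => ?_
    obtain ⟨u, rfl⟩ := LinearMap.mem_range.1 hw
    have := hv' u
    simp only [inner_zero_right] at this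
    rw [← inner_conj_symm]
    simp [this]
  refine ⟨(secondQuant T).graph.topologicalClosure.toLinearPMap, ?_⟩
  rw [Submodule.toLinearPMap_graph_eq]
  rintro ⟨a, b⟩ hab rfl
  exact key b hab

end Adjoint

/-! ### Convergence of derivations on product vectors -/

section Convergence

variable {T : h →ₗ.[ℂ] h}

lemma fockVector_succ {n : ℕ} (ξ : Fin (n + 1) → h) :
    fockVector ξ = create (ξ 0) (fockVector fun i => ξ i.succ) := by
  simp [fockVector, List.ofFn_succ]

/-- By `hB0` and `hB`, each `B N` kills the vacuum and obeys the Leibniz rule with one-particle map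
`A N`. So convergence of `A N` on the individual factors propagates by induction on their number,
and the limit obeys the Leibniz rule of `dF₀(T)`. -/
lemma tendsto_fockVector {B : ℕ → Fock h →L[ℂ] Fock h} {A : ℕ → h → h}
    (hB0 : ∀ N, B N vacuum = 0)
    (hB : ∀ N ξ w, B N (create ξ w) = create (A N ξ) w + create ξ (B N w))
    {n : ℕ} (ξ : Fin n → h) (hξ : ∀ i, ∃ ζ, (ξ i, ζ) ∈ T.graph ∧
      Tendsto (fun N => A N (ξ i)) atTop (𝓝 ζ)) :
    ∃ v, (fockVector ξ, v) ∈ (secondQuant T).graph ∧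
      Tendsto (fun N => B N (fockVector ξ)) atTop (𝓝 v) := by
  induction n with
  | zero =>
    refine ⟨0, ?_, ?_⟩
    · simpa [fockVector] using vacuum_secondQuant_graph
    · simp [fockVector, hB0]
  | succ n ih =>
    obtain ⟨v, hv, hlim⟩ := ih (fun i => ξ i.succ) fun i => hξ i.succ
    obtain ⟨ζ, hζ, hA⟩ := hξ 0
    refine ⟨create ζ (fockVector fun i => ξ i.succ) + create (ξ 0) v, ?_, ?_⟩
    · rw [fockVector_succ]
      exact pairCreate_graph hζ hv
    · rw [fockVector_succ]
      simp only [hB]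
      refine Tendsto.add ?_ ((create (ξ 0)).continuous.continuousAt.tendsto.comp hlim)
      simp only [← createCLM_apply]
      have : Continuous fun x => createCLM h x (fockVector fun i => ξ i.succ) := by fun_prop
      exact this.continuousAt.tendsto.comp hA

end Convergence

end FockTools

end KS

/-! ### Fourier series on the twisted circle -/

namespace KS
namespace LatticeData

variable (D : LatticeData) (θ : ℤˣ)

/-- The plane waves of the sector `θ`. -/
def wave (n : ℤ) : D.ContSpace := D.contWave (D.mom θ n)

lemma inner_wave_self (n : ℤ) : ⟪D.wave θ n, D.wave θ n⟫_ℂ = 2 * D.L := by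
  rw [wave, inner_contWave]
  simp
  ring

lemma inner_wave (m n : ℤ) : ⟪D.wave θ m, D.wave θ n⟫_ℂ = if m = n then 2 * (D.L : ℂ) else 0 := by
  split_ifs with h
  · rw [h, inner_wave_self]
  · exact D.inner_contWave_mom θ h

lemma norm_sq_wave (n : ℤ) : ‖D.wave θ n‖ ^ 2 = 2 * D.L := by
  rw [@norm_sq_eq_re_inner ℂ, inner_wave_self]
  simp

lemma inner_contWave_eq (p : ℝ) (v : D.ContSpace) : ⟪D.contWave p, v⟫_ℂ =
    ∫ x in (-D.L)..D.L, Complex.exp (-(Complex.I * (p * x : ℝ))) * v x := by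
  rw [L2.inner_def, intervalIntegral.integral_of_le (by linarith [D.L_pos]),
    ← integral_Ico_eq_integral_Ioc]
  refine integral_congr_ae ?_
  filter_upwards [(D.memLp_planeWave p).coeFn_toLp] with x hp
  rw [contWave, hp, RCLike.inner_apply, ← Complex.exp_conj, mul_comm]
  congr 2
  simp

lemma circleMeasure_eq : D.circleMeasure = volume.restrict (Set.Ioc (-D.L) D.L) :=
  Measure.restrict_congr_set Ico_ae_eq_Ioc

/-- Multiplication by `e^{-idx}`, with `d` the offset of the momenta of the sector, turns the
coefficients into ordinary Fourier coefficients without changing absolute values. Parseval's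
identity then gives `‖v‖ = 0`. -/
lemma eq_zero_of_inner_wave {v : D.ContSpace} (hv : ∀ n, ⟪D.wave θ n, v⟫_ℂ = 0) : v = 0 := by
  have hL := D.L_pos
  have hab : -D.L < D.L := by linarith
  set d : ℝ := Real.pi / D.L * (if θ = 1 then 0 else 1 / 2) with hd
  set f : ℝ → ℂ := fun x => Complex.exp (-(Complex.I * (d * x : ℝ))) * v x with hf
  have hnorm : ∀ x, ‖f x‖ = ‖v x‖ := by
    intro x
    have : -(Complex.I * ((d * x : ℝ) : ℂ)) = ((-(d * x) : ℝ) : ℂ) * Complex.I := by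
      push_cast; ring
    rw [hf]
    simp only [norm_mul]
    rw [this, Complex.norm_exp_ofReal_mul_I, one_mul]
  have hmem : MemLp f 2 (volume.restrict (Set.Ioc (-D.L) D.L)) := by
    rw [← D.circleMeasure_eq]
    refine (Lp.memLp v).of_le ?_ (Eventually.of_forall fun x => (hnorm x).le)
    exact (Continuous.aestronglyMeasurable (by fun_prop)).mul (Lp.aestronglyMeasurable v)
  have hc : ∀ n, fourierCoeffOn hab f n = 0 := by
    intro n
    rw [fourierCoeffOn_eq_integral]
    have h := hv n
    rw [wave, inner_contWave_eq] at h
    convert smul_zero _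
    rw [← h]
    refine intervalIntegral.integral_congr fun x _ => ?_
    simp only [hf, smul_eq_mul]
    rw [fourier_coe_apply, ← mul_assoc, ← Complex.exp_add]
    congr 2
    have hL' : (D.L : ℂ) ≠ 0 := Complex.ofReal_ne_zero.2 hL.ne'
    simp only [mom, hd]
    push_cast
    field_simp
    ring
  have hs := hasSum_sq_fourierCoeffOn hab hmem
  simp only [hc, norm_zero, ne_eq, OfNat.ofNat_ne_zero, not_false_eq_true, zero_pow] at hs
  have h0 := hs.unique hasSum_zero
  rw [smul_eq_zero] at h0
  have h1 : ∫ x in (-D.L)..D.L, ‖f x‖ ^ 2 = 0 := h0.resolve_left (by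
    rw [inv_eq_zero]; linarith)
  have h2 : ⟪v, v⟫_ℂ = ((∫ x in (-D.L)..D.L, ‖f x‖ ^ 2 : ℝ) : ℂ) := by
    rw [L2.inner_def, intervalIntegral.integral_of_le hab.le, ← integral_Ico_eq_integral_Ioc]
    refine Eq.trans ?_ (integral_ofReal (𝕜 := ℂ))
    refine integral_congr_ae (Eventually.of_forall fun x => ?_)
    simp only [hnorm]
    rw [inner_self_eq_norm_sq_to_K]
    simp
  rw [h1, Complex.ofReal_zero] at h2
  exact inner_self_eq_zero.1 h2

lemma inner_wave_ext {v w : D.ContSpace} (h : ∀ n, ⟪D.wave θ n, v⟫_ℂ = ⟪D.wave θ n, w⟫_ℂ) :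
    v = w :=
  sub_eq_zero.1 <| D.eq_zero_of_inner_wave θ fun n => by rw [inner_sub_right, h, sub_self]

lemma sqrt_two_L_pos : 0 < √(2 * D.L) := Real.sqrt_pos.2 (by linarith [D.L_pos])

lemma sqrt_two_L_sq : ((√(2 * D.L) : ℝ) : ℂ) * ((√(2 * D.L) : ℝ) : ℂ) = 2 * D.L := by
  rw [← Complex.ofReal_mul, Real.mul_self_sqrt (by linarith [D.L_pos])]
  push_cast; rfl

/-- The normalized plane waves. -/
def unitWave (n : ℤ) : D.ContSpace := (((√(2 * D.L))⁻¹ : ℝ) : ℂ) • D.wave θ n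

lemma inner_unitWave (n : ℤ) (v : D.ContSpace) :
    ⟪D.unitWave θ n, v⟫_ℂ = (((√(2 * D.L))⁻¹ : ℝ) : ℂ) * ⟪D.wave θ n, v⟫_ℂ := by
  rw [unitWave, inner_smul_left, Complex.conj_ofReal]

lemma orthonormal_unitWave : Orthonormal ℂ (D.unitWave θ) := by
  rw [orthonormal_iff_ite]
  intro m n
  rw [inner_unitWave, unitWave, inner_smul_right, inner_wave]
  split_ifs with h
  · rw [← sqrt_two_L_sq]
    have := D.sqrt_two_L_pos.ne'
    push_cast
    have : ((√(2 * D.L) : ℝ) : ℂ) ≠ 0 := Complex.ofReal_ne_zero.2 this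
    field_simp
  · simp

/-- The Hilbert basis of normalized plane waves. -/
def waveBasis : HilbertBasis ℤ ℂ D.ContSpace :=
  HilbertBasis.mkOfOrthogonalEqBot (D.orthonormal_unitWave θ) <| by
    rw [Submodule.eq_bot_iff]
    intro v hv
    refine D.eq_zero_of_inner_wave θ fun n => ?_
    have h := (Submodule.mem_orthogonal _ _).1 hv (D.unitWave θ n) (Submodule.subset_span ⟨n, rfl⟩)
    rw [inner_unitWave, mul_eq_zero] at h
    exact h.resolve_left (by simpa using D.sqrt_two_L_pos.ne')

lemma waveBasis_apply (n : ℤ) : D.waveBasis θ n = D.unitWave θ n := by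
  simp [waveBasis]

lemma waveBasis_repr (v : D.ContSpace) (n : ℤ) :
    (D.waveBasis θ).repr v n = (((√(2 * D.L))⁻¹ : ℝ) : ℂ) * ⟪D.wave θ n, v⟫_ℂ := by
  rw [HilbertBasis.repr_apply_apply, waveBasis_apply, inner_unitWave]

lemma hasSum_wave (v : D.ContSpace) :
    HasSum (fun n => ((2 * D.L : ℂ)⁻¹ * ⟪D.wave θ n, v⟫_ℂ) • D.wave θ n) v := by
  have h := (D.waveBasis θ).hasSum_repr v
  convert h using 2 with n
  rw [waveBasis_repr, waveBasis_apply, unitWave, smul_smul, ← sqrt_two_L_sq]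
  congr 1
  push_cast
  ring

lemma hasSum_sq_inner_wave (v : D.ContSpace) :
    HasSum (fun n => ‖⟪D.wave θ n, v⟫_ℂ‖ ^ 2) (2 * D.L * ‖v‖ ^ 2) := by
  have h := lp.hasSum_norm (p := 2) (by norm_num) ((D.waveBasis θ).repr v)
  simp only [ENNReal.toReal_ofNat, Real.rpow_ofNat, LinearIsometryEquiv.norm_map] at h
  have h2 := h.mul_left (2 * D.L)
  refine h2.congr_fun fun n => ?_
  rw [waveBasis_repr, norm_mul, mul_pow, Complex.norm_real, Real.norm_eq_abs, sq_abs, inv_pow,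
    Real.sq_sqrt (by linarith [D.L_pos])]
  have := D.L_pos.ne'
  field_simp

/-- Riesz-Fischer: used to build vectors from prescribed coefficients. -/
lemma exists_inner_wave {c : ℤ → ℂ} (hc : Summable fun n => ‖c n‖ ^ 2) :
    ∃ v : D.ContSpace, ∀ n, ⟪D.wave θ n, v⟫_ℂ = c n := by
  have hm : Memℓp (fun n => (((√(2 * D.L))⁻¹ : ℝ) : ℂ) * c n) 2 := by
    refine memℓp_gen ?_
    simp only [ENNReal.toReal_ofNat, Real.rpow_ofNat, norm_mul, mul_pow]
    exact hc.mul_left _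
  refine ⟨(D.waveBasis θ).repr.symm ⟨_, hm⟩, fun n => ?_⟩
  have h := D.waveBasis_repr θ ((D.waveBasis θ).repr.symm ⟨_, hm⟩) n
  rw [LinearIsometryEquiv.apply_symm_apply] at h
  refine mul_left_cancel₀ ?_ h.symm
  simpa using D.sqrt_two_L_pos.ne'

lemma dense_trigPoly : Dense (D.trigPoly θ : Set D.ContSpace) := by
  intro v
  refine mem_closure_of_tendsto (D.hasSum_wave θ v) (Eventually.of_forall fun s => ?_)
  exact Submodule.sum_mem _ fun n _ => Submodule.smul_mem _ _ (Submodule.subset_span ⟨n, rfl⟩)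

/-! ### The one-particle Virasoro generator in Fourier space -/

section Ell

variable (σ : ℤˣ) (κ : ℤ)

/-- `l - σ k / 2` at the momentum `l` labelled by `n`. -/
def shiftMom (n : ℤ) : ℝ := D.mom θ n - (σ : ℤ) * (Real.pi / D.L * κ) / 2

/-- The matrix element of `ℓ_{±,k}` between `e_l` and `e_{l ∓ k}`. -/
def ellCoef (n : ℤ) : ℝ := (σ : ℤ) * D.L / Real.pi * D.shiftMom θ σ κ n

lemma ellTrig_graph_wave (n : ℤ) :
    (D.wave θ n, (D.ellCoef θ σ κ n : ℂ) • D.wave θ (n - σ * κ)) ∈ (D.ellTrig σ θ κ).graph := by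
  rw [LinearPMap.mem_graph_iff]
  refine ⟨⟨D.wave θ n, Submodule.subset_span ⟨n, rfl⟩⟩, rfl, ?_⟩
  change ∑ᶠ m : ℤ, (((σ : ℤ) / (2 * Real.pi) *
          (D.mom θ m - (σ : ℤ) * (Real.pi / D.L * κ) / 2) : ℝ) : ℂ) •
        ⟪D.wave θ m, D.wave θ n⟫_ℂ • D.wave θ (m - σ * κ) = _
  rw [finsum_eq_single _ n]
  -- The plane waves are not normalized: their squared norm `2L` turns the prefactor `1/(2π)` into
  -- the `L/π` of `ellCoef`.
  · rw [inner_wave_self, smul_smul]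
    congr 1
    simp only [ellCoef, shiftMom]
    push_cast
    have : (Real.pi : ℂ) ≠ 0 := Complex.ofReal_ne_zero.2 Real.pi_ne_zero
    field_simp
  · intro m hm
    rw [inner_wave, if_neg hm, zero_smul, smul_zero]

/-- The maximal graph of `ℓ_{±,k}` in terms of Fourier coefficients. -/
def ellGraph : Submodule ℂ (D.ContSpace × D.ContSpace) where
  carrier := {p | ∀ n, ⟪D.wave θ (n - σ * κ), p.2⟫_ℂ = D.ellCoef θ σ κ n * ⟪D.wave θ n, p.1⟫_ℂ}
  add_mem' {p q} hp hq n := by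
    simp only [Prod.fst_add, Prod.snd_add, inner_add_right, hp n, hq n, mul_add]
  zero_mem' n := by simp
  smul_mem' c p hp n := by
    simp only [Prod.smul_fst, Prod.smul_snd, inner_smul_right, hp n]; ring

lemma mem_ellGraph {p : D.ContSpace × D.ContSpace} : p ∈ D.ellGraph θ σ κ ↔
    ∀ n, ⟪D.wave θ (n - σ * κ), p.2⟫_ℂ = D.ellCoef θ σ κ n * ⟪D.wave θ n, p.1⟫_ℂ := Iff.rfl

lemma isClosed_ellGraph : IsClosed (D.ellGraph θ σ κ : Set (D.ContSpace × D.ContSpace)) := by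
  have : (D.ellGraph θ σ κ : Set (D.ContSpace × D.ContSpace)) = ⋂ n : ℤ,
    {p | ⟪D.wave θ (n - σ * κ), p.2⟫_ℂ = D.ellCoef θ σ κ n * ⟪D.wave θ n, p.1⟫_ℂ} := by
    ext p; simp [mem_ellGraph]
  rw [this]
  exact isClosed_iInter fun n => isClosed_eq (by fun_prop) (by fun_prop)

lemma wave_mem_ellGraph (n : ℤ) :
    (D.wave θ n, (D.ellCoef θ σ κ n : ℂ) • D.wave θ (n - σ * κ)) ∈ D.ellGraph θ σ κ := by
  intro m
  simp only [inner_smul_right, inner_wave, sub_left_inj]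
  split_ifs with h
  · rw [h]
  · simp

/-- The Fourier series of the second component, reindexed by the shift, runs in step with that of
the first. Thus every pair is a norm limit of combinations of pairs over plane waves. -/
lemma hasSum_ellGraph {p : D.ContSpace × D.ContSpace} (hp : p ∈ D.ellGraph θ σ κ) :
    HasSum (fun n => ((2 * D.L : ℂ)⁻¹ * ⟪D.wave θ n, p.1⟫_ℂ) •
      (D.wave θ n, (D.ellCoef θ σ κ n : ℂ) • D.wave θ (n - σ * κ))) p := by
  have h1 := D.hasSum_wave θ p.1
  have h2 := (Equiv.subRight ((σ : ℤ) * κ)).hasSum_iff.2 (D.hasSum_wave θ p.2)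
  convert h1.prodMk h2 using 2 with n
  simp only [Prod.smul_mk, Function.comp_apply, Equiv.subRight_apply, hp n, smul_smul]
  congr 2
  ring

/-- A closed subspace containing the graph over the plane waves contains the graph of `ℓ_{±,k}`. -/
lemma ellGraph_le {S : Submodule ℂ (D.ContSpace × D.ContSpace)}
    (hS : IsClosed (S : Set (D.ContSpace × D.ContSpace)))
    (h : ∀ n, (D.wave θ n, (D.ellCoef θ σ κ n : ℂ) • D.wave θ (n - σ * κ)) ∈ S) :
    D.ellGraph θ σ κ ≤ S := fun _ hp =>
  hS.mem_of_tendsto (D.hasSum_ellGraph θ σ κ hp) <| Eventually.of_forall fun _ =>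
    S.sum_mem fun n _ => S.smul_mem _ (h n)

lemma ellTrig_graph_le : (D.ellTrig σ θ κ).graph ≤ D.ellGraph θ σ κ := by
  intro p hp
  obtain ⟨x, h1, h2⟩ := (LinearPMap.mem_graph_iff _).1 hp
  have : ∀ ξ : D.ContSpace, ∀ hξ : ξ ∈ D.trigPoly θ,
      (ξ, D.ellTrig σ θ κ ⟨ξ, hξ⟩) ∈ D.ellGraph θ σ κ := by
    intro ξ hξ
    induction hξ using Submodule.span_induction with
    | mem x hx =>
      obtain ⟨n, rfl⟩ := hx
      have e := (LinearPMap.mem_graph_iff _).1 (D.ellTrig_graph_wave θ σ κ n)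
      obtain ⟨y, h1, h2⟩ := e
      have hy : y = ⟨D.contWave (D.mom θ n), Submodule.subset_span ⟨n, rfl⟩⟩ := Subtype.ext h1
      rw [← hy, h2]
      exact D.wave_mem_ellGraph θ σ κ n
    | zero =>
      have := (D.ellTrig σ θ κ).map_zero
      exact (show (0, D.ellTrig σ θ κ 0) ∈ D.ellGraph θ σ κ by
        rw [this]; exact Submodule.zero_mem _)
    | add x y hx hy hx' hy' =>
      have e := (D.ellTrig σ θ κ).map_add ⟨x, hx⟩ ⟨y, hy⟩
      have := Submodule.add_mem _ hx' hy'
      rw [Prod.mk_add_mk, ← e] at this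
      exact this
    | smul c x hx hx' =>
      have e := (D.ellTrig σ θ κ).map_smul c ⟨x, hx⟩
      have := Submodule.smul_mem _ c hx'
      rw [Prod.smul_mk, ← e] at this
      exact this
  have h3 := this x x.2
  rwa [show p = ((x : D.ContSpace), D.ellTrig σ θ κ x) from Prod.ext h1.symm h2.symm]

/-- Minimal and maximal operator agree: the Fourier condition is closed and holds on trigonometric
polynomials, and conversely its solutions are sums over the pairs of plane waves. -/
lemma ellGraph_eq_closure : (D.ellTrig σ θ κ).graph.topologicalClosure = D.ellGraph θ σ κ :=
  le_antisymm (Submodule.topologicalClosure_minimal _ (D.ellTrig_graph_le θ σ κ)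
    (D.isClosed_ellGraph θ σ κ)) <|
    D.ellGraph_le θ σ κ (Submodule.isClosed_topologicalClosure _) fun n =>
      Submodule.le_topologicalClosure _ (D.ellTrig_graph_wave θ σ κ n)

lemma ellTrig_isClosable : (D.ellTrig σ θ κ).IsClosable := by
  refine ⟨(D.ellGraph θ σ κ).toLinearPMap, ?_⟩
  rw [ellGraph_eq_closure, Submodule.toLinearPMap_graph_eq]
  rintro ⟨a, b⟩ hab rfl
  refine D.eq_zero_of_inner_wave θ fun n => ?_
  have := hab (n + σ * κ)
  simpa using this

lemma ell_graph : (D.ell σ θ κ).graph = D.ellGraph θ σ κ := by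
  rw [ell, ← (D.ellTrig_isClosable θ σ κ).graph_closure_eq_closure_graph, ellGraph_eq_closure]

lemma trigPoly_le_ell_domain : D.trigPoly θ ≤ (D.ell σ θ κ).domain :=
  (D.ellTrig σ θ κ).le_closure.1

/-- The symbol is centred at the midpoint of `l` and `l ∓ k`, hence unchanged when the two are
exchanged and `k` is reversed. As it is also real, `ℓ_{±,-k}` is formally adjoint to `ℓ_{±,k}`. -/
lemma ellCoef_neg (n : ℤ) : D.ellCoef θ σ (-κ) (n - σ * κ) = D.ellCoef θ σ κ n := by
  simp only [ellCoef, shiftMom, mom]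
  push_cast
  ring

lemma ell_formal_adjoint (x : (D.ell σ θ κ).domain) (y : (D.ell σ θ (-κ)).domain) :
    ⟪(x : D.ContSpace), D.ell σ θ (-κ) y⟫_ℂ = ⟪D.ell σ θ κ x, (y : D.ContSpace)⟫_ℂ := by
  have hx := (D.ell σ θ κ).mem_graph x
  have hy := (D.ell σ θ (-κ)).mem_graph y
  rw [ell_graph] at hx hy
  have s1 := (innerSL ℂ (D.ell σ θ κ x)).hasSum
    ((Equiv.subRight ((σ : ℤ) * κ)).hasSum_iff.2 (D.hasSum_wave θ (y : D.ContSpace)))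
  have s2 := (innerSL ℂ (x : D.ContSpace)).hasSum (D.hasSum_wave θ (D.ell σ θ (-κ) y))
  refine s2.unique ?_
  convert s1 using 2 with n
  · simp only [Function.comp_apply, Equiv.subRight_apply, map_smul, innerSL_apply_apply, smul_eq_mul]
    have e1 := hx n
    have e2 := hy (n - σ * κ)
    have e3 : n - σ * κ - σ * (-κ) = n := by ring
    simp only [e3, ellCoef_neg] at e1 e2
    rw [e2, ← inner_conj_symm _ (D.wave θ n), ← inner_conj_symm _ (D.wave θ (n - σ * κ)), e1,
      map_mul, Complex.conj_ofReal]
    ring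
  · rfl

end Ell

end LatticeData
end KS

/-! ### Fourier coefficients of the scaling functions and refinement -/

namespace KS

lemma unfold_integral_complex {G : ℝ → ℂ} (hG : Integrable G) {L : ℝ} (hL : 0 < L) :
    HasSum (fun m : ℤ => ∫ z in (-L)..L, G (z + 2 * L * m)) (∫ z, G z) := by
  have hL2 : (2 * L) ≠ 0 := by positivity
  have h1 := (hG.comp_mul_left' hL2).hasSum_intervalIntegral (-(1 / 2))
  rw [Measure.integral_comp_mul_left] at h1
  have h2 := h1.const_smul (2 * L)
  rw [abs_of_pos (by positivity), smul_inv_smul₀ hL2] at h2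
  refine h2.congr_fun fun m => ?_
  have e1 := intervalIntegral.integral_comp_mul_left (a := -(1 / 2) + (m : ℝ))
    (b := -(1 / 2) + (m : ℝ) + 1) G hL2
  have e2 := intervalIntegral.integral_comp_add_right (a := -L) (b := L) G (2 * L * m)
  rw [e2, e1, smul_inv_smul₀ hL2]
  congr 1 <;> ring

namespace ScalingFunction

variable (s : ScalingFunction)

/-- The Fourier transform of the scaling function. -/
def ft (t : ℝ) : ℂ := ∫ x, Complex.exp (-(Complex.I * (t * x : ℝ))) * s.toFun x

lemma integral_exp_mul_comp {a : ℝ} (ha : 0 < a) (b p : ℝ) :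
    ∫ z, Complex.exp (-(Complex.I * (p * z : ℝ))) * s.toFun ((z - b) / a) =
      a * Complex.exp (-(Complex.I * (p * b : ℝ))) * s.ft (a * p) := by
  obtain ⟨F, hF⟩ : ∃ F : ℝ → ℂ, F = fun u : ℝ => Complex.exp (-(Complex.I * (p * b : ℝ))) *
      (Complex.exp (-(Complex.I * (a * p * u : ℝ))) * s.toFun u) := ⟨_, rfl⟩
  have h1 : ∀ z : ℝ, Complex.exp (-(Complex.I * (p * z : ℝ))) * s.toFun ((z - b) / a) =
      (fun y : ℝ => F (y / a)) (z - b) := by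
    intro z
    simp only [hF]
    rw [← mul_assoc, ← Complex.exp_add]
    congr 2
    push_cast
    have : (a : ℂ) ≠ 0 := Complex.ofReal_ne_zero.2 ha.ne'
    field_simp
    ring
  simp_rw [h1]
  rw [integral_sub_right_eq_self (fun y : ℝ => F (y / a)) b, Measure.integral_comp_div F a, hF,
    integral_const_mul, abs_of_pos ha, Complex.real_smul, ft]
  ring

/-- The scaling equation on the Fourier side; it yields the inclusion of each scale in the next one.
-/
lemma ft_two_mul (t : ℝ) : s.ft (2 * t) =
    s.filter.sum fun n c => (c : ℂ) * (√2 / 2 : ℝ) *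
      Complex.exp (-(Complex.I * (t * n : ℝ))) * s.ft t := by
  have h : ∀ x : ℝ, Complex.exp (-(Complex.I * (2 * t * x : ℝ))) * s.toFun x =
      ∑ n ∈ s.filter.support, ((s.filter n * √2 : ℝ) : ℂ) *
        (Complex.exp (-(Complex.I * (2 * t * x : ℝ))) *
          s.toFun ((x - n / 2) / (1 / 2))) := by
    intro x
    rw [s.scaling_eq x, Finsupp.sum, Complex.ofReal_sum, Finset.mul_sum]
    refine Finset.sum_congr rfl fun n _ => ?_
    rw [show (x - n / 2) / (1 / 2) = 2 * x - (n : ℝ) by ring]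
    push_cast
    ring
  rw [ft]
  simp_rw [h]
  rw [integral_finsetSum, Finsupp.sum]
  · refine Finset.sum_congr rfl fun n _ => ?_
    rw [integral_const_mul, s.integral_exp_mul_comp (by norm_num)]
    rw [show 1 / 2 * (2 * t) = t by ring, show 2 * t * (n / 2) = t * (n : ℝ) by ring]
    push_cast
    ring
  · intro n _
    refine Integrable.const_mul ?_ _
    have hs := s.continuous_toFun
    refine Continuous.integrable_of_hasCompactSupport (by fun_prop) ?_
    refine HasCompactSupport.mul_left (f := fun x : ℝ =>
      Complex.exp (-(Complex.I * (2 * t * x : ℝ)))) ?_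
    have h := s.hasCompactSupport_toFun.comp_homeomorph
      ((Homeomorph.subRight ((n : ℝ) / 2)).trans
        (Homeomorph.mulRight₀ (1 / 2 : ℝ)⁻¹ (by norm_num)))
    exact h.comp_left (g := fun r : ℝ => (r : ℂ)) Complex.ofReal_zero

lemma ft_zero : s.ft 0 = 1 := by
  simp only [ft, zero_mul, Complex.ofReal_zero, mul_zero, neg_zero, Complex.exp_zero, one_mul]
  rw [integral_complex_ofReal, s.integral_eq_one, Complex.ofReal_one]

lemma continuous_ft : Continuous s.ft := by
  have hs := s.continuous_toFun
  refine continuous_of_dominated (bound := fun x => ‖s.toFun x‖) ?_ ?_ ?_ ?_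
  · intro t
    exact Continuous.aestronglyMeasurable (by fun_prop)
  · intro t
    refine Eventually.of_forall fun x => ?_
    have : -(Complex.I * ((t * x : ℝ) : ℂ)) = ((-(t * x) : ℝ) : ℂ) * Complex.I := by
      push_cast; ring
    rw [norm_mul, this, Complex.norm_exp_ofReal_mul_I, one_mul, Complex.norm_real]
  · exact (hs.integrable_of_hasCompactSupport s.hasCompactSupport_toFun).norm
  · exact Eventually.of_forall fun x => by fun_prop

end ScalingFunction

namespace LatticeData

variable (D : LatticeData) (s : ScalingFunction) (θ : ℤˣ)

lemma eps_succ (N : ℕ) : D.eps (N + 1) = D.eps N / 2 := by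
  simp only [eps, pow_succ]; field_simp

lemma tendsto_eps : Tendsto D.eps atTop (𝓝 0) := by
  have := (tendsto_pow_atTop_nhds_zero_of_lt_one (r := (1 / 2 : ℝ)) (by norm_num)
    (by norm_num)).const_mul D.eps₀
  rw [mul_zero] at this
  refine this.congr fun N => ?_
  rw [eps, one_div, inv_pow, div_eq_mul_inv]

/-- Plane waves of the sector pick up the same sign `θᵐ` under `m` turns as the periodization, so
the periodized integral unfolds to the line. -/
lemma exp_mom_period (n m : ℤ) :
    Complex.exp (-(Complex.I * (D.mom θ n * (2 * D.L * m) : ℝ))) = (((θ ^ m : ℤˣ) : ℤ) : ℂ) := by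
  have hL : (D.L : ℂ) ≠ 0 := Complex.ofReal_ne_zero.2 D.L_pos.ne'
  rcases Int.units_eq_one_or θ with rfl | rfl
  · have : -(Complex.I * ((D.mom 1 n * (2 * D.L * m) : ℝ) : ℂ)) =
        ((-(n * m) : ℤ) : ℂ) * (2 * Real.pi * Complex.I) := by
      simp only [mom, if_true]
      push_cast
      field_simp
      ring
    rw [this, Complex.exp_int_mul_two_pi_mul_I]
    simp
  · have : -(Complex.I * ((D.mom (-1) n * (2 * D.L * m) : ℝ) : ℂ)) =
        ((-(n * m) : ℤ) : ℂ) * (2 * Real.pi * Complex.I) + ((-m : ℤ) : ℂ) * (Real.pi * Complex.I) := by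
      simp only [mom, show ((-1 : ℤˣ) = 1) = False by decide, if_false]
      push_cast
      field_simp
      ring
    rw [this, Complex.exp_add, Complex.exp_int_mul_two_pi_mul_I, one_mul, Complex.exp_int_mul,
      Complex.exp_pi_mul_I]
    rcases Int.even_or_odd m with h | h
    · rw [h.neg_one_zpow, h.neg.neg_one_zpow]; simp
    · rw [h.neg_one_zpow, h.neg.neg_one_zpow]; simp

/-- Unfolding the twisted periodization replaces the integral over the circle by one over the line,
which is `ŝ` after translation and scaling. -/
lemma inner_wave_scalingVec (N : ℕ) (n j : ℤ) : ⟪D.wave θ n, D.scalingVec s θ N j⟫_ℂ =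
    (√(D.eps N) : ℝ) * s.ft (D.eps N * D.mom θ n) *
      Complex.exp (-(Complex.I * (D.mom θ n * (D.eps N * j) : ℝ))) := by
  have hL := D.L_pos
  have he := D.eps_pos N
  set φ : ℝ → ℝ := fun y => (√(D.eps N))⁻¹ * s.toFun ((y - D.eps N * j) / D.eps N) with hφ
  have hc : Continuous φ := D.continuous_aux s N j
  have hs : HasCompactSupport φ := D.hasCompactSupport_aux s N j
  set G : ℝ → ℂ := fun z => Complex.exp (-(Complex.I * (D.mom θ n * z : ℝ))) * φ z with hGdef
  have hG : Integrable G := by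
    refine Continuous.integrable_of_hasCompactSupport (by fun_prop) ?_
    exact HasCompactSupport.mul_left (hs.comp_left (g := fun r : ℝ => (r : ℂ)) Complex.ofReal_zero)
  obtain ⟨M, hM⟩ := exists_cut hs (T := 2 * D.L) (by positivity) D.L
  have h1 : ⟪D.wave θ n, D.scalingVec s θ N j⟫_ℂ = ∫ z, G z := by
    rw [wave, inner_contWave_eq, ← (unfold_integral_complex hG hL).tsum_eq,
      tsum_eq_sum (s := Finset.Icc (-(M : ℤ)) M)]
    · rw [← intervalIntegral.integral_finsetSum
        (fun m _ => Continuous.intervalIntegrable (by fun_prop) _ _)]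
      have hae : ∀ᵐ z ∂volume.restrict (Set.Ioc (-D.L) D.L), D.scalingVec s θ N j z =
          ((D.scaledScaling s θ N (z - D.eps N * j) : ℝ) : ℂ) := by
        rw [← circleMeasure_eq]
        exact (D.memLp_scaled s θ N j).coeFn_toLp
      rw [ae_restrict_iff' measurableSet_Ioc] at hae
      refine intervalIntegral.integral_congr_ae ?_
      filter_upwards [hae] with z hz hz'
      rw [Set.uIoc_of_le (by linarith)] at hz'
      rw [hz hz', scaledScaling_sub, ← hφ,
        twistPer_eq_sum hM (abs_le.2 ⟨hz'.1.le, hz'.2⟩), Complex.ofReal_sum, Finset.mul_sum]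
      refine Finset.sum_congr rfl fun m _ => ?_
      rw [hGdef]
      simp only
      have e : -(Complex.I * ((D.mom θ n * (z + 2 * D.L * m) : ℝ) : ℂ)) =
          -(Complex.I * ((D.mom θ n * z : ℝ) : ℂ)) +
            -(Complex.I * ((D.mom θ n * (2 * D.L * m) : ℝ) : ℂ)) := by push_cast; ring
      rw [e, Complex.exp_add, exp_mom_period]
      push_cast
      ring
    · intro m hm
      rw [intervalIntegral.integral_congr (g := fun _ => (0 : ℂ))]
      · simp
      · intro z hz
        rw [Set.uIcc_of_le (by linarith)] at hz
        simp only [hGdef]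
        rw [hM z (abs_le.2 hz) m hm, Complex.ofReal_zero, mul_zero]
  rw [h1]
  have h2 : ∀ z, G z = (((√(D.eps N))⁻¹ : ℝ) : ℂ) *
      (Complex.exp (-(Complex.I * (D.mom θ n * z : ℝ))) *
        s.toFun ((z - D.eps N * j) / D.eps N)) := by
    intro z
    simp only [hGdef, hφ]
    push_cast
    ring
  simp_rw [h2]
  rw [integral_const_mul, s.integral_exp_mul_comp he]
  have h3 : (((√(D.eps N))⁻¹ : ℝ) : ℂ) * D.eps N = (√(D.eps N) : ℝ) := by
    rw [← Complex.ofReal_mul]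
    congr 1
    rw [inv_mul_eq_iff_eq_mul₀ (Real.sqrt_pos.2 he).ne', Real.mul_self_sqrt he.le]
  rw [← h3]
  ring

lemma inner_wave_R (N : ℕ) (n : ℤ) (η : D.LatSpace N) : ⟪D.wave θ n, D.R s θ N η⟫_ℂ =
    (√(D.eps N) : ℝ) * s.ft (D.eps N * D.mom θ n) * ⟪D.latWave N (D.mom θ n), η⟫_ℂ := by
  rw [R_apply, inner_sum, PiLp.inner_apply, Finset.mul_sum]
  refine Finset.sum_congr rfl fun j _ => ?_
  rw [inner_smul_right, inner_wave_scalingVec, RCLike.inner_apply, latWave, ← Complex.exp_conj]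
  simp only [map_mul, Complex.conj_I, Complex.conj_ofReal, neg_mul]
  ring

lemma scalingVec_refine (N : ℕ) (j : ℤ) : D.scalingVec s θ N j =
    s.filter.sum fun n c => (c : ℂ) • D.scalingVec s θ (N + 1) (2 * j + n) := by
  refine D.inner_wave_ext θ fun m => ?_
  rw [Finsupp.sum, inner_sum, inner_wave_scalingVec,
    show D.eps N * D.mom θ m = 2 * (D.eps (N + 1) * D.mom θ m) by rw [eps_succ]; ring,
    s.ft_two_mul, Finsupp.sum, Finset.mul_sum, Finset.sum_mul]
  refine Finset.sum_congr rfl fun n _ => ?_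
  rw [inner_smul_right, inner_wave_scalingVec]
  have e1 : √(D.eps N) * (√2 / 2) = √(D.eps (N + 1)) := by
    rw [eps_succ, Real.sqrt_div (D.eps_pos N).le, mul_div_assoc', div_eq_div_iff (by norm_num)
      (by positivity), mul_assoc, Real.mul_self_sqrt (by norm_num)]
  have e2 : -(Complex.I * ((D.mom θ m * (D.eps (N + 1) * (2 * j + n : ℤ)) : ℝ) : ℂ)) =
      -(Complex.I * ((D.eps (N + 1) * D.mom θ m * n : ℝ) : ℂ)) +
      -(Complex.I * ((D.mom θ m * (D.eps N * j) : ℝ) : ℂ)) := by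
    rw [eps_succ]; push_cast; ring
  rw [e2, Complex.exp_add, ← e1]
  push_cast
  ring

/-- Sites outside the fundamental window only contribute signs, so refinement coefficients that
leave the window do no harm. -/
lemma scalingVec_add (N : ℕ) (j m : ℤ) : D.scalingVec s θ N (j + 2 * D.len N * m) =
    (((θ ^ m : ℤˣ) : ℤ) : ℂ) • D.scalingVec s θ N j := by
  refine D.inner_wave_ext θ fun n => ?_
  rw [inner_smul_right, inner_wave_scalingVec, inner_wave_scalingVec, ← D.exp_mom_period θ n m]
  have e : -(Complex.I * ((D.mom θ n * (D.eps N * (j + 2 * D.len N * m : ℤ)) : ℝ) : ℂ)) =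
      -(Complex.I * ((D.mom θ n * (2 * D.L * m) : ℝ) : ℂ)) +
      -(Complex.I * ((D.mom θ n * (D.eps N * j) : ℝ) : ℂ)) := by
    rw [← D.eps_mul_len N]; push_cast; ring
  rw [e, Complex.exp_add]
  ring

lemma len_pos (N : ℕ) : 0 < D.len N := Nat.mul_pos (by positivity) D.len₀_pos

lemma exists_site (N : ℕ) (j : ℤ) : ∃ i ∈ Finset.Ico (-(D.len N : ℤ)) (D.len N), ∃ m : ℤ,
    j = i + 2 * D.len N * m := by
  have h : (0 : ℤ) < 2 * D.len N := by have := D.len_pos N; omega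
  refine ⟨(j + D.len N) % (2 * D.len N) - D.len N, ?_, (j + D.len N) / (2 * D.len N), ?_⟩
  · have h1 := Int.emod_nonneg (j + D.len N) h.ne'
    have h2 := Int.emod_lt_of_pos (j + D.len N) h
    rw [Finset.mem_Ico]
    constructor <;> linarith
  · have := Int.emod_add_mul_ediv (j + D.len N) (2 * D.len N)
    linarith

lemma scalingVec_mem_range (N : ℕ) (j : ℤ) :
    D.scalingVec s θ N j ∈ LinearMap.range (D.R s θ N).toLinearMap := by
  classical
  obtain ⟨i, hi, m, rfl⟩ := D.exists_site N j
  rw [scalingVec_add]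
  refine Submodule.smul_mem _ _ ⟨EuclideanSpace.single ⟨i, hi⟩ 1, ?_⟩
  change D.R s θ N _ = _
  rw [R_apply, Finset.sum_eq_single ⟨i, hi⟩]
  · simp
  · intro b _ hb
    simp [hb]
  · simp

/-- Refinement expresses each coarse generator by fine ones, some of them indexed outside the
window; these are wrapped around by `scalingVec_add`. -/
lemma range_R_mono : Monotone fun N : ℕ => LinearMap.range (D.R s θ N).toLinearMap := by
  refine monotone_nat_of_le_succ fun N => ?_
  rintro _ ⟨η, rfl⟩
  change D.R s θ N η ∈ _
  rw [R_apply]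
  refine Submodule.sum_mem _ fun j _ => Submodule.smul_mem _ _ ?_
  rw [scalingVec_refine, Finsupp.sum]
  exact Submodule.sum_mem _ fun n _ => Submodule.smul_mem _ _ (D.scalingVec_mem_range s θ (N + 1) _)

lemma mem_waveletSpan {ξ : D.ContSpace} (hξ : ξ ∈ D.waveletSpan s θ) :
    ∃ M, ∀ N ≥ M, ∃ η, D.R s θ N η = ξ := by
  rw [waveletSpan, Submodule.mem_iSup_of_directed _ (D.range_R_mono s θ).directed_le] at hξ
  obtain ⟨M, hM⟩ := hξ
  exact ⟨M, fun N hN => D.range_R_mono s θ hN hM⟩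

lemma R_mem_waveletSpan (N : ℕ) (η : D.LatSpace N) : D.R s θ N η ∈ D.waveletSpan s θ :=
  Submodule.mem_iSup_of_mem N ⟨η, rfl⟩

end LatticeData
end KS

/-! ### Lattice plane waves and the zeros of the Fourier transform -/

namespace KS

lemma sum_Ico_int_sub (f : ℤ → ℂ) (a : ℤ) (n : ℕ) :
    ∑ j ∈ Finset.Ico a (a + n), (f (j + 1) - f j) = f (a + n) - f a := by
  induction n with
  | zero => simp
  | succ n ih =>
    have : Finset.Ico a (a + (n + 1 : ℕ)) = insert (a + n) (Finset.Ico a (a + n)) := by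
      ext x; simp; omega
    rw [this, Finset.sum_insert (by simp), ih]
    push_cast
    ring_nf

namespace LatticeData

variable (D : LatticeData) (θ : ℤˣ)

lemma card_sites (N : ℕ) : Fintype.card (D.Sites N) = 2 * D.len N := by
  rw [Fintype.card_coe, Int.card_Ico]
  omega

lemma latWave_add (N : ℕ) (n m : ℤ) :
    D.latWave N (D.mom θ (n + 2 * D.len N * m)) = D.latWave N (D.mom θ n) := by
  have hL : (D.len N : ℂ) ≠ 0 := by exact_mod_cast (D.len_pos N).ne'
  have he : (D.eps N : ℂ) ≠ 0 := Complex.ofReal_ne_zero.2 (D.eps_pos N).ne'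
  rw [latWave, latWave]
  congr 1
  funext j
  have e : Complex.I * ((D.mom θ (n + 2 * D.len N * m) * (D.eps N * (j : ℤ)) : ℝ) : ℂ) =
      Complex.I * ((D.mom θ n * (D.eps N * (j : ℤ)) : ℝ) : ℂ) +
        ((m * j : ℤ) : ℂ) * (2 * Real.pi * Complex.I) := by
    simp only [mom, ← D.eps_mul_len N]
    push_cast
    field_simp
    ring
  rw [e, Complex.exp_add, Complex.exp_int_mul_two_pi_mul_I, mul_one]

lemma inner_latWave_self (N : ℕ) (p : ℝ) :
    ⟪D.latWave N p, D.latWave N p⟫_ℂ = 2 * D.len N := by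
  rw [PiLp.inner_apply]
  have : ∀ j : D.Sites N, ⟪(D.latWave N p) j, (D.latWave N p) j⟫_ℂ = 1 := by
    intro j
    rw [inner_self_eq_norm_sq_to_K, latWave]
    simp only
    rw [mul_comm, Complex.norm_exp_ofReal_mul_I]
    simp
  rw [Finset.sum_congr rfl fun j _ => this j, Finset.sum_const, Finset.card_univ, card_sites]
  simp

/-- A geometric sum with ratio `exp z`: multiplied by `exp z - 1` it telescopes to zero, and the
ratio is `1` only for momenta that coincide modulo `2 L_N`. -/
lemma inner_latWave (N : ℕ) (m n : ℤ) :
    ⟪D.latWave N (D.mom θ m), D.latWave N (D.mom θ n)⟫_ℂ =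
      if (2 * D.len N : ℤ) ∣ n - m then 2 * (D.len N : ℂ) else 0 := by
  have hL : (D.len N : ℂ) ≠ 0 := by exact_mod_cast (D.len_pos N).ne'
  have he : (D.eps N : ℂ) ≠ 0 := Complex.ofReal_ne_zero.2 (D.eps_pos N).ne'
  have hpi : (Real.pi : ℂ) ≠ 0 := Complex.ofReal_ne_zero.2 Real.pi_ne_zero
  split_ifs with h
  · obtain ⟨q, hq⟩ := h
    obtain rfl : n = m + 2 * D.len N * q := by linarith
    rw [latWave_add, inner_latWave_self]
  · set z : ℂ := Real.pi * (n - m) / D.len N * Complex.I with hz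
    set f : ℤ → ℂ := fun j => Complex.exp (j * z) with hf
    have h1 : ⟪D.latWave N (D.mom θ m), D.latWave N (D.mom θ n)⟫_ℂ =
        ∑ j ∈ Finset.Ico (-(D.len N : ℤ)) (D.len N), f j := by
      rw [PiLp.inner_apply, ← Finset.sum_coe_sort (Finset.Ico (-(D.len N : ℤ)) (D.len N))]
      refine Finset.sum_congr rfl fun j _ => ?_
      rw [RCLike.inner_apply, latWave, latWave, ← Complex.exp_conj, ← Complex.exp_add, hf]
      simp only [map_mul, Complex.conj_I, Complex.conj_ofReal]
      congr 1
      simp only [mom, ← D.eps_mul_len N, hz]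
      push_cast
      field_simp
      ring
    have h2 : (Complex.exp z - 1) * ∑ j ∈ Finset.Ico (-(D.len N : ℤ)) (D.len N), f j = 0 := by
      have h3 := sum_Ico_int_sub f (-(D.len N : ℤ)) (2 * D.len N)
      rw [show -(D.len N : ℤ) + (2 * D.len N : ℕ) = D.len N by push_cast; ring] at h3
      have h4 : f (D.len N) - f (-(D.len N : ℤ)) = 0 := by
        rw [sub_eq_zero, hf]
        simp only
        rw [Complex.exp_eq_exp_iff_exists_int]
        refine ⟨n - m, ?_⟩
        rw [hz]
        push_cast
        field_simp
        ring
      rw [Finset.mul_sum, ← h4, ← h3]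
      refine Finset.sum_congr rfl fun j _ => ?_
      simp only [hf]
      push_cast
      rw [add_mul, one_mul, Complex.exp_add]
      ring
    rw [h1]
    refine (mul_eq_zero.1 h2).resolve_left fun h0 => h ?_
    rw [sub_eq_zero, Complex.exp_eq_one_iff] at h0
    obtain ⟨q, hq⟩ := h0
    refine ⟨q, ?_⟩
    rw [hz] at hq
    have : ((n - m : ℤ) : ℂ) = ((2 * D.len N * q : ℤ) : ℂ) := by
      have hI := Complex.I_ne_zero
      field_simp at hq
      push_cast
      linear_combination hq
    exact_mod_cast this

lemma eq_of_dvd_of_mem_Ico {N : ℕ} {m n : ℤ} (hm : m ∈ Finset.Ico (-(D.len N : ℤ)) (D.len N))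
    (hn : n ∈ Finset.Ico (-(D.len N : ℤ)) (D.len N)) (h : (2 * D.len N : ℤ) ∣ n - m) : m = n := by
  rw [Finset.mem_Ico] at hm hn
  have := Int.eq_zero_of_abs_lt_dvd h (by rw [abs_lt]; constructor <;> linarith)
  linarith

lemma span_latWave (N : ℕ) :
    Submodule.span ℂ (Set.range fun n : D.Sites N => D.latWave N (D.mom θ n)) = ⊤ := by
  have hli : LinearIndependent ℂ fun n : D.Sites N => D.latWave N (D.mom θ n) := by
    refine linearIndependent_of_ne_zero_of_inner_eq_zero (𝕜 := ℂ) (fun n h0 => ?_) fun m n hmn => ?_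
    · have := D.inner_latWave_self N (D.mom θ n)
      rw [h0, inner_zero_left] at this
      have h1 : (D.len N : ℂ) ≠ 0 := by exact_mod_cast (D.len_pos N).ne'
      exact h1 (by linear_combination -(1 / 2 : ℂ) * this)
    · simp only
      rw [inner_latWave, if_neg]
      intro h
      exact hmn (Subtype.ext (D.eq_of_dvd_of_mem_Ico m.2 n.2 h))
  exact hli.span_eq_top_of_card_eq_finrank' (by simp)

lemma norm_sq_latWave (N : ℕ) (p : ℝ) : ‖D.latWave N p‖ ^ 2 = 2 * D.len N := by
  rw [@norm_sq_eq_re_inner ℂ, inner_latWave_self]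
  simp

variable (s : ScalingFunction)

/-- On a circle of length one with two sites, the image `v` of the constant lattice function has
`‖v‖² = 2`. Parseval's identity allots a total of `2` to its coefficients, and `ŝ(0) = 1` already
uses up all of it. The coefficients at the other even labels `2q`, which are multiples of `ŝ(2πq)`,
must vanish. -/
lemma ft_two_pi_mul {q : ℤ} (hq : q ≠ 0) : s.ft (2 * Real.pi * q) = 0 := by
  set D : LatticeData := ⟨1 / 2, 1, by norm_num, by norm_num⟩ with hD
  have hlen : D.len 0 = 1 := by simp [len, hD]
  have heps : D.eps 0 = 1 / 2 := by simp [eps, hD]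
  have hL : D.L = 1 / 2 := by simp [L, hD]
  have hmom : ∀ n : ℤ, D.mom 1 n = 2 * Real.pi * n := by
    intro n; simp only [mom, hL, if_true]; ring
  set v := D.R s 1 0 (D.latWave 0 (D.mom 1 0)) with hv
  have hs := D.hasSum_sq_inner_wave 1 v
  have hnorm : ‖v‖ ^ 2 = 2 := by
    rw [hv, LinearIsometry.norm_map, norm_sq_latWave, hlen]; norm_num
  rw [hnorm, hL] at hs
  have hcoef : ∀ p : ℤ, ‖⟪D.wave 1 (2 * p), v⟫_ℂ‖ ^ 2 = 2 * ‖s.ft (2 * Real.pi * p)‖ ^ 2 := by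
    intro p
    rw [hv, inner_wave_R, inner_latWave, if_pos (by rw [hlen]; exact ⟨-p, by push_cast; ring⟩), heps,
      hmom, hlen, show 1 / 2 * (2 * Real.pi * ((2 * p : ℤ) : ℝ)) = 2 * Real.pi * p by push_cast; ring]
    simp only [norm_mul, mul_pow, Complex.norm_real, Real.norm_eq_abs, sq_abs]
    rw [Real.sq_sqrt (by norm_num)]
    simp
    ring
  have hle := sum_le_hasSum {2 * 0, 2 * q} (fun n _ => by positivity) hs
  rw [Finset.sum_pair (by omega), hcoef, hcoef] at hle
  simp only [Int.cast_zero, mul_zero, s.ft_zero, norm_one] at hle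
  have : ‖s.ft (2 * Real.pi * q)‖ ^ 2 ≤ 0 := by linarith
  have := pow_eq_zero_iff (two_ne_zero) |>.1 (le_antisymm this (sq_nonneg _))
  exact norm_eq_zero.1 this

end LatticeData
end KS

/-! ### Regularity: the periodized derivative and its quadratic bound -/

namespace KS

/-- Integration by parts for a function with locally integrable derivative against a `C¹` function,
with vanishing boundary values. -/
lemma integral_mul_eq_neg_of_boundary {f g φ : ℝ → ℝ} (hg : LocallyIntegrable g)
    (hf : ∀ a b, f b - f a = ∫ x in a..b, g x) (hφ : ContDiff ℝ 1 φ) {a b : ℝ}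
    (ha : f a = 0) (hb : f b = 0) :
    ∫ x in a..b, g x * φ x = -∫ x in a..b, f x * deriv φ x := by
  have hfeq : f = fun x => ∫ t in a..x, g t := by
    funext x
    rw [← hf a x, ha, sub_zero]
  have hgi : ∀ c d, IntervalIntegrable g volume c d := fun c d =>
    (hg.integrableOn_isCompact isCompact_uIcc).intervalIntegrable
  have hac : AbsolutelyContinuousOnInterval f a b := by
    rw [hfeq]
    exact (hgi a b).absolutelyContinuousOnInterval_intervalIntegral Set.left_mem_uIcc
  have hac' : AbsolutelyContinuousOnInterval φ a b := hφ.contDiffOn.absolutelyContinuousOnInterval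
  have h := hac.integral_mul_deriv_eq_deriv_mul hac'
  rw [ha, hb, zero_mul, zero_mul, sub_zero, zero_sub] at h
  rw [h, neg_neg]
  -- The derivative of `f` equals `g` only almost everywhere, by Lebesgue differentiation.
  refine intervalIntegral.integral_congr_ae ?_
  filter_upwards [_root_.LocallyIntegrable.ae_hasDerivAt_integral hg] with x hx _
  have := (hx a).deriv
  rw [← hfeq] at this
  rw [this]

/-- Real integration by parts against `cos (t x)` and `sin (t x)`, recombined. The boundary terms
vanish. -/
lemma integral_exp_mul_deriv {f g : ℝ → ℝ} (hg : LocallyIntegrable g)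
    (hf : ∀ a b, f b - f a = ∫ x in a..b, g x) (hfc : Continuous f) {a b : ℝ}
    (ha : f a = 0) (hb : f b = 0) (t : ℝ) :
    ∫ x in a..b, Complex.exp (-(Complex.I * (t * x : ℝ))) * g x =
      Complex.I * t * ∫ x in a..b, Complex.exp (-(Complex.I * (t * x : ℝ))) * f x := by
  have hgi : IntervalIntegrable g volume a b :=
    (hg.integrableOn_isCompact isCompact_uIcc).intervalIntegrable
  have he : ∀ x : ℝ, Complex.exp (-(Complex.I * (t * x : ℝ))) =
      (Real.cos (t * x) : ℂ) - (Real.sin (t * x) : ℂ) * Complex.I := by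
    intro x
    rw [show -(Complex.I * ((t * x : ℝ) : ℂ)) = ((-(t * x) : ℝ) : ℂ) * Complex.I by push_cast; ring,
      Complex.exp_ofReal_mul_I, Real.cos_neg, Real.sin_neg]
    push_cast; ring
  have key : ∀ u : ℝ → ℝ, IntervalIntegrable u volume a b →
      ∫ x in a..b, Complex.exp (-(Complex.I * (t * x : ℝ))) * u x =
        ((∫ x in a..b, u x * Real.cos (t * x) : ℝ) : ℂ) -
          ((∫ x in a..b, u x * Real.sin (t * x) : ℝ) : ℂ) * Complex.I := by
    intro u hu
    have i1 : IntervalIntegrable (fun x => u x * Real.cos (t * x)) volume a b :=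
      hu.mul_continuousOn (by fun_prop)
    have i2 : IntervalIntegrable (fun x => u x * Real.sin (t * x)) volume a b :=
      hu.mul_continuousOn (by fun_prop)
    have j1 : IntervalIntegrable (fun x => ((u x * Real.cos (t * x) : ℝ) : ℂ)) volume a b :=
      ⟨i1.1.ofReal, i1.2.ofReal⟩
    have j2 : IntervalIntegrable (fun x => ((u x * Real.sin (t * x) : ℝ) : ℂ)) volume a b :=
      ⟨i2.1.ofReal, i2.2.ofReal⟩
    rw [← intervalIntegral.integral_ofReal, ← intervalIntegral.integral_ofReal,
      ← intervalIntegral.integral_mul_const, ← intervalIntegral.integral_sub j1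
        (j2.mul_const _)]
    refine intervalIntegral.integral_congr fun x _ => ?_
    simp only [he]
    push_cast; ring
  have hlin : ∀ x, HasDerivAt (fun x => t * x) t x := fun x => by
    simpa using (hasDerivAt_id x).const_mul t
  have hdc : deriv (fun x => Real.cos (t * x)) = fun x => -t * Real.sin (t * x) := by
    funext x
    rw [(hlin x).cos.deriv]; ring
  have hds : deriv (fun x => Real.sin (t * x)) = fun x => t * Real.cos (t * x) := by
    funext x
    rw [(hlin x).sin.deriv]; ring
  rw [key g hgi, key f (hfc.intervalIntegrable _ _),
    integral_mul_eq_neg_of_boundary hg hf (φ := fun x => Real.cos (t * x)) (by fun_prop) ha hb,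
    integral_mul_eq_neg_of_boundary hg hf (φ := fun x => Real.sin (t * x)) (by fun_prop) ha hb,
    hdc, hds]
  have e1 : ∀ x, f x * (-t * Real.sin (t * x)) = -t * (f x * Real.sin (t * x)) := by intro x; ring
  have e2 : ∀ x, f x * (t * Real.cos (t * x)) = t * (f x * Real.cos (t * x)) := by intro x; ring
  simp only [e1, e2]
  rw [intervalIntegral.integral_const_mul, intervalIntegral.integral_const_mul]
  push_cast
  linear_combination (t : ℂ) * ((∫ x in a..b, f x * Real.sin (t * x) : ℝ) : ℂ) * Complex.I_sq

/-- The circle of length one. -/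
def unitCircle : LatticeData := ⟨1 / 2, 1, by norm_num, by norm_num⟩

lemma unitCircle_L : unitCircle.L = 1 / 2 := by simp [unitCircle, LatticeData.L]

lemma unitCircle_measure :
    unitCircle.circleMeasure = volume.restrict (Set.Ioc (-(1 / 2 : ℝ)) (1 / 2)) := by
  rw [LatticeData.circleMeasure_eq, unitCircle_L]

lemma unitCircle_mom (q : ℤ) : unitCircle.mom 1 q = 2 * Real.pi * q := by
  simp only [LatticeData.mom, unitCircle_L, if_true]; ring

/-- The periodization over `2 K + 1` unit cells of `e^{-itx} g(x)`. -/
def cellSum (g : ℝ → ℝ) (K : ℕ) (t x : ℝ) : ℂ :=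
  ∑ n ∈ Finset.range (2 * K + 1),
    Complex.exp (-(Complex.I * (t * (x + ((n : ℝ) - K)) : ℝ))) * g (x + ((n : ℝ) - K))

/-- The periodization over `2 K + 1` unit cells of `|g|`. -/
def cellAbsSum (g : ℝ → ℝ) (K : ℕ) (x : ℝ) : ℝ :=
  ∑ n ∈ Finset.range (2 * K + 1), ‖g (x + ((n : ℝ) - K))‖

section Cell

variable {g : ℝ → ℝ}

lemma memLp_translate (hg : MemLp g 2 volume) (c : ℝ) :
    MemLp (fun x => g (x + c)) 2 unitCircle.circleMeasure :=
  (hg.comp_measurePreserving (measurePreserving_add_right volume c)).restrict _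

lemma memLp_cellSum (hg : MemLp g 2 volume) (K : ℕ) (t : ℝ) : MemLp (cellSum g K t) 2 unitCircle.circleMeasure := by
  refine memLp_finsetSum _ fun n _ => ?_
  have h := memLp_translate hg ((n : ℝ) - K)
  refine h.of_le ((Continuous.aestronglyMeasurable (by fun_prop)).mul
    (Complex.continuous_ofReal.comp_aestronglyMeasurable h.1)) (Eventually.of_forall fun x => ?_)
  rw [norm_mul, show -(Complex.I * ((t * (x + ((n : ℝ) - K)) : ℝ) : ℂ)) =
      ((-(t * (x + ((n : ℝ) - K))) : ℝ) : ℂ) * Complex.I by push_cast; ring,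
    Complex.norm_exp_ofReal_mul_I, one_mul, Complex.norm_real]

lemma memLp_cellAbsSum (hg : MemLp g 2 volume) (K : ℕ) :
    MemLp (cellAbsSum g K) 2 unitCircle.circleMeasure :=
  memLp_finsetSum _ fun n _ => (memLp_translate hg ((n : ℝ) - K)).norm

/-- `cellSum` as a vector of `L²` of the circle of length one. -/
def cellVec (hg : MemLp g 2 volume) (K : ℕ) (t : ℝ) : unitCircle.ContSpace := (memLp_cellSum hg K t).toLp _

/-- The `2K + 1` unit cells tile the interval of integration, and integer translations do not affect
`e^{-2πiqx}`. So the coefficients of the periodization sample the Fourier integral of `g` at `t +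
2πq`. -/
lemma inner_wave_cellVec (hg : MemLp g 2 volume) (K : ℕ) (t : ℝ) (q : ℤ) :
    ⟪unitCircle.wave 1 q, cellVec hg K t⟫_ℂ =
    ∫ x in (-(K : ℝ) - 1 / 2)..(K + 1 / 2),
      Complex.exp (-(Complex.I * ((t + 2 * Real.pi * q) * x : ℝ))) * g x := by
  have hloc : LocallyIntegrable g := hg.locallyIntegrable (by norm_num)
  set f : ℝ → ℂ := fun x => Complex.exp (-(Complex.I * ((t + 2 * Real.pi * q) * x : ℝ))) * g x with hf
  have hfi : ∀ a b, IntervalIntegrable f volume a b := fun a b =>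
    have h := (hloc.integrableOn_isCompact (isCompact_uIcc (a := a) (b := b))).intervalIntegrable
    IntervalIntegrable.continuousOn_mul ⟨h.1.ofReal, h.2.ofReal⟩ (by fun_prop)
  have hsum := intervalIntegral.sum_integral_adjacent_intervals (μ := volume) (f := f)
    (a := fun n : ℕ => (n : ℝ) - K - 1 / 2) (n := 2 * K + 1) (fun k _ => hfi _ _)
  rw [show ((0 : ℕ) : ℝ) - K - 1 / 2 = -(K : ℝ) - 1 / 2 by push_cast; ring,
    show ((2 * K + 1 : ℕ) : ℝ) - K - 1 / 2 = K + 1 / 2 by push_cast; ring] at hsum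
  rw [← hsum]
  have hshift : ∀ n : ℕ, ∫ x in ((n : ℝ) - K - 1 / 2)..((n + 1 : ℕ) - K - 1 / 2 : ℝ), f x =
      ∫ x in (-(1 / 2 : ℝ))..(1 / 2), f (x + ((n : ℝ) - K)) := by
    intro n
    rw [intervalIntegral.integral_comp_add_right]
    congr 1 <;> push_cast <;> ring
  simp only [hshift]
  rw [← intervalIntegral.integral_finsetSum (fun n _ => by
    have := (hfi (-(1 / 2) + ((n : ℝ) - K)) (1 / 2 + ((n : ℝ) - K))).comp_add_right ((n : ℝ) - K)
    simpa using this), LatticeData.wave, LatticeData.inner_contWave_eq, unitCircle_L]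
  have hae : ∀ᵐ x ∂volume.restrict (Set.Ioc (-(1 / 2 : ℝ)) (1 / 2)), cellVec hg K t x =
      cellSum g K t x := by
    rw [← unitCircle_measure]
    exact (memLp_cellSum hg K t).coeFn_toLp
  rw [ae_restrict_iff' measurableSet_Ioc] at hae
  refine intervalIntegral.integral_congr_ae ?_
  filter_upwards [hae] with x hx hx'
  rw [Set.uIoc_of_le (by norm_num)] at hx'
  rw [hx hx', cellSum, Finset.mul_sum]
  refine Finset.sum_congr rfl fun n _ => ?_
  rw [hf, ← mul_assoc, unitCircle_mom]
  simp only
  congr 1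
  have e : -(Complex.I * (((t + 2 * Real.pi * q) * (x + ((n : ℝ) - K)) : ℝ) : ℂ)) =
      -(Complex.I * ((2 * Real.pi * q * x : ℝ) : ℂ)) +
        -(Complex.I * ((t * (x + ((n : ℝ) - K)) : ℝ) : ℂ)) +
        ((-(q * (n - K)) : ℤ) : ℂ) * (2 * Real.pi * Complex.I) := by
    push_cast; ring
  rw [e, Complex.exp_add (_ + _), Complex.exp_int_mul_two_pi_mul_I, mul_one, Complex.exp_add]

/-- Pointwise, `|e^{-ity} - 1| ≤ |t| |y|`, and `|y| ≤ K + 1` on the cells. This linear bound in `t`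
gives the quadratic one for the squared coefficients. -/
lemma norm_cellVec_sub_le (hg : MemLp g 2 volume) (K : ℕ) (t : ℝ) :
    ‖cellVec hg K t - cellVec hg K 0‖ ≤
    |t| * (K + 1) * ‖(memLp_cellAbsSum hg K).toLp‖ := by
  refine Lp.norm_le_mul_norm_of_ae_le_mul ?_
  have h1 : ∀ᵐ x ∂unitCircle.circleMeasure, x ∈ Set.Ioc (-(1 / 2 : ℝ)) (1 / 2) := by
    rw [unitCircle_measure]
    exact ae_restrict_mem measurableSet_Ioc
  filter_upwards [(memLp_cellSum hg K t).coeFn_toLp, (memLp_cellSum hg K 0).coeFn_toLp,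
    (memLp_cellAbsSum hg K).coeFn_toLp, Lp.coeFn_sub (cellVec hg K t) (cellVec hg K 0), h1]
    with x e1 e2 e3 e4 hx
  rw [e4, Pi.sub_apply, cellVec, cellVec, e1, e2, e3, cellSum, cellSum, ← Finset.sum_sub_distrib]
  have hpos : 0 ≤ cellAbsSum g K x := Finset.sum_nonneg fun _ _ => norm_nonneg _
  rw [Real.norm_of_nonneg hpos, cellAbsSum, Finset.mul_sum]
  refine (norm_sum_le _ _).trans (Finset.sum_le_sum fun n hn => ?_)
  rw [← sub_mul, norm_mul, Complex.norm_real]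
  refine mul_le_mul_of_nonneg_right ?_ (norm_nonneg _)
  rw [zero_mul, Complex.ofReal_zero, mul_zero, neg_zero, Complex.exp_zero,
    show -(Complex.I * ((t * (x + ((n : ℝ) - K)) : ℝ) : ℂ)) =
      Complex.I * ((-(t * (x + ((n : ℝ) - K))) : ℝ) : ℂ) by push_cast; ring]
  refine (Real.norm_exp_I_mul_ofReal_sub_one_le).trans ?_
  rw [norm_neg, Real.norm_eq_abs, abs_mul]
  refine mul_le_mul_of_nonneg_left ?_ (abs_nonneg _)
  rw [Finset.mem_range] at hn
  have hn' : (n : ℝ) ≤ 2 * K := by exact_mod_cast Nat.lt_succ_iff.1 hn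
  rw [abs_le]
  have := hx.1; have := hx.2
  have : (0 : ℝ) ≤ n := n.cast_nonneg
  constructor <;> linarith

end Cell

namespace ScalingFunction

variable {s : ScalingFunction}

/-- For a regular scaling function, `∑_q |t + 2πq|² |ŝ(t + 2πq)|²` vanishes quadratically in `t`. -/
lemma Regular.exists_bound (hs : s.Regular) : ∃ C : ℝ, ∀ (t : ℝ) (F : Finset ℤ),
    ∑ q ∈ F, (t + 2 * Real.pi * q) ^ 2 * ‖s.ft (t + 2 * Real.pi * q)‖ ^ 2 ≤ C * t ^ 2 := by
  obtain ⟨g, hg, hsg⟩ := hs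
  obtain ⟨B, hB0, hB⟩ := KS.exists_bound s.hasCompactSupport_toFun
  obtain ⟨K, hK⟩ := exists_nat_ge B
  have hloc : LocallyIntegrable g := hg.locallyIntegrable (by norm_num)
  have hzero : ∀ x : ℝ, (K : ℝ) < |x| → s.toFun x = 0 := fun x hx => hB x (hK.trans_lt hx)
  -- The support of `s` lies in `[-K, K]`, so the boundary terms vanish and the integral over the
  -- cells is the full Fourier transform.
  have hft : ∀ t q, ⟪unitCircle.wave 1 q, cellVec hg K t⟫_ℂ =
      Complex.I * (t + 2 * Real.pi * q : ℝ) * s.ft (t + 2 * Real.pi * q) := by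
    intro t q
    rw [inner_wave_cellVec, integral_exp_mul_deriv hloc hsg s.continuous_toFun, ft,
      intervalIntegral.integral_eq_integral_of_support_subset]
    · intro x hx
      by_contra hx'
      refine hx ?_
      simp only
      rw [hzero, Complex.ofReal_zero, mul_zero]
      rw [Set.mem_Ioc, not_and_or, not_lt, not_le] at hx'
      rcases hx' with h | h
      · exact lt_abs.2 (Or.inr (by linarith))
      · exact lt_abs.2 (Or.inl (by linarith))
    · exact hzero _ (lt_abs.2 (Or.inr (by linarith)))
    · exact hzero _ (lt_abs.2 (Or.inl (by linarith)))
  refine ⟨((K + 1) * ‖(memLp_cellAbsSum hg K).toLp‖) ^ 2, fun t F => ?_⟩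
  -- At `t = 0` the periodized derivative vanishes: for `q = 0` through the factor `2πq`, otherwise
  -- through `ŝ(2πq) = 0`. Subtracting it changes no coefficient but makes the norm of order `|t|`.
  have h0 : ∀ q, ⟪unitCircle.wave 1 q, cellVec hg K 0⟫_ℂ = 0 := by
    intro q
    rw [hft, zero_add]
    by_cases hq : q = 0
    · simp [hq]
    · rw [LatticeData.ft_two_pi_mul s hq, mul_zero]
  have hsum := unitCircle.hasSum_sq_inner_wave 1 (cellVec hg K t - cellVec hg K 0)
  have hle := sum_le_hasSum F (fun n _ => by positivity) hsum
  have hterm : ∀ q, ‖⟪unitCircle.wave 1 q, cellVec hg K t - cellVec hg K 0⟫_ℂ‖ ^ 2 =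
      (t + 2 * Real.pi * q) ^ 2 * ‖s.ft (t + 2 * Real.pi * q)‖ ^ 2 := by
    intro q
    rw [inner_sub_right, h0, sub_zero, hft, norm_mul, norm_mul, Complex.norm_I, one_mul,
      Complex.norm_real, mul_pow, Real.norm_eq_abs, sq_abs]
  simp only [hterm] at hle
  refine hle.trans ?_
  rw [unitCircle_L, show (2 : ℝ) * (1 / 2) = 1 by norm_num, one_mul]
  calc ‖cellVec hg K t - cellVec hg K 0‖ ^ 2
      ≤ (|t| * (K + 1) * ‖(memLp_cellAbsSum hg K).toLp‖) ^ 2 := by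
        gcongr; exact norm_cellVec_sub_le hg K t
    _ = _ := by rw [mul_assoc, mul_pow, sq_abs, mul_comm]

end ScalingFunction
end KS

/-! ### Strong and weak limits -/

namespace KS

section Limits

variable {E F : Type*} [NormedAddCommGroup E] [NormedSpace ℂ E] [NormedAddCommGroup F]
  [NormedSpace ℂ F]

/-- Pointwise limits of a bounded sequence of operators form a closed subspace of `E × F`. -/
lemma isClosed_setOf_tendsto_apply {T : ℕ → E →L[ℂ] F} {C : ℝ} (hT : ∀ N, ‖T N‖ ≤ C) :
    IsClosed {p : E × F | Tendsto (fun N => T N p.1) atTop (𝓝 p.2)} := by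
  have hC : 0 ≤ C := (norm_nonneg _).trans (hT 0)
  rw [← isSeqClosed_iff_isClosed]
  intro p q hp hpq
  rw [Set.mem_ofPred_eq, Metric.tendsto_atTop]
  intro ε hε
  obtain ⟨n, hn⟩ := (Metric.tendsto_atTop.1 hpq (ε / (2 * (C + 1))) (by positivity))
  have hn := hn n le_rfl
  -- With `δ = ε / (2 (C + 1))`, this tolerance is `ε - C δ - δ = ε / 2`, which is what the other
  -- two legs of the triangle inequality leave over.
  obtain ⟨N₀, hN₀⟩ := Metric.tendsto_atTop.1 (hp n) (ε / 2 - ε / (2 * (C + 1)) * C -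
    ε / (2 * (C + 1)) + ε / 2) (by
      have : ε / (2 * (C + 1)) * (C + 1) = ε / 2 := by field_simp
      linarith)
  refine ⟨N₀, fun N hN => ?_⟩
  have h1 : dist (p n).1 q.1 < ε / (2 * (C + 1)) := (le_max_left _ _).trans_lt hn
  have h2 : dist (p n).2 q.2 < ε / (2 * (C + 1)) := (le_max_right _ _).trans_lt hn
  have h3 : dist (T N q.1) (T N (p n).1) ≤ C * dist (p n).1 q.1 := by
    rw [dist_comm, dist_eq_norm, ← map_sub, dist_eq_norm]
    exact (T N).le_of_opNorm_le (hT N) _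
  have h4 : C * dist (p n).1 q.1 ≤ C * (ε / (2 * (C + 1))) := by gcongr
  have h5 := hN₀ N hN
  calc dist (T N q.1) q.2 ≤ dist (T N q.1) (T N (p n).1) + dist (T N (p n).1) (p n).2
        + dist (p n).2 q.2 := dist_triangle4 _ _ _ _
    _ < ε := by linarith

/-- A closed subspace of `E × H` contains the limits of its sequences which converge in the first
component and weakly in the second one. -/
lemma mem_of_tendsto_weak {E H : Type*} [NormedAddCommGroup E] [NormedSpace ℂ E]
    [NormedAddCommGroup H] [InnerProductSpace ℂ H] [CompleteSpace H] {S : Submodule ℂ (E × H)}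
    (hS : IsClosed (S : Set (E × H))) {x : ℕ → E} {z : ℕ → H} (hxz : ∀ N, (x N, z N) ∈ S)
    {x₀ : E} {z₀ : H} (hx : Tendsto x atTop (𝓝 x₀))
    (hz : ∀ v, Tendsto (fun N => ⟪v, z N⟫_ℂ) atTop (𝓝 ⟪v, z₀⟫_ℂ)) : (x₀, z₀) ∈ S := by
  by_contra hmem
  -- A functional separating the limit from `S` passes to the limit along the sequence: it is norm
  -- continuous in the first component and, by Riesz, an inner product in the second. This
  -- contradicts the strict separation.
  obtain ⟨f, u, hu, hu'⟩ := RCLike.geometric_hahn_banach_closed_point (𝕜 := ℂ)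
    (S.restrictScalars ℝ).convex hS hmem
  have hlim : Tendsto (fun N => f (x N, z N)) atTop (𝓝 (f (x₀, z₀))) := by
    have e : ∀ (a : E) (b : H), f (a, b) = f.comp (ContinuousLinearMap.inl ℂ E H) a +
        ⟪(InnerProductSpace.toDual ℂ H).symm (f.comp (ContinuousLinearMap.inr ℂ E H)), b⟫_ℂ := by
      intro a b
      rw [InnerProductSpace.toDual_symm_apply]
      simp [← map_add]
    simp only [e]
    exact ((ContinuousLinearMap.continuous _).continuousAt.tendsto.comp hx).add (hz _)
  have h2 := le_of_tendsto' ((RCLike.continuous_re.tendsto _).comp hlim)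
    (fun N => (hu _ (hxz N)).le)
  exact absurd hu' (not_lt.2 h2)

end Limits

/-! ### Interpolated plane waves and density of the wavelet span -/

namespace LatticeData

variable (D : LatticeData) (θ : ℤˣ)

/-- Bounded sequences converge weakly if their Fourier coefficients converge. -/
lemma tendsto_inner_of_tendsto_inner_wave {z : ℕ → D.ContSpace} {z₀ : D.ContSpace} {C : ℝ}
    (hC : ∀ N, ‖z N‖ ≤ C)
    (h : ∀ n, Tendsto (fun N => ⟪D.wave θ n, z N⟫_ℂ) atTop (𝓝 ⟪D.wave θ n, z₀⟫_ℂ))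
    (v : D.ContSpace) : Tendsto (fun N => ⟪v, z N⟫_ℂ) atTop (𝓝 ⟪v, z₀⟫_ℂ) := by
  have hcl := isClosed_setOf_tendsto_apply (T := fun N => innerSL ℂ (z N)) (C := C)
    (fun N => by rw [innerSL_apply_norm]; exact hC N)
  have hmem : ∀ w ∈ D.trigPoly θ, Tendsto (fun N => ⟪z N, w⟫_ℂ) atTop (𝓝 ⟪z₀, w⟫_ℂ) := by
    intro w hw
    induction hw using Submodule.span_induction with
    | mem w hw =>
      obtain ⟨n, rfl⟩ := hw
      have := (Complex.continuous_conj.tendsto _).comp (h n)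
      simp only [wave, inner_conj_symm, Function.comp_def] at this
      exact this
    | zero => simp
    | add a b _ _ ha hb => simpa only [inner_add_right] using ha.add hb
    | smul c a _ ha => simpa only [inner_smul_right] using ha.const_mul c
  -- The functionals `⟪z N, ·⟫` are uniformly bounded, so the vectors on which they converge to
  -- `⟪z₀, ·⟫` form a closed set; it contains the dense trigonometric polynomials.
  have hv : Tendsto (fun N => ⟪z N, v⟫_ℂ) atTop (𝓝 ⟪z₀, v⟫_ℂ) := by
    have hc : Continuous fun w : D.ContSpace => (w, ⟪z₀, w⟫_ℂ) := by fun_prop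
    have hset := hcl.preimage hc
    have : closure (D.trigPoly θ : Set D.ContSpace) ⊆ _ := closure_minimal
      (fun w hw => hmem w hw) hset
    exact this (D.dense_trigPoly θ v)
  have := (Complex.continuous_conj.tendsto _).comp hv
  simpa only [inner_conj_symm, Function.comp_def] using this

variable (s : ScalingFunction)

/-- The interpolation of a plane wave on the lattice by the scaling function. -/
def interp (N : ℕ) (n : ℤ) : D.ContSpace :=
  ((√(D.eps N) : ℝ) : ℂ) • D.R s θ N (D.latWave N (D.mom θ n))

lemma interp_mem_waveletSpan (N : ℕ) (n : ℤ) : D.interp θ s N n ∈ D.waveletSpan s θ :=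
  Submodule.smul_mem _ _ (D.R_mem_waveletSpan s θ N _)

lemma norm_sq_interp (N : ℕ) (n : ℤ) : ‖D.interp θ s N n‖ ^ 2 = 2 * D.L := by
  rw [interp, norm_smul, LinearIsometry.norm_map, mul_pow, norm_sq_latWave, Complex.norm_real,
    Real.norm_eq_abs, sq_abs, Real.sq_sqrt (D.eps_pos N).le, ← D.eps_mul_len N]
  ring

/-- Aliasing: the lattice cannot tell `n` from `n + 2 L_N q`, and the weights `ŝ` at the aliased
momenta distribute the mass among them. -/
lemma inner_wave_interp (N : ℕ) (m n : ℤ) : ⟪D.wave θ m, D.interp θ s N n⟫_ℂ =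
    if (2 * D.len N : ℤ) ∣ n - m then 2 * D.L * s.ft (D.eps N * D.mom θ m) else 0 := by
  rw [interp, inner_smul_right, inner_wave_R, inner_latWave]
  split_ifs
  · have e : ((√(D.eps N) : ℝ) : ℂ) * ((√(D.eps N) : ℝ) : ℂ) = D.eps N := by
      rw [← Complex.ofReal_mul, Real.mul_self_sqrt (D.eps_pos N).le]
    rw [← D.eps_mul_len N]
    push_cast
    linear_combination 2 * s.ft (D.eps N * D.mom θ m) * (D.len N : ℂ) * e
  · simp

/-- Both vectors have squared norm `2L`, and their inner product `2L ŝ(ε_N l)` tends to `2L`. -/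
lemma tendsto_interp (n : ℤ) : Tendsto (fun N => D.interp θ s N n) atTop (𝓝 (D.wave θ n)) := by
  rw [tendsto_iff_norm_sub_tendsto_zero]
  have hsq : Tendsto (fun N => ‖D.interp θ s N n - D.wave θ n‖ ^ 2) atTop (𝓝 0) := by
    have e : ∀ N, ‖D.interp θ s N n - D.wave θ n‖ ^ 2 =
        4 * D.L - 4 * D.L * (s.ft (D.eps N * D.mom θ n)).re := by
      intro N
      rw [@norm_sub_sq ℂ, norm_sq_interp, norm_sq_wave, inner_re_symm, inner_wave_interp,
        if_pos (by simp)]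
      simp
      ring
    simp only [e]
    have h1 : Tendsto (fun N => D.eps N * D.mom θ n) atTop (𝓝 0) := by
      simpa using D.tendsto_eps.mul_const (D.mom θ n)
    have h2 := (s.continuous_ft.tendsto 0).comp h1
    have h3 := (Complex.continuous_re.tendsto _).comp h2
    rw [s.ft_zero, Complex.one_re] at h3
    have h4 := (h3.const_mul (4 * D.L)).const_sub (4 * D.L)
    simpa using h4
  have := (Real.continuous_sqrt.tendsto 0).comp hsq
  simpa [Function.comp_def, Real.sqrt_sq (norm_nonneg _)] using this

lemma dense_waveletSpan : Dense (D.waveletSpan s θ : Set D.ContSpace) := by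
  have h : D.trigPoly θ ≤ (D.waveletSpan s θ).topologicalClosure := by
    refine Submodule.span_le.2 ?_
    rintro _ ⟨n, rfl⟩
    exact mem_closure_of_tendsto (D.tendsto_interp θ s n)
      (Eventually.of_forall fun N => D.interp_mem_waveletSpan θ s N n)
  exact dense_closure.1 ((D.dense_trigPoly θ).mono h)

/-! ### The wavelet span as a core of the one-particle generator -/

section Bound

variable {s} (σ : ℤˣ) (κ : ℤ)

lemma eps_mul_mom_add (N : ℕ) (n q : ℤ) :
    D.eps N * D.mom θ (n + 2 * D.len N * q) = D.eps N * D.mom θ n + 2 * Real.pi * q := by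
  have := (D.eps_pos N).ne'
  have hl : (D.len N : ℝ) ≠ 0 := by exact_mod_cast (D.len_pos N).ne'
  simp only [mom, ← D.eps_mul_len N]
  push_cast
  field_simp
  ring

/-- In the variable `t = ε_N l`, the sum over aliases is `ε_N⁻²` times the sum in
`Regular.exists_bound`. The bound `C t²` there supplies the `ε_N²` that makes the result independent
of `N`. -/
lemma exists_mom_bound (hs : s.Regular) (n : ℤ) : ∃ C : ℝ, ∀ (N : ℕ) (F : Finset ℤ),
    ∑ m ∈ F, D.mom θ m ^ 2 * ‖⟪D.wave θ m, D.interp θ s N n⟫_ℂ‖ ^ 2 ≤ C := by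
  classical
  obtain ⟨C, hC⟩ := hs.exists_bound
  refine ⟨(2 * D.L) ^ 2 * (C * D.mom θ n ^ 2), fun N F => ?_⟩
  have he := D.eps_pos N
  have hl : (2 * D.len N : ℤ) ≠ 0 := by have := D.len_pos N; omega
  set j : ℤ → ℤ := fun q => n + 2 * D.len N * q with hj
  have hinj : Function.Injective j := fun a b hab => by
    simp only [hj] at hab
    exact mul_left_cancel₀ hl (by linarith)
  have hF : ∑ m ∈ F, D.mom θ m ^ 2 * ‖⟪D.wave θ m, D.interp θ s N n⟫_ℂ‖ ^ 2 =
      ∑ q ∈ F.preimage j hinj.injOn,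
        D.mom θ (j q) ^ 2 * ‖⟪D.wave θ (j q), D.interp θ s N n⟫_ℂ‖ ^ 2 := by
    rw [Finset.sum_preimage j F hinj.injOn (fun m => D.mom θ m ^ 2 *
      ‖⟪D.wave θ m, D.interp θ s N n⟫_ℂ‖ ^ 2)]
    intro m _ hm
    rw [inner_wave_interp, if_neg]
    · simp
    · rintro ⟨q, hq⟩
      exact hm ⟨-q, by simp only [hj]; linarith⟩
  rw [hF]
  have hterm : ∀ q, D.mom θ (j q) ^ 2 * ‖⟪D.wave θ (j q), D.interp θ s N n⟫_ℂ‖ ^ 2 =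
      ((2 * D.L) ^ 2 / D.eps N ^ 2) * ((D.eps N * D.mom θ n + 2 * Real.pi * q) ^ 2 *
        ‖s.ft (D.eps N * D.mom θ n + 2 * Real.pi * q)‖ ^ 2) := by
    intro q
    rw [inner_wave_interp, if_pos ⟨-q, by simp only [hj]; ring⟩, ← D.eps_mul_mom_add, norm_mul,
      show (2 * (D.L : ℂ)) = ((2 * D.L : ℝ) : ℂ) by push_cast; ring, Complex.norm_real,
      Real.norm_eq_abs, mul_pow, sq_abs]
    simp only [hj]
    generalize ‖s.ft (D.eps N * D.mom θ (n + 2 * D.len N * q))‖ = z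
    field_simp
  simp only [hterm]
  rw [← Finset.mul_sum]
  calc _ ≤ ((2 * D.L) ^ 2 / D.eps N ^ 2) * (C * (D.eps N * D.mom θ n) ^ 2) := by
        gcongr; exact hC _ _
    _ = _ := by field_simp

/-- The uniform momentum bound makes the coefficients prescribed by `ℓ_{±,k}` square-summable with a
bound free of `N`, so Riesz-Fischer yields the image vector. -/
lemma exists_ellGraph_interp (hs : s.Regular) (n : ℤ) : ∃ C : ℝ, ∀ N : ℕ, ∃ ζ : D.ContSpace,
    (D.interp θ s N n, ζ) ∈ D.ellGraph θ σ κ ∧ ‖ζ‖ ≤ C := by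
  have hL := D.L_pos
  obtain ⟨C, hC⟩ := D.exists_mom_bound θ hs n
  set a : ℝ := ((σ : ℤ) * D.L / Real.pi) ^ 2 with ha
  set b : ℝ := ((σ : ℤ) * (Real.pi / D.L * κ) / 2) ^ 2 with hb
  set K : ℝ := 2 * a * C + 2 * a * b * (2 * D.L * (2 * D.L)) with hK
  have hbound : ∀ (N : ℕ) (F : Finset ℤ),
      ∑ m ∈ F, ‖(D.ellCoef θ σ κ m : ℂ) * ⟪D.wave θ m, D.interp θ s N n⟫_ℂ‖ ^ 2 ≤ K := by
    intro N F
    have h1 := hC N F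
    have h2 := sum_le_hasSum F (fun m _ => by positivity)
      (D.hasSum_sq_inner_wave θ (D.interp θ s N n))
    rw [norm_sq_interp] at h2
    -- `(x - y)² ≤ 2x² + 2y²` splits the symbol into the momentum, controlled by `C`, and the
    -- constant `k/2`, controlled by the norm `2L`.
    have h3 : ∀ m, ‖(D.ellCoef θ σ κ m : ℂ) * ⟪D.wave θ m, D.interp θ s N n⟫_ℂ‖ ^ 2 ≤
        2 * a * (D.mom θ m ^ 2 * ‖⟪D.wave θ m, D.interp θ s N n⟫_ℂ‖ ^ 2) +
          2 * a * b * ‖⟪D.wave θ m, D.interp θ s N n⟫_ℂ‖ ^ 2 := by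
      intro m
      rw [norm_mul, mul_pow, Complex.norm_real, Real.norm_eq_abs, sq_abs, ellCoef, mul_pow, ← ha,
        ← mul_assoc, ← add_mul]
      refine mul_le_mul_of_nonneg_right ?_ (sq_nonneg _)
      have ha0 : 0 ≤ a := sq_nonneg _
      have : D.shiftMom θ σ κ m ^ 2 ≤ 2 * D.mom θ m ^ 2 + 2 * b := by
        rw [shiftMom, hb]
        nlinarith [sq_nonneg (D.mom θ m + (σ : ℤ) * (Real.pi / D.L * κ) / 2)]
      nlinarith
    refine (Finset.sum_le_sum fun m _ => h3 m).trans ?_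
    rw [Finset.sum_add_distrib, ← Finset.mul_sum, ← Finset.mul_sum, hK]
    have ha0 : 0 ≤ a := sq_nonneg _
    have hb0 : 0 ≤ b := sq_nonneg _
    gcongr
  refine ⟨√(K / (2 * D.L)), fun N => ?_⟩
  set c : ℤ → ℂ := fun m => (D.ellCoef θ σ κ m : ℂ) * ⟪D.wave θ m, D.interp θ s N n⟫_ℂ with hc
  have hsum : Summable fun m => ‖c m‖ ^ 2 :=
    summable_of_sum_le (fun m => by positivity) (hbound N)
  obtain ⟨ζ, hζ⟩ := D.exists_inner_wave θ (c := c ∘ Equiv.addRight ((σ : ℤ) * κ))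
    ((Equiv.addRight ((σ : ℤ) * κ)).summable_iff.2 hsum)
  refine ⟨ζ, fun m => ?_, ?_⟩
  · rw [hζ]
    simp [hc]
  · have h1 := D.hasSum_sq_inner_wave θ ζ
    simp only [hζ] at h1
    have h2 : HasSum (fun m => ‖c m‖ ^ 2) (2 * D.L * ‖ζ‖ ^ 2) :=
      (Equiv.addRight ((σ : ℤ) * κ)).hasSum_iff.1 h1
    have h3 : 2 * D.L * ‖ζ‖ ^ 2 ≤ K := hasSum_le_of_sum_le h2 (hbound N)
    refine Real.le_sqrt_of_sq_le ?_
    rw [le_div_iff₀ (by positivity)]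
    linarith

lemma mem_ell_domain_iff {ξ : D.ContSpace} : ξ ∈ (D.ell σ θ κ).domain ↔
    ∃ ζ, (ξ, ζ) ∈ D.ellGraph θ σ κ := by
  rw [LinearPMap.mem_domain_iff, ell_graph]

/-- At each scale the lattice plane waves span the lattice space, so membership need only be checked
for multiples of `interp`. -/
lemma waveletSpan_le_ell_domain (hs : s.Regular) : D.waveletSpan s θ ≤ (D.ell σ θ κ).domain := by
  refine iSup_le fun N => ?_
  rintro _ ⟨η, rfl⟩
  have hη : η ∈ Submodule.span ℂ (Set.range fun n : D.Sites N => D.latWave N (D.mom θ n)) := by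
    rw [span_latWave]; trivial
  induction hη using Submodule.span_induction with
  | mem η hη =>
    obtain ⟨n, rfl⟩ := hη
    obtain ⟨C, hC⟩ := D.exists_ellGraph_interp θ σ κ hs n
    obtain ⟨ζ, hζ, -⟩ := hC N
    have h1 := (D.mem_ell_domain_iff θ σ κ).2 ⟨ζ, hζ⟩
    have h2 := Submodule.smul_mem _ (((√(D.eps N) : ℝ) : ℂ)⁻¹) h1
    rw [interp, inv_smul_smul₀ (Complex.ofReal_ne_zero.2 (Real.sqrt_pos.2 (D.eps_pos N)).ne')] at h2
    exact h2
  | zero => rw [map_zero]; exact Submodule.zero_mem _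
  | add a b _ _ ha hb => rw [map_add]; exact Submodule.add_mem _ ha hb
  | smul c a _ ha => rw [map_smul]; exact Submodule.smul_mem _ _ ha

/-- The wavelet span is a core of the one-particle Virasoro generator. -/
lemma ell_graph_le_closure (hs : s.Regular) : (D.ell σ θ κ).graph ≤
    ((D.ell σ θ κ).domRestrict (D.waveletSpan s θ)).graph.topologicalClosure := by
  rw [ell_graph]
  refine D.ellGraph_le θ σ κ (Submodule.isClosed_topologicalClosure _) fun n => ?_
  obtain ⟨C, hC⟩ := D.exists_ellGraph_interp θ σ κ hs n
  choose ζ hζ hζC using hC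
  -- It suffices to reach the pairs over plane waves. The interpolants converge in norm, while their
  -- images are only bounded with convergent coefficients, which is weak convergence.
  refine mem_of_tendsto_weak (Submodule.isClosed_topologicalClosure _)
    (x := fun N => D.interp θ s N n) (z := ζ) (fun N => ?_) (D.tendsto_interp θ s n)
    (D.tendsto_inner_of_tendsto_inner_wave θ hζC fun m => ?_)
  · refine Submodule.le_topologicalClosure _ ?_
    have h1 : (D.interp θ s N n, ζ N) ∈ (D.ell σ θ κ).graph := by rw [ell_graph]; exact hζ N
    obtain ⟨y, hy1, hy2⟩ := (LinearPMap.mem_graph_iff _).1 h1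
    rw [LinearPMap.mem_graph_iff]
    refine ⟨⟨y, ⟨?_, y.2⟩⟩, hy1, ?_⟩
    · rw [hy1]; exact D.interp_mem_waveletSpan θ s N n
    · rw [← hy2]
      exact LinearPMap.domRestrict_apply rfl
  · have e1 : ∀ N, ⟪D.wave θ m, ζ N⟫_ℂ =
        D.ellCoef θ σ κ (m + σ * κ) * ⟪D.wave θ (m + σ * κ), D.interp θ s N n⟫_ℂ := by
      intro N
      have := hζ N (m + σ * κ)
      simpa using this
    have e2 := D.wave_mem_ellGraph θ σ κ n (m + σ * κ)
    simp only [add_sub_cancel_right] at e2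
    simp only [e1, e2]
    refine Tendsto.const_mul _ ?_
    have hc : Continuous fun v : D.ContSpace => ⟪D.wave θ (m + σ * κ), v⟫_ℂ := by fun_prop
    exact (hc.tendsto _).comp (D.tendsto_interp θ s n)

end Bound

end LatticeData
end KS

/-! ### Compressed lattice shifts -/

namespace KS
namespace LatticeData

variable (D : LatticeData) (θ : ℤˣ) (s : ScalingFunction)

/-- Multiplication by the plane wave `e_p` on the lattice. -/
def modulate (N : ℕ) (p : ℝ) : D.LatSpace N →L[ℂ] D.LatSpace N :=
  LinearMap.mkContinuous
    { toFun := fun η => WithLp.toLp 2 fun j => D.latWave N p j * η j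
      map_add' := fun η η' => by ext j; simp [mul_add]
      map_smul' := fun c η => by ext j; simp [mul_left_comm] } 1 fun η => by
    rw [one_mul, EuclideanSpace.norm_eq, EuclideanSpace.norm_eq]
    refine le_of_eq (congrArg _ (Finset.sum_congr rfl fun j _ => ?_))
    simp only [LinearMap.coe_mk, AddHom.coe_mk, latWave]
    rw [norm_mul, mul_comm Complex.I, Complex.norm_exp_ofReal_mul_I, one_mul]

lemma modulate_apply (N : ℕ) (p : ℝ) (η : D.LatSpace N) (j : D.Sites N) :
    D.modulate N p η j = D.latWave N p j * η j := rfl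

lemma norm_modulate_le (N : ℕ) (p : ℝ) : ‖D.modulate N p‖ ≤ 1 :=
  LinearMap.mkContinuous_norm_le _ zero_le_one _

lemma modulate_latWave (N : ℕ) (p q : ℝ) :
    D.modulate N p (D.latWave N q) = D.latWave N (q + p) := by
  ext j
  rw [modulate_apply]
  simp only [latWave]
  rw [← Complex.exp_add]
  congr 1
  push_cast
  ring

lemma mom_sub_mul (σ : ℤˣ) (κ n : ℤ) :
    D.mom θ (n - σ * κ) = D.mom θ n + -((σ : ℤ) * (Real.pi / D.L * κ)) := by
  simp only [mom]; push_cast; ring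

section Shift

variable (σ : ℤˣ) (κ : ℤ)

/-- The compression of the lattice momentum shift by `∓ k`, as an operator on the continuum space. -/
def shiftOp (N : ℕ) : D.ContSpace →L[ℂ] D.ContSpace :=
  (D.R s θ N).toContinuousLinearMap ∘L D.modulate N (-((σ : ℤ) * (Real.pi / D.L * κ))) ∘L
    ContinuousLinearMap.adjoint (D.R s θ N).toContinuousLinearMap

lemma norm_shiftOp_le (N : ℕ) : ‖D.shiftOp θ s σ κ N‖ ≤ 1 := by
  have h1 := (D.R s θ N).norm_toContinuousLinearMap_le
  have h2 := D.norm_modulate_le N (-((σ : ℤ) * (Real.pi / D.L * κ)))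
  have h3 : ‖ContinuousLinearMap.adjoint (D.R s θ N).toContinuousLinearMap‖ ≤ 1 := by
    rw [LinearIsometryEquiv.norm_map]; exact h1
  refine (ContinuousLinearMap.opNorm_comp_le _ _).trans ?_
  refine mul_le_one₀ h1 (norm_nonneg _) ?_
  exact (ContinuousLinearMap.opNorm_comp_le _ _).trans (mul_le_one₀ h2 (norm_nonneg _) h3)

lemma shiftOp_R (N : ℕ) (η : D.LatSpace N) : D.shiftOp θ s σ κ N (D.R s θ N η) =
    D.R s θ N (D.modulate N (-((σ : ℤ) * (Real.pi / D.L * κ))) η) := by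
  have : ContinuousLinearMap.adjoint (D.R s θ N).toContinuousLinearMap (D.R s θ N η) = η := by
    refine ext_inner_left ℂ fun w => ?_
    rw [ContinuousLinearMap.adjoint_inner_right]
    exact (D.R s θ N).inner_map_map w η
  change D.R s θ N (D.modulate N _ (ContinuousLinearMap.adjoint _ (D.R s θ N η))) = _
  rw [this]

lemma shiftOp_interp (N : ℕ) (n : ℤ) :
    D.shiftOp θ s σ κ N (D.interp θ s N n) = D.interp θ s N (n - σ * κ) := by
  rw [interp, interp, map_smul, shiftOp_R, modulate_latWave, mom_sub_mul]

/-- On interpolants the shift is exact, `interp n ↦ interp (n - σκ)`. The remainder `wave - interp`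
tends to zero and the shifts are contractions. -/
lemma tendsto_shiftOp_wave (n : ℤ) :
    Tendsto (fun N => D.shiftOp θ s σ κ N (D.wave θ n)) atTop (𝓝 (D.wave θ (n - σ * κ))) := by
  have h1 := D.tendsto_interp θ s (n - σ * κ)
  have h2 : Tendsto (fun N => D.shiftOp θ s σ κ N (D.wave θ n - D.interp θ s N n)) atTop (𝓝 0) := by
    have h3 : Tendsto (fun N => ‖D.wave θ n - D.interp θ s N n‖) atTop (𝓝 0) := by
      have := ((D.tendsto_interp θ s n).const_sub (D.wave θ n)).norm
      simpa using this
    refine squeeze_zero_norm (fun N => ?_) h3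
    have := (D.shiftOp θ s σ κ N).le_of_opNorm_le (D.norm_shiftOp_le θ s σ κ N)
      (D.wave θ n - D.interp θ s N n)
    simpa using this
  have h4 := h1.add h2
  rw [add_zero] at h4
  refine h4.congr fun N => ?_
  rw [map_sub, shiftOp_interp, add_sub_cancel]

/-- The compressed lattice shifts converge strongly to the shift of the plane waves. -/
lemma tendsto_shiftOp {w w' : D.ContSpace}
    (h : ∀ n, ⟪D.wave θ (n - σ * κ), w'⟫_ℂ = ⟪D.wave θ n, w⟫_ℂ) :
    Tendsto (fun N => D.shiftOp θ s σ κ N w) atTop (𝓝 w') := by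
  have hcl := isClosed_setOf_tendsto_apply (D.norm_shiftOp_le θ s σ κ)
  have h1 := D.hasSum_wave θ w
  have h2 := (Equiv.subRight ((σ : ℤ) * κ)).hasSum_iff.2 (D.hasSum_wave θ w')
  -- Convergence is a closed condition on pairs, so it need only be checked on the partial sums of
  -- the Fourier series of `w` and `w'`, matched by reindexing.
  have h3 := hcl.mem_of_tendsto (h1.prodMk h2) (Eventually.of_forall fun F => ?_)
  · exact h3
  · simp only [Set.mem_ofPred_eq, Prod.fst_sum, Prod.snd_sum, map_sum, map_smul, Function.comp_apply,
      Equiv.subRight_apply, h]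
    exact tendsto_finsetSum _ fun n _ => (D.tendsto_shiftOp_wave θ s σ κ n).const_smul _

end Shift

/-! ### Convergence of the one-particle approximants -/

section Approximant

variable (σ : ℤˣ) (κ : ℤ)

/-- The lattice operator with eigenvectors `e_l` and eigenvalues `2 L_N sin(ε_N (l ∓ k/2))`. -/
def sinOp (N : ℕ) (η : D.LatSpace N) : D.LatSpace N :=
  ∑ n ∈ Finset.Ico (-(D.len N : ℤ)) (D.len N), ((Real.sin (D.eps N * D.shiftMom θ σ κ n) : ℝ) : ℂ) •
    ⟪D.latWave N (D.mom θ n), η⟫_ℂ • D.latWave N (D.mom θ n)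

/-- Both the sine and the lattice plane wave have period `2 L_N` in the momentum label, so the
eigenvalue relation holds for every integer `m` and not only in the window. -/
lemma inner_latWave_sinOp (N : ℕ) (η : D.LatSpace N) (m : ℤ) :
    ⟪D.latWave N (D.mom θ m), D.sinOp θ σ κ N η⟫_ℂ =
      2 * D.len N * (Real.sin (D.eps N * D.shiftMom θ σ κ m) : ℝ) *
        ⟪D.latWave N (D.mom θ m), η⟫_ℂ := by
  obtain ⟨i, hi, q, rfl⟩ := D.exists_site N m
  have hsin : Real.sin (D.eps N * D.shiftMom θ σ κ (i + 2 * D.len N * q)) =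
      Real.sin (D.eps N * D.shiftMom θ σ κ i) := by
    have e : D.eps N * D.shiftMom θ σ κ (i + 2 * D.len N * q) =
        D.eps N * D.shiftMom θ σ κ i + q * (2 * Real.pi) := by
      simp only [shiftMom, mul_sub, eps_mul_mom_add]; ring
    rw [e, Real.sin_add_int_mul_two_pi]
  rw [latWave_add, hsin, sinOp, inner_sum, Finset.sum_eq_single i]
  · rw [inner_smul_right, inner_smul_right, inner_latWave_self]; ring
  · intro n hn hne
    rw [inner_smul_right, inner_smul_right, inner_latWave, if_neg, mul_zero, mul_zero]
    intro h
    exact hne (D.eq_of_dvd_of_mem_Ico hi hn h).symm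
  · exact fun h => absurd hi h

/-- As the relation on the lattice holds at every momentum, the factor `ŝ` cancels and the lattice
operator becomes a Fourier multiplier on the continuum image. Here `2 L_N / (2L) = 1 / ε_N`. -/
lemma inner_wave_R_sinOp (N : ℕ) (η : D.LatSpace N) (m : ℤ) :
    ⟪D.wave θ m, ((2 * D.L : ℂ)⁻¹) • D.R s θ N (D.sinOp θ σ κ N η)⟫_ℂ =
      (Real.sin (D.eps N * D.shiftMom θ σ κ m) / D.eps N : ℝ) * ⟪D.wave θ m, D.R s θ N η⟫_ℂ := by
  have he : (D.eps N : ℂ) ≠ 0 := Complex.ofReal_ne_zero.2 (D.eps_pos N).ne'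
  have hl : (D.len N : ℂ) ≠ 0 := by exact_mod_cast (D.len_pos N).ne'
  rw [inner_smul_right, inner_wave_R, inner_wave_R, inner_latWave_sinOp, ← D.eps_mul_len N]
  push_cast
  field_simp

/-- The one-particle operator of the Koo-Saleur approximant, on the continuum space. -/
def oneParticle (N : ℕ) (ξ : D.ContSpace) : D.ContSpace :=
  (((σ : ℤ) / (2 * Real.pi) : ℝ) : ℂ) • ∑ n ∈ Finset.Ico (-(D.len N : ℤ)) (D.len N),
    ((Real.cos (D.eps N * (Real.pi / D.L * κ) / 4) ^ 2 *
      Real.sin (D.eps N * (D.mom θ n - (σ : ℤ) * (Real.pi / D.L * κ) / 2)) : ℝ) : ℂ) •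
    ⟪D.R s θ N (D.latWave N (D.mom θ n)), ξ⟫_ℂ • D.R s θ N (D.latWave N (D.mom θ (n - σ * κ)))

lemma oneParticle_R (N : ℕ) (η : D.LatSpace N) : D.oneParticle θ s σ κ N (D.R s θ N η) =
    (((σ : ℤ) * D.L / Real.pi * Real.cos (D.eps N * (Real.pi / D.L * κ) / 4) ^ 2 : ℝ) : ℂ) •
      D.shiftOp θ s σ κ N (((2 * D.L : ℂ)⁻¹) • D.R s θ N (D.sinOp θ σ κ N η)) := by
  have hL : (D.L : ℂ) ≠ 0 := Complex.ofReal_ne_zero.2 D.L_pos.ne'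
  have hpi : (Real.pi : ℂ) ≠ 0 := Complex.ofReal_ne_zero.2 Real.pi_ne_zero
  rw [map_smul, shiftOp_R, sinOp, map_sum, map_sum, oneParticle, smul_smul, Finset.smul_sum,
    Finset.smul_sum]
  refine Finset.sum_congr rfl fun n _ => ?_
  rw [map_smul, map_smul, map_smul, map_smul, modulate_latWave, ← mom_sub_mul,
    LinearIsometry.inner_map_map, smul_smul, smul_smul, smul_smul, smul_smul, shiftMom]
  congr 1
  push_cast
  field_simp

lemma tendsto_sin_div (t : ℝ) :
    Tendsto (fun N => Real.sin (D.eps N * t) / D.eps N) atTop (𝓝 t) := by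
  have hd : HasDerivAt (fun x : ℝ => Real.sin (x * t)) t 0 := by
    have := ((hasDerivAt_id (0 : ℝ)).mul_const t).sin
    simpa using this
  have h1 := hd.tendsto_slope_zero
  have h2 : Tendsto D.eps atTop (𝓝[≠] 0) :=
    tendsto_nhdsWithin_iff.2 ⟨D.tendsto_eps, Eventually.of_forall fun N => (D.eps_pos N).ne'⟩
  refine (h1.comp h2).congr fun N => ?_
  simp [div_eq_inv_mul]

lemma abs_sin_div_le (N : ℕ) (t : ℝ) : |Real.sin (D.eps N * t) / D.eps N| ≤ |t| := by
  have he := D.eps_pos N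
  rw [abs_div, abs_of_pos he, div_le_iff₀ he]
  refine Real.abs_sin_le_abs.trans ?_
  rw [abs_mul, abs_of_pos he, mul_comm]

/-- Convergence of the one-particle Koo-Saleur approximants on the wavelet span. -/
lemma tendsto_oneParticle {ξ ζ : D.ContSpace} (hξ : ξ ∈ D.waveletSpan s θ)
    (hζ : (ξ, ζ) ∈ D.ellGraph θ σ κ) :
    Tendsto (fun N => D.oneParticle θ s σ κ N ξ) atTop (𝓝 ζ) := by
  have hL := D.L_pos
  have hLC : (D.L : ℂ) ≠ 0 := Complex.ofReal_ne_zero.2 D.L_pos.ne'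
  have hpi : (Real.pi : ℂ) ≠ 0 := Complex.ofReal_ne_zero.2 Real.pi_ne_zero
  have hσ : ((σ : ℤ) : ℂ) * ((σ : ℤ) : ℂ) = 1 := by
    rcases Int.units_eq_one_or σ with h | h <;> simp [h]
  obtain ⟨M, hM⟩ := D.mem_waveletSpan s θ hξ
  -- `w'` is `ζ` without the prefactor `σL/π` (note `σ² = 1`). Below, `w` is `w'` with the momentum
  -- shift undone, that is, `ξ` multiplied by the symbol `l ∓ k/2`.
  set w' : D.ContSpace := (((σ : ℤ) * Real.pi / D.L : ℝ) : ℂ) • ζ with hw'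
  set c : ℤ → ℂ := fun m => (D.shiftMom θ σ κ m : ℂ) * ⟪D.wave θ m, ξ⟫_ℂ with hc
  have hcw : ∀ m, ⟪D.wave θ (m - σ * κ), w'⟫_ℂ = c m := by
    intro m
    rw [hw', inner_smul_right, hζ m, hc, ellCoef]
    push_cast
    field_simp
    linear_combination (D.shiftMom θ σ κ m : ℂ) * ⟪D.wave θ m, ξ⟫_ℂ * hσ
  have hcs : Summable fun m => ‖c m‖ ^ 2 := by
    have := (Equiv.subRight ((σ : ℤ) * κ)).summable_iff.2
      (D.hasSum_sq_inner_wave θ w').summable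
    refine this.congr fun m => ?_
    rw [← hcw]; rfl
  obtain ⟨w, hw⟩ := D.exists_inner_wave θ hcs
  -- The multiplier is applied to `ξ` at every `N`, also where `ξ` is not yet in the range of
  -- `R^N_∞`; the identification with the lattice operator is made only for `N ≥ M`.
  have hy : ∀ N : ℕ, ∃ y : D.ContSpace, ∀ m, ⟪D.wave θ m, y⟫_ℂ =
      (Real.sin (D.eps N * D.shiftMom θ σ κ m) / D.eps N : ℝ) * ⟪D.wave θ m, ξ⟫_ℂ := by
    intro N
    refine D.exists_inner_wave θ (hcs.of_nonneg_of_le (fun m => by positivity) fun m => ?_)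
    rw [hc]
    simp only [norm_mul, Complex.norm_real, Real.norm_eq_abs]
    exact pow_le_pow_left₀ (by positivity) (mul_le_mul_of_nonneg_right (D.abs_sin_div_le N _)
      (norm_nonneg _)) 2
  choose y hy using hy
  have hyw : Tendsto y atTop (𝓝 w) := by
    rw [tendsto_iff_norm_sub_tendsto_zero]
    have hterm : ∀ N m, ‖⟪D.wave θ m, y N - w⟫_ℂ‖ ^ 2 =
        (Real.sin (D.eps N * D.shiftMom θ σ κ m) / D.eps N - D.shiftMom θ σ κ m) ^ 2 *
          ‖⟪D.wave θ m, ξ⟫_ℂ‖ ^ 2 := by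
      intro N m
      rw [inner_sub_right, hy, hw, hc]
      simp only
      rw [← sub_mul, norm_mul, mul_pow, ← Complex.ofReal_sub, Complex.norm_real, Real.norm_eq_abs,
        sq_abs]
    have hsq : Tendsto (fun N => ∑' m, ‖⟪D.wave θ m, y N - w⟫_ℂ‖ ^ 2) atTop
        (𝓝 (∑' _ : ℤ, (0 : ℝ))) := by
      -- The constant is `4 = 2²`: both the multiplier and its limit are bounded by the modulus of
      -- the symbol.
      refine tendsto_tsum_of_dominated_convergence (bound := fun m => 4 * ‖c m‖ ^ 2)
        (hcs.mul_left 4) (fun m => ?_) (Eventually.of_forall fun N m => ?_)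
      · simp only [hterm]
        have := (((D.tendsto_sin_div (D.shiftMom θ σ κ m)).sub_const
          (D.shiftMom θ σ κ m)).pow 2).mul_const (‖⟪D.wave θ m, ξ⟫_ℂ‖ ^ 2)
        simpa using this
      · rw [hterm, Real.norm_of_nonneg (by positivity), hc]
        simp only [norm_mul, mul_pow, Complex.norm_real, Real.norm_eq_abs, sq_abs]
        rw [← mul_assoc]
        refine mul_le_mul_of_nonneg_right ?_ (by positivity)
        have h1 := D.abs_sin_div_le N (D.shiftMom θ σ κ m)
        have h2 := abs_sub (Real.sin (D.eps N * D.shiftMom θ σ κ m) / D.eps N)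
          (D.shiftMom θ σ κ m)
        rw [← sq_abs, ← sq_abs (D.shiftMom θ σ κ m)]
        nlinarith [abs_nonneg (Real.sin (D.eps N * D.shiftMom θ σ κ m) / D.eps N -
          D.shiftMom θ σ κ m)]
    rw [tsum_zero] at hsq
    have e : ∀ N, ∑' m, ‖⟪D.wave θ m, y N - w⟫_ℂ‖ ^ 2 = 2 * D.L * ‖y N - w‖ ^ 2 := fun N =>
      (D.hasSum_sq_inner_wave θ (y N - w)).tsum_eq
    simp only [e] at hsq
    have h2 := (Real.continuous_sqrt.tendsto _).comp (hsq.const_mul (2 * D.L)⁻¹)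
    simp only [Function.comp_def, mul_zero, Real.sqrt_zero] at h2
    refine h2.congr fun N => ?_
    rw [inv_mul_cancel_left₀ (by positivity), Real.sqrt_sq (norm_nonneg _)]
  have hV : Tendsto (fun N => D.shiftOp θ s σ κ N (y N)) atTop (𝓝 w') := by
    have h1 := D.tendsto_shiftOp θ s σ κ (w := w) (w' := w') fun n => by rw [hcw, hw]
    have h2 : Tendsto (fun N => D.shiftOp θ s σ κ N (y N - w)) atTop (𝓝 0) := by
      refine squeeze_zero_norm (fun N => ?_) (tendsto_iff_norm_sub_tendsto_zero.1 hyw)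
      have := (D.shiftOp θ s σ κ N).le_of_opNorm_le (D.norm_shiftOp_le θ s σ κ N) (y N - w)
      simpa using this
    have h3 := h1.add h2
    rw [add_zero] at h3
    refine h3.congr fun N => ?_
    rw [map_sub, add_sub_cancel]
  have hcos : Tendsto (fun N => (((σ : ℤ) * D.L / Real.pi *
      Real.cos (D.eps N * (Real.pi / D.L * κ) / 4) ^ 2 : ℝ) : ℂ)) atTop
      (𝓝 (((σ : ℤ) * D.L / Real.pi : ℝ) : ℂ)) := by
    have hcont : Continuous fun x : ℝ => (((σ : ℤ) * D.L / Real.pi *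
      Real.cos (x * (Real.pi / D.L * κ) / 4) ^ 2 : ℝ) : ℂ) := by fun_prop
    have := (hcont.tendsto 0).comp D.tendsto_eps
    simpa [Function.comp_def] using this
  have hlim := hcos.smul hV
  have hζ' : (((σ : ℤ) * D.L / Real.pi : ℝ) : ℂ) • w' = ζ := by
    rw [hw', smul_smul]
    convert one_smul ℂ ζ
    push_cast
    field_simp
    linear_combination hσ
  rw [hζ'] at hlim
  refine hlim.congr' ?_
  filter_upwards [eventually_ge_atTop M] with N hN
  obtain ⟨η, rfl⟩ := hM N hN
  rw [oneParticle_R]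
  congr 2
  refine D.inner_wave_ext θ fun m => ?_
  rw [hy, inner_wave_R_sinOp]

end Approximant

/-! ### The approximants as derivations on Fock space -/

section FockApproximant

variable (σ : ℤˣ) (κ : ℤ)

lemma fockRep_alpha_kooSaleur (N : ℕ) : fockRep (D.alpha s θ N (D.kooSaleur σ θ κ N)) =
    (((σ : ℤ) / (2 * Real.pi) : ℝ) : ℂ) • ∑ n ∈ Finset.Ico (-(D.len N : ℤ)) (D.len N),
    ((Real.cos (D.eps N * (Real.pi / D.L * κ) / 4) ^ 2 *
      Real.sin (D.eps N * (D.mom θ n - (σ : ℤ) * (Real.pi / D.L * κ) / 2)) : ℝ) : ℂ) •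
    (create (D.R s θ N (D.latWave N (D.mom θ (n - σ * κ)))) *
      annihilate (D.R s θ N (D.latWave N (D.mom θ n)))) := by
  simp only [kooSaleur, alpha, map_smul, map_sum, map_mul, carMap_cr, carMap_an, fockRep_cr,
    fockRep_an]

lemma fockRep_alpha_kooSaleur_vacuum (N : ℕ) :
    fockRep (D.alpha s θ N (D.kooSaleur σ θ κ N)) vacuum = 0 := by
  rw [fockRep_alpha_kooSaleur, smul_apply, _root_.sum_apply, Finset.sum_eq_zero, smul_zero]
  intro n _
  rw [smul_apply, mul_apply_eq_comp, annihilate_vacuum, map_zero, smul_zero]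

/-- Moving `a†(ξ)` to the left past `a(g)` and `a†(f)` costs two signs, which cancel; only the
contraction `⟪g, ξ⟫` remains. Hence normal-ordered quadratic expressions satisfy the Leibniz rule.
-/
lemma create_annihilate_create {h : Type*} [NormedAddCommGroup h] [InnerProductSpace ℂ h]
    (f g ξ : h) (w : Fock h) : create f (annihilate g (create ξ w)) =
      ⟪g, ξ⟫_ℂ • create f w + create ξ (create f (annihilate g w)) := by
  have h1 : annihilate g (create ξ w) = ⟪g, ξ⟫_ℂ • w - create ξ (annihilate g w) := by
    have := congrArg (fun A => A w) (car g ξ)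
    simp only [add_apply, mul_apply_eq_comp, smul_apply, one_apply_eq_self] at this
    rw [← this, add_sub_cancel_right]
  have h2 : create f (create ξ (annihilate g w)) = -create ξ (create f (annihilate g w)) := by
    have := congrArg (fun A => A (annihilate g w)) (create_anticomm f ξ)
    simp only [add_apply, mul_apply_eq_comp, zero_apply] at this
    exact eq_neg_of_add_eq_zero_left this
  rw [h1, map_sub, map_smul, h2, sub_neg_eq_add]

lemma fockRep_alpha_kooSaleur_create (N : ℕ) (ξ : D.ContSpace) (w : Fock D.ContSpace) :
    fockRep (D.alpha s θ N (D.kooSaleur σ θ κ N)) (create ξ w) =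
      create (D.oneParticle θ s σ κ N ξ) w +
        create ξ (fockRep (D.alpha s θ N (D.kooSaleur σ θ κ N)) w) := by
  rw [fockRep_alpha_kooSaleur, ← createCLM_apply (D.oneParticle θ s σ κ N ξ), oneParticle]
  simp only [map_smul, map_sum, smul_apply, _root_.sum_apply, mul_apply_eq_comp,
    create_annihilate_create, smul_add, Finset.sum_add_distrib, createCLM_apply]

end FockApproximant

/-! ### The wavelet Fock space as a core of the Virasoro generator -/

section Virasoro

variable {s} (σ : ℤˣ) (κ : ℤ)

lemma secondQuant_ell_isClosable : (secondQuant (D.ell σ θ κ)).IsClosable :=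
  secondQuant_isClosable (T' := D.ell σ θ (-κ)) (D.ell_formal_adjoint θ σ κ)
    ((D.dense_trigPoly θ).mono (D.trigPoly_le_ell_domain θ σ (-κ)))

lemma virasoro_hasCore (hs : s.Regular) :
    (D.virasoro σ θ κ).HasCore (algFock (D.waveletSpan s θ)) := by
  have hcl := D.secondQuant_ell_isClosable θ σ κ
  have hV : (D.virasoro σ θ κ).IsClosed := hcl.closure_isClosed
  have hdom : algFock (D.waveletSpan s θ) ≤ (secondQuant (D.ell σ θ κ)).domain :=
    algFock_mono (D.waveletSpan_le_ell_domain θ σ κ hs)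
  have hle : secondQuant (D.ell σ θ κ) ≤ D.virasoro σ θ κ := LinearPMap.le_closure _
  refine ⟨hdom.trans hle.1, ?_⟩
  set f := (D.virasoro σ θ κ).domRestrict (algFock (D.waveletSpan s θ)) with hf
  have hfle : f ≤ D.virasoro σ θ κ := LinearPMap.domRestrict_le
  have hfc : f.IsClosable := hV.isClosable.leIsClosable hfle
  refine LinearPMap.eq_of_eq_graph ?_
  rw [← hfc.graph_closure_eq_closure_graph]
  -- Only the second inclusion has content. By closedness it is enough to approximate the pairs of
  -- `dF₀(ℓ_{±,k})` itself, and this is the lifted one-particle core property.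
  refine le_antisymm (Submodule.topologicalClosure_minimal _ (LinearPMap.le_graph_of_le hfle) hV) ?_
  rw [virasoro, ← hcl.graph_closure_eq_closure_graph]
  refine Submodule.topologicalClosure_minimal _ ?_ (Submodule.isClosed_topologicalClosure _)
  refine (secondQuant_graph_le_closure (D.ell_graph_le_closure θ σ κ hs)).trans
    (Submodule.topologicalClosure_mono ?_)
  rintro ⟨u, v⟩ ⟨h1, h2⟩
  obtain ⟨y, hy1, hy2⟩ := (LinearPMap.mem_graph_iff _).1 (LinearPMap.le_graph_of_le hle h1)
  rw [LinearPMap.mem_graph_iff]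
  refine ⟨⟨y, ⟨?_, y.2⟩⟩, hy1, ?_⟩
  · rw [hy1]; exact h2
  · rw [← hy2]; exact LinearPMap.domRestrict_apply rfl

end Virasoro

end LatticeData
end KS

end

/-! ### The main theorem -/

theorem mainTheorem4 (D : KS.LatticeData) (s : KS.ScalingFunction) (hs : s.Regular)
    (σ θ : ℤˣ) (κ : ℤ) :
    Dense (KS.algFock (D.waveletSpan s θ) : Set (KS.Fock D.ContSpace)) ∧
    (D.virasoro σ θ κ).HasCore (KS.algFock (D.waveletSpan s θ)) ∧
    ∀ (n : ℕ) (ξ : Fin n → D.ContSpace), (∀ i, ξ i ∈ D.waveletSpan s θ) →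
      ∃ h : KS.fockVector ξ ∈ (D.virasoro σ θ κ).domain,
        Filter.Tendsto
          (fun N : ℕ => ‖KS.fockRep (D.alpha s θ N (D.kooSaleur σ θ κ N)) (KS.fockVector ξ) -
            D.virasoro σ θ κ ⟨KS.fockVector ξ, h⟩‖)
          Filter.atTop (nhds 0) := by
  refine ⟨KS.dense_algFock (D.dense_waveletSpan θ s), D.virasoro_hasCore θ σ κ hs,
    fun n ξ hξ => ?_⟩
  obtain ⟨v, hv, hlim⟩ := KS.tendsto_fockVector (T := D.ell σ θ κ)
    (D.fockRep_alpha_kooSaleur_vacuum θ s σ κ) (D.fockRep_alpha_kooSaleur_create θ s σ κ) ξ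
    fun i => by
      obtain ⟨ζ, hζ⟩ := (D.mem_ell_domain_iff θ σ κ).1
        (D.waveletSpan_le_ell_domain θ σ κ hs (hξ i))
      exact ⟨ζ, by rw [D.ell_graph]; exact hζ, D.tendsto_oneParticle θ s σ κ (hξ i) hζ⟩
  -- The product vector lies already in the domain of `dF₀(ℓ_{±,k})`, and the limit `v` is its image
  -- there; the closure extends this operator.
  have hle : KS.secondQuant (D.ell σ θ κ) ≤ D.virasoro σ θ κ := LinearPMap.le_closure _
  obtain ⟨y, hy1, hy2⟩ := (LinearPMap.mem_graph_iff _).1 (LinearPMap.le_graph_of_le hle hv)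
  simp only at hy1 hy2
  have h : KS.fockVector ξ ∈ (D.virasoro σ θ κ).domain := hy1 ▸ y.2
  refine ⟨h, ?_⟩
  have hval : D.virasoro σ θ κ ⟨KS.fockVector ξ, h⟩ = v := by
    rw [← hy2]
    congr 1
    exact Subtype.ext hy1.symm
  rw [hval]
  exact tendsto_iff_norm_sub_tendsto_zero.1 hlim
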